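/- Let $S=\mathbb{C}[x^0,\ldots,x^n]$ and let $f\in S$ be homogeneous of degree $\nu=n+1$ and nonsingular (its partial derivatives $f_i=\partial f/\partial x^i$ do not vanish simultaneously at any point of $X=\{f=0\}\subset\mathbb{P}^n$). **The space $\tilde R$.** Let $S^{[m]}$ be the space of homogeneous polynomials of degree $m$, let $J_f=(f_0,\ldots,f_n)$, let $R^k=\operatorname{Image}(S^{[k\nu]}\to S/J_f)$, $R=\bigoplus_k R^k\subset S/J_f$, and let $$\tilde R=R\oplus\mathbb{C}e_0\oplus\cdots\oplus\mathbb{C}e_{n-1},$$ graded by $\deg[h]=2k$ for $h\in S^{[k\nu]}$ and $\deg e_k=n-1$. **The complex $(\mathcal{C},D)$.** Let $T=S[y]$ with $y$ odd of degree $-1$ and weight $\nu$ (each $x^i$ has degree $0$ and weight $1$), and let $L$ be the free graded $T$-module with basis $e,\partial_0,\ldots,\partial_n,\partial$, that is, $\operatorname{Der}(T)\oplus Te$ with $\partial_i=\partial/\partial x^i$, $\partial=\partial/\partial y$. The graded symmetric algebra of $L[1]$ over $T$ is the free graded commutative $S$-algebra on $y,\partial_i,e,\partial$, now of degrees $-1,1,0,2$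 and weights $\nu,-1,0,-\nu$. It carries the $S$-linear derivation $d_f$ of degree one and weight zero with $$d_f y=f,\qquad d_f\partial_i=f_i\,\partial,\qquad d_f\partial=0,\qquad d_f e=\sum_{k=0}^n x^k\partial_k-\nu\,y\,\partial .$$ Put $F=\bigoplus_{k=0}^{n-1}\mathcal{S}^k_T(L[1])$, and let $\mathfrak{F}$ be the associated complex of sheaves on $\mathbb{P}^n$: for $U_\sigma=\bigcap_{i\in\sigma}\{x^i\ne0\}$, $\Gamma(U_\sigma,\mathfrak{F}^q)$ is the degree-$q$, weight-zero part of $F[(\prod_{i\in\sigma}x^i)^{-1}]$. Let $C^p(\mathfrak{F}^q)=\prod_{i_0<\cdots<i_p}\Gamma(U_{i_0\cdots i_p},\mathfrak{F}^q)$ be the Čech cochains for the standard cover, with Čech differential $\check\delta$, let $\mathcal{C}^m=\bigoplus_{p+q=m}C^p(\mathfrak{F}^q)$, and let $D=\check\delta+d_f$, where $d_f$ is taken with the usual sign $(-1)^p$ on $C^p$, so that $D^2=0$. **Theorem.** There is an isomorphism of graded vector spaces $\Phi:\tilde R\xrightarrow{\ \simeq\ }H(\mathcal{C},D)$. It can be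 chosen so that * for $0\le p\le n-1$ and $h\in S^{[p\nu]}$, $\Phi([h])$ is the class of the Čech $0$-cocycle whose component on every $U_i$ is $h\,\partial^p$ (so that Čech degree $0$ contributes $\bigoplus_p R^p$); * for $0\le k\le n-1$, $\Phi(e_k)$ is the class of a $D$-cocycle of total degree $n-1$ whose component of Čech degree $n$ is $\dfrac{y\,e^k}{x^0\cdots x^n}$ (so that Čech degree $n$ contributes the classes $e_k$). -/

import Mathlib

/-! Notation: `x^0, …, x^n` are the homogeneous coordinates of `ℙⁿ` over `ℂ`, and `f` is a
homogeneous polynomial of degree `ν = n + 1`. -/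

noncomputable section

namespace CYCech

open MvPolynomial

/-! ### The Jacobian ring and the target `R̃` -/

/-- The hypersurface `{f = 0} ⊆ ℙⁿ` is nonsingular: at every point of it (given by a non-zero
vector) some partial derivative of `f` does not vanish. -/
def IsNonsingular {n : ℕ} (f : MvPolynomial (Fin (n + 1)) ℂ) : Prop :=
  ∀ x : Fin (n + 1) → ℂ, x ≠ 0 → eval x f = 0 → ∃ i, eval x (pderiv i f) ≠ 0

/-- The ideal `J_f` generated by the partial derivatives of `f`. -/
def jacobianIdeal {n : ℕ} (f : MvPolynomial (Fin (n + 1)) ℂ) :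
    Ideal (MvPolynomial (Fin (n + 1)) ℂ) :=
  Ideal.span (Set.range fun i => pderiv i f)

/-- The quotient map `S → S / J_f`, as a `ℂ`-linear map. -/
def toJacobian {n : ℕ} (f : MvPolynomial (Fin (n + 1)) ℂ) :
    MvPolynomial (Fin (n + 1)) ℂ →ₗ[ℂ] MvPolynomial (Fin (n + 1)) ℂ ⧸ jacobianIdeal f :=
  (Ideal.Quotient.mkₐ ℂ (jacobianIdeal f)).toLinearMap

/-- `R = Image (⨁ₖ S^{[kν]} → S / J_f)`. -/
def R {n : ℕ} (f : MvPolynomial (Fin (n + 1)) ℂ) :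
    Submodule ℂ (MvPolynomial (Fin (n + 1)) ℂ ⧸ jacobianIdeal f) :=
  (⨆ k : ℕ, homogeneousSubmodule (Fin (n + 1)) ℂ (k * (n + 1))).map (toJacobian f)

/-- The class `[h] ∈ R` of a homogeneous polynomial `h ∈ S^{[kν]}`. -/
def R.mk {n : ℕ} (f : MvPolynomial (Fin (n + 1)) ℂ) {k : ℕ} {h : MvPolynomial (Fin (n + 1)) ℂ}
    (hh : h.IsHomogeneous (k * (n + 1))) : R f :=
  ⟨toJacobian f h, Submodule.mem_map_of_mem <|
    Submodule.mem_iSup_of_mem k ((mem_homogeneousSubmodule _ _).2 hh)⟩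

/-- The vector space `R̃ = R ⊕ ℂ e₀ ⊕ ⋯ ⊕ ℂ e_{n-1}`. -/
abbrev RTilde {n : ℕ} (f : MvPolynomial (Fin (n + 1)) ℂ) : Type := R f × (Fin n → ℂ)

/-- The element `[h] ∈ R ⊆ R̃`. -/
def RTilde.ofPoly {n : ℕ} (f : MvPolynomial (Fin (n + 1)) ℂ) {k : ℕ}
    {h : MvPolynomial (Fin (n + 1)) ℂ} (hh : h.IsHomogeneous (k * (n + 1))) : RTilde f :=
  (R.mk f hh, 0)

/-- The element `e_k ∈ R̃`. -/
def RTilde.e {n : ℕ} (f : MvPolynomial (Fin (n + 1)) ℂ) (k : Fin n) : RTilde f :=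
  (0, Pi.single k 1)

/-- The part of `R̃` of degree `m`, where `deg [h] = 2k` for `h ∈ S^{[kν]}` and
`deg e_k = n - 1`. -/
def RTilde.degreePart {n : ℕ} (f : MvPolynomial (Fin (n + 1)) ℂ) (m : ℤ) :
    Submodule ℂ (RTilde f) :=
  Submodule.span ℂ
    ({ v | ∃ (k : ℕ) (h : MvPolynomial (Fin (n + 1)) ℂ) (hh : h.IsHomogeneous (k * (n + 1))),
        m = 2 * (k : ℤ) ∧ v = RTilde.ofPoly f hh } ∪
     { v | ∃ k : Fin n, m = (n : ℤ) - 1 ∧ v = RTilde.e f k })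

/-! ### The graded commutative algebra `F`, localized at `x^0 ⋯ x^n`

`T = S[y]` with `y` odd, and `L` is the free graded `T`-module with basis `e, ∂₀, …, ∂ₙ, ∂` in
degrees `-1, 0, …, 0, 1` (that is, `Der T ⊕ T e`).  After the shift by one, `e` and `∂` are even
and the `∂ᵢ` are odd, so the graded symmetric algebra of `L[1]` over `T` is
`S[∂, e] ⊗ Λ(y, ∂₀, …, ∂ₙ)`.  Below `S` is replaced by the ring of Laurent polynomials
`ℂ[x^0, …, x^n, 1/x^0, …, 1/x^n]`; the sections over the open sets of the standard cover and the
truncation `⨁_{k ≤ n-1} 𝒮^k (L[1])` are cut out as subspaces afterwards. -/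

/-- The ring `ℂ[x^0, …, x^n, 1/x^0, …, 1/x^n][∂]` generated by the even generators other than `e`;
the exponent `(m, c)` stands for the monomial `∏ (x^i)^{mᵢ} ∂^c`. -/
abbrev Coeff (n : ℕ) : Type := AddMonoidAlgebra ℂ ((Fin (n + 1) → ℤ) × ℕ)

/-- The exterior algebra on the odd generators `y` (index `none`) and `∂ᵢ` (index `some i`). -/
abbrev Ext (n : ℕ) : Type := ExteriorAlgebra (Coeff n) (Option (Fin (n + 1)) → Coeff n)

/-- The whole algebra; the polynomial variable is the even generator `e`, of degree `0` and
weight `0`. -/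
abbrev Alg (n : ℕ) : Type := Polynomial (Ext n)

/-- The odd generator `y`, of degree `-1` and weight `ν`. -/
def yGen (n : ℕ) : Ext n := ExteriorAlgebra.ι (Coeff n) (Pi.single none 1)

/-- The odd generator `∂ᵢ`, of degree `1` and weight `-1`. -/
def dGen {n : ℕ} (i : Fin (n + 1)) : Ext n := ExteriorAlgebra.ι (Coeff n) (Pi.single (some i) 1)

/-- The Laurent monomial `∏ (x^i)^{mᵢ}`; here `x^i` has degree `0` and weight `1`. -/
def xMon {n : ℕ} (m : Fin (n + 1) → ℤ) : Coeff n := AddMonoidAlgebra.single (m, 0) 1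

/-- The even generator `∂ = ∂/∂y`, of degree `2` and weight `-ν`. -/
def bdry (n : ℕ) : Coeff n := AddMonoidAlgebra.single (0, 1) 1

/-- A polynomial in `x^0, …, x^n`, as an element of `Coeff n`. -/
def ofPoly {n : ℕ} : MvPolynomial (Fin (n + 1)) ℂ →ₐ[ℂ] Coeff n :=
  aeval fun i => xMon (Pi.single i 1)

/-- The monomial `x^m ∂^c e^a y^ε ∂_{i₁} ⋯ ∂_{i_r}`, where `i₁ < ⋯ < i_r` are the elements
of `I`. -/
def mono {n : ℕ} (m : Fin (n + 1) → ℤ) (c a ε : ℕ) (I : Finset (Fin (n + 1))) : Alg n :=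
  Polynomial.monomial a ((xMon m * bdry n ^ c) • (yGen n ^ ε * ((I.sort (· ≤ ·)).map dGen).prod))

/-- The linear form with `y ↦ f` and `∂ᵢ ↦ fᵢ ∂`. -/
def koszulForm {n : ℕ} (f : MvPolynomial (Fin (n + 1)) ℂ) :
    Module.Dual (Coeff n) (Option (Fin (n + 1)) → Coeff n) :=
  Fintype.linearCombination (Coeff n)
    (fun o : Option (Fin (n + 1)) => o.elim (ofPoly f) fun i => ofPoly (pderiv i f) * bdry n)

/-- `d_f e = ∑ₖ x^k ∂ₖ - ν y ∂`. -/
def eulerElt (n : ℕ) : Ext n :=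
  ∑ k : Fin (n + 1), ofPoly (X k) • dGen k - ((n + 1 : Coeff n) * bdry n) • yGen n

/-- The differential `d_f`: the odd derivation, linear over the Laurent polynomials, with
`d_f y = f`, `d_f ∂ᵢ = fᵢ ∂`, `d_f ∂ = 0` and `d_f e = ∑ₖ x^k ∂ₖ - ν y ∂`.  On the coefficients of
the powers of `e` it is the contraction with `koszulForm f`, which is the odd derivation with the
first three properties; and `d_f (e^a) = a e^{a-1} d_f e`. -/
def dAlg {n : ℕ} (f : MvPolynomial (Fin (n + 1)) ℂ) : Alg n →ₗ[ℂ] Alg n :=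
  (Polynomial.lsum fun a => (Polynomial.monomial (R := Ext n) a).restrictScalars (Coeff n) ∘ₗ
      CliffordAlgebra.contractLeft (koszulForm f)).restrictScalars ℂ +
    LinearMap.mulLeft ℂ (Polynomial.C (eulerElt n)) ∘ₗ
      (Polynomial.derivative (R := Ext n)).restrictScalars ℂ

/-! ### The Čech complex -/

/-- `Γ(U_σ, 𝔉^q)` for `U_σ = ⋂_{i ∈ σ} {x^i ≠ 0}`: the span of the monomials
`x^m ∂^c e^a y^ε ∂_I` in which only the `x^i` with `i ∈ σ` may have negative exponents, of
weight zero, of degree `q`, and lying in `𝒮^k (L[1])` for some `k ≤ n - 1`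
(the generators `e, ∂ᵢ, ∂` count for `k`, the variables `x^i, y` do not). -/
def sections (n : ℕ) (σ : Finset (Fin (n + 1))) (q : ℤ) : Submodule ℂ (Alg n) :=
  Submodule.span ℂ { w | ∃ (m : Fin (n + 1) → ℤ) (c a ε : ℕ) (I : Finset (Fin (n + 1))),
    w = mono m c a ε I ∧ ε ≤ 1 ∧
    (∀ i, i ∉ σ → 0 ≤ m i) ∧
    (∑ i, m i) + (n + 1) * ε - I.card - (n + 1) * c = 0 ∧
    2 * (c : ℤ) + I.card - ε = q ∧
    c + a + I.card < n }

/-- Families of elements indexed by the sets `σ = {i₀ < ⋯ < i_p}` of indices. -/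
abbrev PreCochain (n : ℕ) : Type := Finset (Fin (n + 1)) → Alg n

/-- `𝒞^m = ⨁_{p+q=m} C^p(𝔉^q)`, where a Čech `p`-cochain has one component in `Γ(U_σ, 𝔉^q)` for
every `σ` with `p + 1` elements. -/
def cochains (n : ℕ) (m : ℤ) : Submodule ℂ (PreCochain n) where
  carrier := { c | c ∅ = 0 ∧ ∀ σ, σ.Nonempty → c σ ∈ sections n σ (m - ((σ.card : ℤ) - 1)) }
  add_mem' := fun ha hb => ⟨by simp [ha.1, hb.1], fun σ hσ => add_mem (ha.2 σ hσ) (hb.2 σ hσ)⟩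
  zero_mem' := ⟨rfl, fun _ _ => zero_mem _⟩
  smul_mem' := fun r _ ha =>
    ⟨by simp [ha.1], fun σ hσ => Submodule.smul_mem _ r (ha.2 σ hσ)⟩

/-- The Čech differential, `(δc)_{i₀ ⋯ i_p} = ∑ⱼ (-1)^j c_{i₀ ⋯ îⱼ ⋯ i_p}`. -/
def cechDiff (n : ℕ) : PreCochain n →ₗ[ℂ] PreCochain n :=
  LinearMap.pi fun σ => ∑ i ∈ σ,
    ((-1 : ℂ) ^ (σ.filter (· < i)).card) • LinearMap.proj (σ.erase i)

/-- The total differential `D = δ + (-1)^p d_f` on Čech `p`-cochains. -/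
def totalDiff {n : ℕ} (f : MvPolynomial (Fin (n + 1)) ℂ) : PreCochain n →ₗ[ℂ] PreCochain n :=
  cechDiff n + LinearMap.pi fun σ =>
    ((-1 : ℂ) ^ (σ.card + 1)) • (dAlg f ∘ₗ LinearMap.proj σ)

/-- Cocycles of degree `m`. -/
def cocycles {n : ℕ} (f : MvPolynomial (Fin (n + 1)) ℂ) (m : ℤ) : Submodule ℂ (PreCochain n) :=
  cochains n m ⊓ LinearMap.ker (totalDiff f)

/-- Coboundaries of degree `m`. -/
def coboundaries {n : ℕ} (f : MvPolynomial (Fin (n + 1)) ℂ) (m : ℤ) :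
    Submodule ℂ (PreCochain n) :=
  (cochains n (m - 1)).map (totalDiff f)

/-- `H^m(𝒞, D)`. -/
abbrev Cohomology {n : ℕ} (f : MvPolynomial (Fin (n + 1)) ℂ) (m : ℤ) : Type :=
  cocycles f m ⧸ (coboundaries f m).submoduleOf (cocycles f m)

/-- The total cohomology `H(𝒞, D) = ⨁ₘ H^m(𝒞, D)`. -/
abbrev TotalCohomology {n : ℕ} (f : MvPolynomial (Fin (n + 1)) ℂ) : Type :=
  DirectSum ℤ fun m => Cohomology f m

/-- The class in `H(𝒞, D)` of a cocycle of degree `m`. -/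
def cocycleClass {n : ℕ} {f : MvPolynomial (Fin (n + 1)) ℂ} {m : ℤ} (z : cocycles f m) :
    TotalCohomology f :=
  DirectSum.lof ℂ ℤ (fun m => Cohomology f m) m (Submodule.Quotient.mk z)

/-- The Čech `0`-cochain with component `h ∂^p` over every `U_i`. -/
def primitiveCochain {n : ℕ} (h : MvPolynomial (Fin (n + 1)) ℂ) (p : ℕ) : PreCochain n :=
  fun σ => if σ.card = 1 then Polynomial.C (algebraMap _ _ (ofPoly h * bdry n ^ p)) else 0

/-- The element `y e^k / (x^0 ⋯ x^n)`. -/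
def eElt (n : ℕ) (k : ℕ) : Alg n :=
  Polynomial.monomial k ((xMon fun _ => -1 : Coeff n) • yGen n)

end CYCech

end

/-! The theorem holds because of three facts about monomials of weight zero, `x^m ∂^c e^a` times a
product of the odd generators `y`, `∂ᵢ`.

*Čech cohomology.* The Čech complex of the standard cover splits into pieces, one for each exponent
`m` of the Laurent variables. A piece is acyclic unless no exponent is negative, when it contributes
the global sections in Čech degree `0`, or all exponents are negative, when it contributes a copy of
the monomial in Čech degree `n` (`cech_exact`). In weight zero the monomials with only negative
exponents are the `y e^k / (x^0 ⋯ x^n)`, all of degree `-1` (`eq_of_forall_neg`). Descending through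
the Čech degrees (`exists_reduce`), every cocycle is therefore cohomologous to a combination of
cocycles that extend the `y e^k / (x^0 ⋯ x^n)` plus a closed global section
(`exists_decomposition`).

*Global sections.* The contraction `ι` with the coordinate form of `y` satisfies
`ι d_f + d_f ι = -ν ∂ ∂/∂e` (`contr_none_dAlg`). In weight zero and symmetric degree at most `n`, a
global section that contains `y` must be divisible by `∂`, so that `ι` can be divided by `∂`
(`exists_bdry_smul_eq_contr`). The quotient is a homotopy that replaces a closed section by one free
of `e` and `y` (`exists_free_representative`). On such sections `d_f` is `∂` times the Koszul
differential of the partial derivatives `fᵢ`. By the Nullstellensatz some power of each `x^i` lies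
in `J_f`, so that the Koszul complex is exact over each open set of the cover, and the Čech argument
turns this into exactness over `S` in positive homological degrees and into the vanishing of
`S / J_f` above the degree `(n+1)(n-1)` (`koszul_exact`). What remains are the elements `h ∂^k`
(`row_cohomology`), which are exact precisely if `h ∈ J_f` (`exists_dAlg_eq_polyElt`,
`polyPart_dAlg_mem`).

*Extension of the elements in Čech degree `n`.* A cochain with component
`y e^(k+1) / (x^0 ⋯ x^n)` over the smallest open set can be chosen such that its total differential
is a closed global section `u`. The derivation `∂/∂e` commutes with `D`, lowers `k + 1` to `k`, and
makes `u` exact, because `-ν ∂u/∂e` is the differential of `ι u / ∂` (`exists_cocycle`). The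
obstruction for `k < n` thus disappears.

The map `h ↦ h ∂^p`, which kills `J_f`, and the extended cocycles define the map `comparison`. It
is surjective by `exists_representative` and injective by `eq_zero_of_eq_totalDiff`, because `R^k`
vanishes for `k ≥ n` (`mem_jacobianIdeal_of_le`). -/

noncomputable section

namespace CYCech

open MvPolynomial Module

/-! ### Monomials of an exterior algebra -/

section ExteriorMonomials

variable {A : Type*} [CommRing A] {M : Type*} [AddCommGroup M] [Module A M] {I : Type*}

/-- The product in the exterior algebra of a list of members of the family `v`. -/
def listWedge (v : I → M) (l : List I) : ExteriorAlgebra A M :=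
  (l.map fun i => ExteriorAlgebra.ι A (v i)).prod

lemma listWedge_cons (v : I → M) (i : I) (l : List I) :
    listWedge (A := A) v (i :: l) = ExteriorAlgebra.ι A (v i) * listWedge v l := rfl

lemma listWedge_perm (v : I → M) {l l' : List I} (h : l.Perm l') :
    ∃ u : ℤˣ, listWedge (A := A) v l = u • listWedge v l' := by
  induction h with
  | nil => exact ⟨1, (one_smul _ _).symm⟩
  | cons i _ ih =>
    obtain ⟨u, hu⟩ := ih
    refine ⟨u, ?_⟩
    rw [listWedge_cons, listWedge_cons, hu, Units.smul_def, Units.smul_def, mul_smul_comm]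
  | swap i j l =>
    refine ⟨-1, ?_⟩
    simp only [listWedge_cons, ← mul_assoc]
    have h := ExteriorAlgebra.ι_add_mul_swap (R := A) (v i) (v j)
    rw [← eq_neg_iff_add_eq_zero] at h
    rw [h]
    simp [Units.smul_def]
  | trans _ _ ih ih' =>
    obtain ⟨u, hu⟩ := ih
    obtain ⟨u', hu'⟩ := ih'
    exact ⟨u * u', by rw [hu, hu', mul_smul]⟩

lemma basis_exteriorAlgebra_eq_listWedge [LinearOrder I] (b : Basis I A M) (s : Finset I) :
    b.ExteriorAlgebra s = listWedge b (s.sort (· ≤ ·)) := by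
  rw [ExteriorAlgebra.basis_apply_ofCard (n := s.card) b rfl, ExteriorAlgebra.ιMulti_family,
    ExteriorAlgebra.ιMulti_apply, listWedge]
  congr 1
  apply List.ext_getElem
  · simp
  · intro k h₁ h₂
    simp only [List.getElem_ofFn, List.getElem_map, Function.comp_apply,
      Set.powersetCard.ofFinEmbEquiv_symm_apply]
    exact congrArg (fun j => ExteriorAlgebra.ι A (b j))
      (Finset.orderEmbOfFin_apply s rfl ⟨k, by simpa using h₁⟩)

lemma basis_exteriorAlgebra_eq_smul_listWedge [LinearOrder I] (b : Basis I A M) {s : Finset I}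
    {l : List I} (hl : l.Nodup) (h : ∀ j, j ∈ l ↔ j ∈ s) :
    ∃ u : ℤˣ, b.ExteriorAlgebra s = u • listWedge b l := by
  rw [basis_exteriorAlgebra_eq_listWedge]
  exact listWedge_perm b ((List.perm_ext_iff_of_nodup (Finset.sort_nodup _ _) hl).2
    fun j => by simp [h])

lemma basis_exteriorAlgebra_empty [LinearOrder I] (b : Basis I A M) :
    b.ExteriorAlgebra ∅ = 1 := by
  rw [basis_exteriorAlgebra_eq_listWedge]
  simp [listWedge]

lemma basis_exteriorAlgebra_singleton [LinearOrder I] (b : Basis I A M) (j : I) :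
    b.ExteriorAlgebra {j} = ExteriorAlgebra.ι A (b j) := by
  rw [basis_exteriorAlgebra_eq_listWedge]
  simp [listWedge]

end ExteriorMonomials

variable {n : ℕ}

/-- The linear order on the indices of the odd generators in which the index of `y` is least. -/
abbrev oddOrder (n : ℕ) : LinearOrder (Option (Fin (n + 1))) :=
  inferInstanceAs (LinearOrder (WithBot (Fin (n + 1))))

/-- The odd generators: `y` for `none` and `∂ᵢ` for `some i`. -/
def oddGen (j : Option (Fin (n + 1))) : Ext n := ExteriorAlgebra.ι (Coeff n) (Pi.single j 1)

/-- The basis of the exterior algebra given by the products of the odd generators. -/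
def extBasis (n : ℕ) : Basis (Finset (Option (Fin (n + 1)))) (Coeff n) (Ext n) :=
  letI := oddOrder n
  (Pi.basisFun (Coeff n) (Option (Fin (n + 1)))).ExteriorAlgebra

/-- The product of the odd generators indexed by the members of a list. -/
def wedge (l : List (Option (Fin (n + 1)))) : Ext n := (l.map oddGen).prod

lemma wedge_nil : wedge ([] : List (Option (Fin (n + 1)))) = 1 := rfl

lemma wedge_cons (j : Option (Fin (n + 1))) (l : List (Option (Fin (n + 1)))) :
    wedge (j :: l) = oddGen j * wedge l := rfl

lemma extBasis_eq_wedge {J : Finset (Option (Fin (n + 1)))} {l : List (Option (Fin (n + 1)))}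
    (hl : l.Nodup) (h : ∀ j, j ∈ l ↔ j ∈ J) : ∃ u : ℤˣ, extBasis n J = u • wedge l := by
  obtain ⟨u, hu⟩ := @basis_exteriorAlgebra_eq_smul_listWedge _ _ _ _ _ _ (oddOrder n)
    (Pi.basisFun (Coeff n) (Option (Fin (n + 1)))) _ _ hl h
  refine ⟨u, hu.trans ?_⟩
  have hb : ⇑(Pi.basisFun (Coeff n) (Option (Fin (n + 1)))) = fun j => Pi.single j 1 := by
    funext j
    simp
  rw [hb]
  rfl

lemma exists_extBasis_eq_wedge (J : Finset (Option (Fin (n + 1)))) :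
    ∃ l : List (Option (Fin (n + 1))), l.Nodup ∧ (∀ j, j ∈ l ↔ j ∈ J) ∧
      ∃ u : ℤˣ, extBasis n J = u • wedge l :=
  ⟨J.toList, J.nodup_toList, fun _ => Finset.mem_toList,
    extBasis_eq_wedge J.nodup_toList fun _ => Finset.mem_toList⟩

lemma extBasis_empty : extBasis n ∅ = 1 := by
  exact @basis_exteriorAlgebra_empty _ _ _ _ _ _ (oddOrder n) _

lemma extBasis_singleton (j : Option (Fin (n + 1))) : extBasis n {j} = oddGen j := by
  refine (@basis_exteriorAlgebra_singleton _ _ _ _ _ _ (oddOrder n) _ _).trans ?_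
  rw [Pi.basisFun_apply]
  rfl

lemma extBasis_insert {J : Finset (Option (Fin (n + 1)))} {j : Option (Fin (n + 1))}
    (hj : j ∉ J) : ∃ u : ℤˣ, oddGen j * extBasis n J = u • extBasis n (insert j J) := by
  obtain ⟨l, hl, hlJ, u, hu⟩ := exists_extBasis_eq_wedge J
  obtain ⟨u', hu'⟩ := extBasis_eq_wedge (J := insert j J) (l := j :: l)
    (List.nodup_cons.2 ⟨fun h => hj ((hlJ j).1 h), hl⟩) (fun i => by simp [hlJ])
  refine ⟨u * u'⁻¹, ?_⟩
  rw [hu, hu', wedge_cons, mul_smul, inv_smul_smul, Units.smul_def, Units.smul_def,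
    mul_smul_comm]

lemma oddGen_mul_self (j : Option (Fin (n + 1))) : oddGen j * oddGen j = 0 :=
  ExteriorAlgebra.ι_sq_zero _

lemma extBasis_eq_mul {J : Finset (Option (Fin (n + 1)))} {j : Option (Fin (n + 1))}
    (hj : j ∈ J) : ∃ u : ℤˣ, extBasis n J = u • (oddGen j * extBasis n (J.erase j)) := by
  obtain ⟨u, hu⟩ := extBasis_insert (Finset.notMem_erase j J)
  rw [Finset.insert_erase hj] at hu
  exact ⟨u⁻¹, by rw [hu, inv_smul_smul]⟩

lemma oddGen_mul_extBasis_of_mem {J : Finset (Option (Fin (n + 1)))} {j : Option (Fin (n + 1))}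
    (hj : j ∈ J) : oddGen j * extBasis n J = 0 := by
  obtain ⟨u, hu⟩ := extBasis_eq_mul hj
  rw [hu, Units.smul_def, mul_smul_comm, ← mul_assoc, oddGen_mul_self, zero_mul, smul_zero]

/-- The coordinate form of an odd generator. -/
abbrev coordForm (j : Option (Fin (n + 1))) :
    Module.Dual (Coeff n) (Option (Fin (n + 1)) → Coeff n) := LinearMap.proj j

lemma contractLeft_coordForm_wedge {j : Option (Fin (n + 1))}
    {l : List (Option (Fin (n + 1)))} (hj : j ∉ l) :
    CliffordAlgebra.contractLeft (coordForm j) (wedge l : Ext n) = 0 := by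
  induction l with
  | nil => rw [wedge_nil, CliffordAlgebra.contractLeft_one]
  | cons i l ih =>
    rw [List.mem_cons, not_or] at hj
    rw [wedge_cons, oddGen, CliffordAlgebra.contractLeft_ι_mul, ih hj.2]
    simp [hj.1]

lemma contractLeft_extBasis_of_notMem {J : Finset (Option (Fin (n + 1)))}
    {j : Option (Fin (n + 1))} (hj : j ∉ J) :
    CliffordAlgebra.contractLeft (coordForm j) (extBasis n J : Ext n) = 0 := by
  obtain ⟨l, -, hlJ, u, hu⟩ := exists_extBasis_eq_wedge J
  rw [hu, Units.smul_def, map_zsmul, contractLeft_coordForm_wedge (fun h => hj ((hlJ j).1 h)),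
    smul_zero]

lemma contractLeft_extBasis_of_mem {J : Finset (Option (Fin (n + 1)))}
    {j : Option (Fin (n + 1))} (hj : j ∈ J) :
    ∃ u : ℤˣ, CliffordAlgebra.contractLeft (coordForm j) (extBasis n J : Ext n) =
      u • extBasis n (J.erase j) := by
  obtain ⟨u, hu⟩ := extBasis_eq_mul hj
  refine ⟨u, ?_⟩
  rw [hu, Units.smul_def, map_zsmul, oddGen, CliffordAlgebra.contractLeft_ι_mul,
    contractLeft_extBasis_of_notMem (Finset.notMem_erase j J)]
  simp [Units.smul_def]

/-! ### The monomial basis of the algebra -/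

/-- The exponents of a monomial `x^m ∂^c e^a ∏_{j ∈ J} (odd generator j)`. -/
structure Idx (n : ℕ) where
  /-- the exponents of the `x^i` -/
  m : Fin (n + 1) → ℤ
  /-- the exponent of `∂` -/
  c : ℕ
  /-- the exponent of `e` -/
  a : ℕ
  /-- the odd generators that occur -/
  J : Finset (Option (Fin (n + 1)))

/-- `Idx n` as a product, in the order in which the scalars are adjoined. -/
def idxEquiv (n : ℕ) :
    (((Fin (n + 1) → ℤ) × ℕ) × Finset (Option (Fin (n + 1)))) × ℕ ≃ Idx n where
  toFun i := ⟨i.1.1.1, i.1.1.2, i.2, i.1.2⟩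
  invFun i := (((i.m, i.c), i.J), i.a)
  left_inv _ := rfl
  right_inv _ := rfl

/-- The basis of the algebra over `ℂ` that consists of the monomials. -/
def monBasis (n : ℕ) : Basis (Idx n) ℂ (Alg n) :=
  (((AddMonoidAlgebra.basis ((Fin (n + 1) → ℤ) × ℕ) ℂ).smulTower (extBasis n)).smulTower
    (Polynomial.basisMonomials (Ext n))).reindex (idxEquiv n)

lemma xMon_mul_bdry_pow (m : Fin (n + 1) → ℤ) (c : ℕ) :
    xMon m * bdry n ^ c = AddMonoidAlgebra.single (m, c) 1 := by
  rw [xMon, bdry, AddMonoidAlgebra.single_pow, AddMonoidAlgebra.single_mul_single]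
  simp

lemma monBasis_apply (i : Idx n) :
    monBasis n i = Polynomial.monomial i.a
      ((AddMonoidAlgebra.single (i.m, i.c) 1 : Coeff n) • extBasis n i.J) := by
  rw [monBasis, Basis.reindex_apply, Basis.smulTower_apply, Basis.smulTower_apply,
    AddMonoidAlgebra.basis_apply, Polynomial.coe_basisMonomials, Polynomial.smul_monomial,
    smul_eq_mul, mul_one]
  rfl

/-- The span of the monomials whose exponents satisfy `P`. -/
def Sp (P : Idx n → Prop) : Submodule ℂ (Alg n) := Submodule.span ℂ (monBasis n '' {i | P i})

lemma monBasis_mem {P : Idx n → Prop} {i : Idx n} (h : P i) : monBasis n i ∈ Sp P :=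
  Submodule.subset_span ⟨i, h, rfl⟩

lemma Sp_mono {P Q : Idx n → Prop} (h : ∀ i, P i → Q i) : Sp P ≤ Sp Q :=
  Submodule.span_mono (Set.image_mono h)

lemma Sp_le {P : Idx n → Prop} {W : Submodule ℂ (Alg n)} (h : ∀ i, P i → monBasis n i ∈ W) :
    Sp P ≤ W := by
  refine Submodule.span_le.2 ?_
  rintro _ ⟨i, hi, rfl⟩
  exact h i hi

lemma map_mem_Sp {P Q : Idx n → Prop} (T : Alg n →ₗ[ℂ] Alg n)
    (h : ∀ i, P i → T (monBasis n i) ∈ Sp Q) {w : Alg n} (hw : w ∈ Sp P) : T w ∈ Sp Q :=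
  Sp_le (W := (Sp Q).comap T) h hw

lemma eq_zero_of_mem_Sp {P : Idx n → Prop} (h : ∀ i, ¬ P i) {w : Alg n} (hw : w ∈ Sp P) :
    w = 0 := by
  have : w ∈ (⊥ : Submodule ℂ (Alg n)) := Sp_le (fun i hi => (h i hi).elim) hw
  simpa using this

lemma mem_Sp_true (w : Alg n) : w ∈ Sp (fun _ : Idx n => True) := by
  have : Sp (fun _ : Idx n => True) = ⊤ := by
    rw [Sp, Set.ofPred_true, Set.image_univ, Basis.span_eq]
  rw [this]
  trivial

open Classical in
/-- The projection onto the span of the monomials that satisfy `Q`. -/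
def pr (Q : Idx n → Prop) : Alg n →ₗ[ℂ] Alg n :=
  (monBasis n).constr ℂ fun i => if Q i then monBasis n i else 0

open Classical in
lemma pr_monBasis (Q : Idx n → Prop) (i : Idx n) :
    pr Q (monBasis n i) = if Q i then monBasis n i else 0 :=
  Basis.constr_basis _ _ _ _

lemma pr_mem {P Q : Idx n → Prop} {w : Alg n} (hw : w ∈ Sp P) :
    pr Q w ∈ Sp fun i => P i ∧ Q i := by
  refine map_mem_Sp _ (fun i hi => ?_) hw
  rw [pr_monBasis]
  split_ifs with h
  · exact monBasis_mem ⟨hi, h⟩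
  · exact zero_mem _

lemma pr_eq_self {P Q : Idx n → Prop} (h : ∀ i, P i → Q i) {w : Alg n} (hw : w ∈ Sp P) :
    pr Q w = w := by
  have : w ∈ LinearMap.eqLocus (pr Q) LinearMap.id :=
    Sp_le (fun i hi => by simp [pr_monBasis, h i hi]) hw
  exact this

lemma pr_eq_zero {P Q : Idx n → Prop} (h : ∀ i, P i → ¬ Q i) {w : Alg n} (hw : w ∈ Sp P) :
    pr Q w = 0 := by
  have : w ∈ LinearMap.ker (pr Q) :=
    Sp_le (fun i hi => by simp [pr_monBasis, h i hi]) hw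
  exact this

/-- The projections onto the monomials on which a function takes given values add up to the
identity. -/
lemma sum_pr_eq {P : Idx n → Prop} {κ : Type*} (s : Finset κ) (g : Idx n → κ)
    (h : ∀ i, P i → g i ∈ s) {w : Alg n} (hw : w ∈ Sp P) :
    ∑ k ∈ s, pr (fun i => g i = k) w = w := by
  classical
  have : w ∈ LinearMap.eqLocus (∑ k ∈ s, pr fun i => g i = k) LinearMap.id :=
    Sp_le (fun i hi => by
      simp [pr_monBasis, h i hi, LinearMap.sum_apply]) hw
  simpa [LinearMap.sum_apply] using this

/-! ### Contractions, multiplications and the two differentials -/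

/-- The contraction with a linear form on the odd generators, acting on the coefficients of the
powers of `e`. -/
def contr (φ : Module.Dual (Coeff n) (Option (Fin (n + 1)) → Coeff n)) :
    Alg n →ₗ[Coeff n] Alg n :=
  Polynomial.lsum fun a => (Polynomial.monomial (R := Ext n) a).restrictScalars (Coeff n) ∘ₗ
    CliffordAlgebra.contractLeft φ

lemma contr_monomial (φ : Module.Dual (Coeff n) (Option (Fin (n + 1)) → Coeff n)) (a : ℕ)
    (x : Ext n) : contr φ (Polynomial.monomial a x) =
      Polynomial.monomial a (CliffordAlgebra.contractLeft φ x) := by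
  rw [contr, Polynomial.lsum_apply, Polynomial.sum_monomial_index]
  · rfl
  · simp

lemma contr_add (φ ψ : Module.Dual (Coeff n) (Option (Fin (n + 1)) → Coeff n)) (w : Alg n) :
    contr (φ + ψ) w = contr φ w + contr ψ w := by
  induction w using Polynomial.induction_on' with
  | add p q hp hq => rw [map_add, map_add, map_add, hp, hq]; abel
  | monomial a x => simp only [contr_monomial, map_add, LinearMap.add_apply]

lemma contr_smul (g : Coeff n) (φ : Module.Dual (Coeff n) (Option (Fin (n + 1)) → Coeff n))
    (w : Alg n) : contr (g • φ) w = g • contr φ w := by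
  induction w using Polynomial.induction_on' with
  | add p q hp hq => rw [map_add, map_add, smul_add, hp, hq]
  | monomial a x =>
    simp only [contr_monomial, map_smul, LinearMap.smul_apply, Polynomial.smul_monomial]

lemma contr_zero (w : Alg n) : contr 0 w = 0 := by
  simpa using contr_smul 0 0 w

lemma contr_sum {κ : Type*} (s : Finset κ)
    (φ : κ → Module.Dual (Coeff n) (Option (Fin (n + 1)) → Coeff n)) (w : Alg n) :
    contr (∑ k ∈ s, φ k) w = ∑ k ∈ s, contr (φ k) w := by
  classical
  induction s using Finset.induction_on with
  | empty => simp [contr_zero]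
  | insert k s hk ih => rw [Finset.sum_insert hk, Finset.sum_insert hk, contr_add, ih]

lemma contr_contr (φ : Module.Dual (Coeff n) (Option (Fin (n + 1)) → Coeff n)) (w : Alg n) :
    contr φ (contr φ w) = 0 := by
  induction w using Polynomial.induction_on' with
  | add p q hp hq => rw [map_add, map_add, hp, hq, add_zero]
  | monomial a x =>
    rw [contr_monomial, contr_monomial, CliffordAlgebra.contractLeft_contractLeft, map_zero]

lemma contr_comm (φ ψ : Module.Dual (Coeff n) (Option (Fin (n + 1)) → Coeff n)) (w : Alg n) :
    contr φ (contr ψ w) = -contr ψ (contr φ w) := by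
  induction w using Polynomial.induction_on' with
  | add p q hp hq => simp only [map_add, hp, hq, neg_add]
  | monomial a x =>
    simp only [contr_monomial]
    rw [CliffordAlgebra.contractLeft_comm, map_neg]

/-- Multiplication by a linear combination of the odd generators. -/
def wedgeMul (v : Option (Fin (n + 1)) → Coeff n) : Alg n →ₗ[ℂ] Alg n :=
  LinearMap.mulLeft ℂ (Polynomial.C (ExteriorAlgebra.ι (Coeff n) v))

lemma wedgeMul_monomial (v : Option (Fin (n + 1)) → Coeff n) (a : ℕ) (x : Ext n) :
    wedgeMul v (Polynomial.monomial a x) =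
      Polynomial.monomial a (ExteriorAlgebra.ι (Coeff n) v * x) := by
  rw [wedgeMul, LinearMap.mulLeft_apply, Polynomial.C_mul_monomial]

lemma wedgeMul_wedgeMul (v : Option (Fin (n + 1)) → Coeff n) (w : Alg n) :
    wedgeMul v (wedgeMul v w) = 0 := by
  rw [wedgeMul, LinearMap.mulLeft_apply, LinearMap.mulLeft_apply, ← mul_assoc, ← Polynomial.C_mul,
    ExteriorAlgebra.ι_sq_zero, Polynomial.C_0, zero_mul]

lemma wedgeMul_add (u v : Option (Fin (n + 1)) → Coeff n) (w : Alg n) :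
    wedgeMul (u + v) w = wedgeMul u w + wedgeMul v w := by
  simp [wedgeMul, add_mul]

lemma wedgeMul_smul (g : Coeff n) (v : Option (Fin (n + 1)) → Coeff n) (w : Alg n) :
    wedgeMul (g • v) w = g • wedgeMul v w := by
  induction w using Polynomial.induction_on' with
  | add p q hp hq => rw [map_add, map_add, smul_add, hp, hq]
  | monomial a x =>
    simp only [wedgeMul_monomial, map_smul, Polynomial.smul_monomial, smul_mul_assoc]

lemma wedgeMul_sum {κ : Type*} (s : Finset κ) (v : κ → Option (Fin (n + 1)) → Coeff n)
    (w : Alg n) : wedgeMul (∑ k ∈ s, v k) w = ∑ k ∈ s, wedgeMul (v k) w := by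
  simp [wedgeMul, Finset.sum_mul]

lemma contr_wedgeMul (φ : Module.Dual (Coeff n) (Option (Fin (n + 1)) → Coeff n))
    (v : Option (Fin (n + 1)) → Coeff n) (w : Alg n) :
    contr φ (wedgeMul v w) = φ v • w - wedgeMul v (contr φ w) := by
  induction w using Polynomial.induction_on' with
  | add p q hp hq => simp only [map_add, smul_add, hp, hq]; abel
  | monomial a x =>
    simp only [contr_monomial, wedgeMul_monomial]
    rw [ExteriorAlgebra.ι, CliffordAlgebra.contractLeft_ι_mul, map_sub, Polynomial.smul_monomial]

/-- The derivation `∂/∂e`. -/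
def dE : Alg n →ₗ[ℂ] Alg n := (Polynomial.derivative (R := Ext n)).restrictScalars ℂ

lemma dE_monomial (a : ℕ) (x : Ext n) :
    dE (Polynomial.monomial a x) = Polynomial.monomial (a - 1) ((a : ℂ) • x) := by
  rw [dE, LinearMap.restrictScalars_apply, Polynomial.derivative_monomial, Nat.cast_smul_eq_nsmul,
    nsmul_eq_mul, Nat.cast_comm]

lemma dE_smul (g : Coeff n) (w : Alg n) : dE (g • w) = g • dE w := by
  simp [dE]

lemma dE_contr (φ : Module.Dual (Coeff n) (Option (Fin (n + 1)) → Coeff n)) (w : Alg n) :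
    dE (contr φ w) = contr φ (dE w) := by
  induction w using Polynomial.induction_on' with
  | add p q hp hq => simp only [map_add, hp, hq]
  | monomial a x =>
    rw [contr_monomial, dE_monomial, dE_monomial, contr_monomial]
    congr 1
    rw [Nat.cast_smul_eq_nsmul, Nat.cast_smul_eq_nsmul, map_nsmul]

lemma dE_wedgeMul (v : Option (Fin (n + 1)) → Coeff n) (w : Alg n) :
    dE (wedgeMul v w) = wedgeMul v (dE w) := by
  induction w using Polynomial.induction_on' with
  | add p q hp hq => simp only [map_add, hp, hq]
  | monomial a x =>
    simp only [dE_monomial, wedgeMul_monomial, mul_smul_comm]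

/-- The antiderivative `∫ de`. -/
def intE : Alg n →ₗ[ℂ] Alg n :=
  Polynomial.lsum fun a => ((a : ℂ) + 1)⁻¹ •
    (Polynomial.monomial (R := Ext n) (a + 1)).restrictScalars ℂ

lemma intE_monomial (a : ℕ) (x : Ext n) :
    intE (Polynomial.monomial a x) = Polynomial.monomial (a + 1) (((a : ℂ) + 1)⁻¹ • x) := by
  rw [intE, Polynomial.lsum_apply, Polynomial.sum_monomial_index]
  · rw [LinearMap.smul_apply, LinearMap.restrictScalars_apply, Polynomial.smul_monomial]
  · exact map_zero _

lemma dE_intE (w : Alg n) : dE (intE w) = w := by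
  induction w using Polynomial.induction_on' with
  | add p q hp hq => simp only [map_add, hp, hq]
  | monomial a x =>
    have h : ((a : ℂ) + 1) ≠ 0 := by exact_mod_cast Nat.succ_ne_zero a
    rw [intE_monomial, dE_monomial, smul_smul]
    simp [h]

/-- The part free of `e`. -/
def evE : Alg n →ₗ[ℂ] Alg n where
  toFun w := Polynomial.C (w.coeff 0)
  map_add' := by simp
  map_smul' := by simp [Polynomial.smul_C]

lemma evE_monomial (a : ℕ) (x : Ext n) :
    evE (Polynomial.monomial a x) = if a = 0 then Polynomial.monomial a x else 0 := by
  by_cases h : a = 0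
  · subst h
    simp [evE]
  · simp [evE, Polynomial.coeff_monomial, h]

lemma intE_dE (w : Alg n) : intE (dE w) = w - evE w := by
  induction w using Polynomial.induction_on' with
  | add p q hp hq => simp only [map_add, hp, hq]; abel
  | monomial a x =>
    rw [dE_monomial, intE_monomial, evE_monomial]
    rcases a with _ | a
    · simp
    · have h : ((a : ℂ) + 1) ≠ 0 := by exact_mod_cast Nat.succ_ne_zero a
      simp [smul_smul, h]

lemma intE_contr (φ : Module.Dual (Coeff n) (Option (Fin (n + 1)) → Coeff n)) (w : Alg n) :
    intE (contr φ w) = contr φ (intE w) := by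
  induction w using Polynomial.induction_on' with
  | add p q hp hq => simp only [map_add, hp, hq]
  | monomial a x =>
    rw [contr_monomial, intE_monomial, intE_monomial, ← Polynomial.smul_monomial,
      ← Polynomial.smul_monomial, LinearMap.map_smul_of_tower, contr_monomial]

lemma intE_wedgeMul (v : Option (Fin (n + 1)) → Coeff n) (w : Alg n) :
    intE (wedgeMul v w) = wedgeMul v (intE w) := by
  induction w using Polynomial.induction_on' with
  | add p q hp hq => simp only [map_add, hp, hq]
  | monomial a x =>
    simp only [intE_monomial, wedgeMul_monomial, mul_smul_comm]

lemma dE_evE (w : Alg n) : dE (evE w) = 0 := by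
  simp [dE, evE]

/-- The vector of coefficients of `d_f e` in the odd generators. -/
def eulerVec (n : ℕ) : Option (Fin (n + 1)) → Coeff n :=
  ∑ k : Fin (n + 1), ofPoly (X k) • Pi.single (some k) 1 -
    ((n + 1 : Coeff n) * bdry n) • Pi.single none 1

lemma eulerVec_none : eulerVec n none = -((n + 1 : Coeff n) * bdry n) := by
  simp [eulerVec]

lemma eulerVec_some (k : Fin (n + 1)) : eulerVec n (some k) = ofPoly (X k) := by
  simp [eulerVec, Finset.sum_apply, Pi.single_apply]

lemma eulerElt_eq : eulerElt n = ExteriorAlgebra.ι (Coeff n) (eulerVec n) := by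
  rw [eulerElt, eulerVec, map_sub, map_sum, map_smul]
  simp only [map_smul]
  rfl

lemma dAlg_eq (f : MvPolynomial (Fin (n + 1)) ℂ) (w : Alg n) :
    dAlg f w = contr (koszulForm f) w + wedgeMul (eulerVec n) (dE w) := by
  rw [wedgeMul, ← eulerElt_eq]
  rfl

lemma koszulForm_apply (f : MvPolynomial (Fin (n + 1)) ℂ) (v : Option (Fin (n + 1)) → Coeff n) :
    koszulForm f v = v none * ofPoly f +
      ∑ i, v (some i) * (ofPoly (pderiv i f) * bdry n) := by
  simp [koszulForm, Fintype.linearCombination_apply, Fintype.sum_option]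

lemma koszulForm_eulerVec {f : MvPolynomial (Fin (n + 1)) ℂ} (hf : f.IsHomogeneous (n + 1)) :
    koszulForm f (eulerVec n) = 0 := by
  rw [koszulForm_apply, eulerVec_none]
  simp only [eulerVec_some, ← mul_assoc, ← map_mul]
  rw [← Finset.sum_mul, ← map_sum, hf.sum_X_mul_pderiv]
  simp only [nsmul_eq_mul, map_mul, map_natCast]
  push_cast
  ring

/-- The Koszul differential of the partial derivatives of `f`: the odd derivation with
`∂ᵢ ↦ fᵢ` that kills `y`, `e` and `∂`. -/
def koszulForm₀ (f : MvPolynomial (Fin (n + 1)) ℂ) :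
    Module.Dual (Coeff n) (Option (Fin (n + 1)) → Coeff n) :=
  Fintype.linearCombination (Coeff n)
    (fun o : Option (Fin (n + 1)) => o.elim 0 fun i => ofPoly (pderiv i f))

lemma koszulForm₀_apply (f : MvPolynomial (Fin (n + 1)) ℂ)
    (v : Option (Fin (n + 1)) → Coeff n) :
    koszulForm₀ f v = ∑ i, v (some i) * ofPoly (pderiv i f) := by
  simp [koszulForm₀, Fintype.linearCombination_apply, Fintype.sum_option]

lemma koszulForm₀_eq (f : MvPolynomial (Fin (n + 1)) ℂ) :
    koszulForm₀ f = ∑ i, ofPoly (pderiv i f) • coordForm (some i) := by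
  refine LinearMap.ext fun v => ?_
  simp [koszulForm₀_apply, LinearMap.sum_apply, mul_comm]

lemma koszulForm_eq (f : MvPolynomial (Fin (n + 1)) ℂ) :
    koszulForm f = ofPoly f • coordForm none + bdry n • koszulForm₀ f := by
  refine LinearMap.ext fun v => ?_
  have h : (ofPoly f • coordForm none + bdry n • koszulForm₀ f :
      Module.Dual (Coeff n) (Option (Fin (n + 1)) → Coeff n)) v =
      ofPoly f * v none + bdry n * koszulForm₀ f v := rfl
  rw [h, koszulForm_apply, koszulForm₀_apply, Finset.mul_sum, mul_comm (v none)]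
  refine congrArg _ (Finset.sum_congr rfl fun i _ => ?_)
  rw [← mul_assoc, mul_comm]

lemma dAlg_dAlg {f : MvPolynomial (Fin (n + 1)) ℂ} (hf : f.IsHomogeneous (n + 1)) (w : Alg n) :
    dAlg f (dAlg f w) = 0 := by
  rw [dAlg_eq f w, map_add, dAlg_eq, dAlg_eq, contr_contr, contr_wedgeMul, koszulForm_eulerVec hf,
    dE_contr, dE_wedgeMul, wedgeMul_wedgeMul]
  simp

lemma dE_dAlg (f : MvPolynomial (Fin (n + 1)) ℂ) (w : Alg n) :
    dE (dAlg f w) = dAlg f (dE w) := by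
  rw [dAlg_eq, dAlg_eq, map_add, dE_contr, dE_wedgeMul]

lemma dAlg_smul (f : MvPolynomial (Fin (n + 1)) ℂ) (g : Coeff n) (w : Alg n) :
    dAlg f (g • w) = g • dAlg f w := by
  rw [dAlg_eq, dAlg_eq, dE_smul, map_smul, smul_add]
  congr 1
  rw [wedgeMul, LinearMap.mulLeft_apply, LinearMap.mulLeft_apply, mul_smul_comm]

/-- Contraction with the coordinate form of `y` is, up to the factor `-ν ∂`, a homotopy between
`∂/∂e` and zero. -/
lemma contr_none_dAlg (f : MvPolynomial (Fin (n + 1)) ℂ) (w : Alg n) :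
    contr (coordForm none) (dAlg f w) + dAlg f (contr (coordForm none) w) =
      -((n + 1 : ℂ) • bdry n • dE w) := by
  rw [dAlg_eq, dAlg_eq, map_add, contr_wedgeMul, contr_comm, dE_contr]
  have h : coordForm none (eulerVec n) = -((n + 1 : ℂ) • bdry n) := by
    rw [LinearMap.proj_apply, eulerVec_none, Algebra.smul_def, map_add, map_natCast, map_one]
  rw [h, neg_smul, smul_assoc]
  abel

lemma dAlg_intE {f : MvPolynomial (Fin (n + 1)) ℂ} {w : Alg n} (hw : dAlg f w = 0) :
    dAlg f (intE w) = wedgeMul (eulerVec n) (evE w) := by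
  have h := congrArg intE hw
  rw [dAlg_eq, map_add, intE_contr, intE_wedgeMul, intE_dE, map_sub, map_zero] at h
  rw [dAlg_eq, dE_intE]
  have h' := sub_eq_zero.2 (eq_neg_of_add_eq_zero_left h)
  rw [eq_neg_of_add_eq_zero_left h]
  abel

/-! ### Gradings -/

/-- The exponent of `y` in a product of odd generators. -/
def yExp (J : Finset (Option (Fin (n + 1)))) : ℤ := if none ∈ J then 1 else 0

/-- The number of `∂ᵢ` in a product of odd generators. -/
def dNum (J : Finset (Option (Fin (n + 1)))) : ℤ := (J.erase none).card

lemma dNum_nonneg (J : Finset (Option (Fin (n + 1)))) : 0 ≤ dNum J := Int.natCast_nonneg _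

lemma dNum_le (J : Finset (Option (Fin (n + 1)))) : dNum J ≤ n + 1 := by
  have h : (J.erase none).card ≤ ((Finset.univ : Finset (Option (Fin (n + 1)))).erase none).card :=
    Finset.card_le_card (Finset.erase_subset_erase _ (Finset.subset_univ _))
  rw [Finset.card_erase_of_mem (Finset.mem_univ _), Finset.card_univ, Fintype.card_option,
    Fintype.card_fin] at h
  rw [dNum]
  omega

lemma yExp_erase_none (J : Finset (Option (Fin (n + 1)))) : yExp (J.erase none) = 0 := by
  simp [yExp]

lemma dNum_erase_none (J : Finset (Option (Fin (n + 1)))) : dNum (J.erase none) = dNum J := by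
  simp [dNum]

lemma yExp_insert_none (J : Finset (Option (Fin (n + 1)))) : yExp (insert none J) = 1 := by
  simp [yExp]

lemma dNum_insert_none {J : Finset (Option (Fin (n + 1)))} (h : none ∉ J) :
    dNum (insert none J) = dNum J := by
  simp [dNum, Finset.erase_insert h, Finset.erase_eq_of_notMem h]

lemma yExp_erase_some (J : Finset (Option (Fin (n + 1)))) (k : Fin (n + 1)) :
    yExp (J.erase (some k)) = yExp J := by
  simp [yExp]

lemma dNum_erase_some {J : Finset (Option (Fin (n + 1)))} {k : Fin (n + 1)} (h : some k ∈ J) :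
    dNum (J.erase (some k)) = dNum J - 1 := by
  have h' : some k ∈ J.erase none := Finset.mem_erase.2 ⟨by simp, h⟩
  have := Finset.card_erase_add_one h'
  rw [dNum, dNum, Finset.erase_right_comm]
  omega

lemma yExp_insert_some (J : Finset (Option (Fin (n + 1)))) (k : Fin (n + 1)) :
    yExp (insert (some k) J) = yExp J := by
  simp [yExp]

lemma dNum_insert_some {J : Finset (Option (Fin (n + 1)))} {k : Fin (n + 1)} (h : some k ∉ J) :
    dNum (insert (some k) J) = dNum J + 1 := by
  have := dNum_erase_some (Finset.mem_insert_self (some k) J)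
  rw [Finset.erase_insert h] at this
  omega

lemma yExp_of_notMem {J : Finset (Option (Fin (n + 1)))} (h : none ∉ J) : yExp J = 0 := by
  simp [yExp, h]

lemma yExp_of_mem {J : Finset (Option (Fin (n + 1)))} (h : none ∈ J) : yExp J = 1 := by
  simp [yExp, h]

lemma yExp_nonneg (J : Finset (Option (Fin (n + 1)))) : 0 ≤ yExp J := by
  unfold yExp; split_ifs <;> simp

lemma yExp_le_one (J : Finset (Option (Fin (n + 1)))) : yExp J ≤ 1 := by
  unfold yExp; split_ifs <;> simp

lemma dNum_eq_zero {J : Finset (Option (Fin (n + 1)))} (h : none ∉ J) :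
    dNum J = 0 ↔ J = ∅ := by
  rw [dNum, Finset.erase_eq_of_notMem h]
  simp

/-- The weight of a monomial. -/
def Idx.wt (i : Idx n) : ℤ := ∑ k, i.m k + (n + 1) * yExp i.J - dNum i.J - (n + 1) * i.c

/-- The degree of a monomial. -/
def Idx.deg (i : Idx n) : ℤ := 2 * i.c + dNum i.J - yExp i.J

/-- The symmetric power in which a monomial lies. -/
def Idx.sym (i : Idx n) : ℤ := i.c + i.a + dNum i.J

/-- Only the `x^k` with `k ∈ σ` have negative exponents. -/
def Idx.Regular (σ : Finset (Fin (n + 1))) (i : Idx n) : Prop := ∀ k, k ∉ σ → 0 ≤ i.m k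

/-! ### The operators on monomials -/

lemma single_smul_monBasis (m : Fin (n + 1) → ℤ) (c : ℕ) (i : Idx n) :
    (AddMonoidAlgebra.single (m, c) 1 : Coeff n) • monBasis n i =
      monBasis n ⟨m + i.m, c + i.c, i.a, i.J⟩ := by
  rw [monBasis_apply, monBasis_apply, Polynomial.smul_monomial, smul_smul,
    AddMonoidAlgebra.single_mul_single, one_mul]
  rfl

lemma bdry_smul_monBasis (i : Idx n) :
    bdry n • monBasis n i = monBasis n ⟨i.m, 1 + i.c, i.a, i.J⟩ := by
  rw [bdry, single_smul_monBasis, zero_add]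

lemma xMon_smul_monBasis (m : Fin (n + 1) → ℤ) (i : Idx n) :
    xMon m • monBasis n i = monBasis n ⟨m + i.m, i.c, i.a, i.J⟩ := by
  rw [xMon, single_smul_monBasis, zero_add]

/-- Multiplication by an element of `Coeff n`, as a `ℂ`-linear map. -/
def coeffMul (g : Coeff n) : Alg n →ₗ[ℂ] Alg n where
  toFun w := g • w
  map_add' := smul_add g
  map_smul' r w := smul_comm g r w

lemma coeffMul_apply (g : Coeff n) (w : Alg n) : coeffMul g w = g • w := rfl

lemma ofPoly_monomial (s : Fin (n + 1) →₀ ℕ) (r : ℂ) :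
    ofPoly (MvPolynomial.monomial s r) =
      r • (AddMonoidAlgebra.single (fun k => (s k : ℤ), 0) 1 : Coeff n) := by
  rw [ofPoly, aeval_monomial, Algebra.smul_def]
  congr 1
  rw [Finsupp.prod_fintype _ _ (fun k => pow_zero _)]
  have : ∀ k, (xMon (Pi.single k 1) : Coeff n) ^ s k =
      AddMonoidAlgebra.single (Pi.single k (s k : ℤ), 0) 1 := fun k => by
    rw [xMon, AddMonoidAlgebra.single_pow, one_pow]
    congr 1
    ext j
    · simp [Pi.single_apply]
    · simp
  simp only [this]
  have key : ∀ t : Finset (Fin (n + 1)),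
      ∏ k ∈ t, (AddMonoidAlgebra.single (Pi.single k (s k : ℤ), 0) 1 : Coeff n) =
        AddMonoidAlgebra.single (∑ k ∈ t, Pi.single k (s k : ℤ), 0) 1 := fun t => by
    classical
    induction t using Finset.induction_on with
    | empty => rfl
    | insert k t hk ih =>
      rw [Finset.prod_insert hk, Finset.sum_insert hk, ih, AddMonoidAlgebra.single_mul_single,
        one_mul]
      rfl
  rw [key, Finset.univ_sum_single fun k => (s k : ℤ)]

lemma ofPoly_smul_monBasis_mem {p : MvPolynomial (Fin (n + 1)) ℂ} {D : ℕ}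
    (hp : p.IsHomogeneous D) (i : Idx n) :
    ofPoly p • monBasis n i ∈ Sp fun j : Idx n =>
      (∀ k, i.m k ≤ j.m k) ∧ ∑ k, j.m k = ∑ k, i.m k + D ∧ j.c = i.c ∧ j.a = i.a ∧ j.J = i.J := by
  rw [p.as_sum, map_sum, Finset.sum_smul]
  refine Submodule.sum_mem _ fun s hs => ?_
  rw [ofPoly_monomial, smul_assoc, single_smul_monBasis]
  refine Submodule.smul_mem _ _ (monBasis_mem ⟨fun k => ?_, ?_, by simp, rfl, rfl⟩)
  · simp
  · have h : ∑ k, s k = D := by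
      rw [← Finsupp.degree_eq_sum]
      exact not_imp_comm.1 (hp.coeff_eq_zero (d := s)) (mem_support_iff.1 hs)
    rw [← h]
    push_cast
    simp only [Pi.add_apply, Finset.sum_add_distrib]
    ring

lemma ofPoly_smul_mem {P Q : Idx n → Prop} {p : MvPolynomial (Fin (n + 1)) ℂ} {D : ℕ}
    (hp : p.IsHomogeneous D)
    (h : ∀ i j : Idx n, P i → (∀ k, i.m k ≤ j.m k) → ∑ k, j.m k = ∑ k, i.m k + D →
      j.c = i.c → j.a = i.a → j.J = i.J → Q j) {w : Alg n} (hw : w ∈ Sp P) :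
    ofPoly p • w ∈ Sp Q :=
  map_mem_Sp (coeffMul (ofPoly p)) (fun i hi => Sp_mono
    (fun j hj => h i j hi hj.1 hj.2.1 hj.2.2.1 hj.2.2.2.1 hj.2.2.2.2)
    (ofPoly_smul_monBasis_mem hp i)) hw

lemma xMon_smul_mem {P Q : Idx n → Prop} (m : Fin (n + 1) → ℤ)
    (h : ∀ i : Idx n, P i → Q ⟨m + i.m, i.c, i.a, i.J⟩) {w : Alg n} (hw : w ∈ Sp P) :
    xMon m • w ∈ Sp Q :=
  map_mem_Sp (coeffMul (xMon m)) (fun i hi => by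
    rw [coeffMul_apply, xMon_smul_monBasis]; exact monBasis_mem (h i hi)) hw

lemma bdry_smul_mem {P Q : Idx n → Prop} (h : ∀ i : Idx n, P i → Q ⟨i.m, 1 + i.c, i.a, i.J⟩)
    {w : Alg n} (hw : w ∈ Sp P) : bdry n • w ∈ Sp Q :=
  map_mem_Sp (coeffMul (bdry n)) (fun i hi => by
    rw [coeffMul_apply, bdry_smul_monBasis]; exact monBasis_mem (h i hi)) hw

/-- Division by `∂`. -/
def bdryInv : Alg n →ₗ[ℂ] Alg n :=
  (monBasis n).constr ℂ fun i => monBasis n ⟨i.m, i.c - 1, i.a, i.J⟩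

lemma bdryInv_bdry_smul (w : Alg n) : bdryInv (bdry n • w) = w := by
  have : w ∈ LinearMap.eqLocus (bdryInv ∘ₗ coeffMul (bdry n)) LinearMap.id :=
    Sp_le (fun i _ => by simp [coeffMul_apply, bdry_smul_monBasis, bdryInv]) (mem_Sp_true w)
  exact this

lemma bdry_smul_injective : Function.Injective fun w : Alg n => bdry n • w :=
  Function.LeftInverse.injective bdryInv_bdry_smul

lemma exists_bdry_smul_eq {P Q : Idx n → Prop}
    (h : ∀ i : Idx n, P i → 1 ≤ i.c ∧ Q ⟨i.m, i.c - 1, i.a, i.J⟩)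
    {w : Alg n} (hw : w ∈ Sp P) : ∃ w' ∈ Sp Q, bdry n • w' = w := by
  refine ⟨bdryInv w, map_mem_Sp bdryInv (fun i hi => ?_) hw, ?_⟩
  · rw [bdryInv, Basis.constr_basis]
    exact monBasis_mem (h i hi).2
  · have : w ∈ LinearMap.eqLocus (coeffMul (bdry n) ∘ₗ bdryInv) LinearMap.id :=
      Sp_le (fun i hi => by
        have h1 : 1 + (i.c - 1) = i.c := by have := (h i hi).1; omega
        simp [coeffMul_apply, bdry_smul_monBasis, bdryInv, h1]) hw
    exact this

lemma contr_coord_monBasis_of_notMem (i : Idx n) {j : Option (Fin (n + 1))} (hj : j ∉ i.J) :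
    contr (coordForm j) (monBasis n i) = 0 := by
  rw [monBasis_apply, contr_monomial, map_smul, contractLeft_extBasis_of_notMem hj, smul_zero,
    map_zero]

lemma monomial_unit_smul (a : ℕ) (u : ℤˣ) (g : Coeff n) (x : Ext n) :
    Polynomial.monomial a (g • u • x) = u • Polynomial.monomial a (g • x) := by
  rw [Units.smul_def, Units.smul_def, smul_comm, map_zsmul]

lemma contr_coord_monBasis_of_mem (i : Idx n) {j : Option (Fin (n + 1))} (hj : j ∈ i.J) :
    ∃ u : ℤˣ, contr (coordForm j) (monBasis n i) =
      u • monBasis n ⟨i.m, i.c, i.a, i.J.erase j⟩ := by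
  obtain ⟨u, hu⟩ := contractLeft_extBasis_of_mem hj
  refine ⟨u, ?_⟩
  rw [monBasis_apply, monBasis_apply, contr_monomial, map_smul, hu, monomial_unit_smul]

lemma contr_coord_mem {P Q : Idx n → Prop} (j : Option (Fin (n + 1)))
    (h : ∀ i : Idx n, P i → j ∈ i.J → Q ⟨i.m, i.c, i.a, i.J.erase j⟩)
    {w : Alg n} (hw : w ∈ Sp P) : contr (coordForm j) w ∈ Sp Q := by
  refine map_mem_Sp ((contr (coordForm j)).restrictScalars ℂ) (fun i hi => ?_) hw
  rw [LinearMap.restrictScalars_apply]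
  by_cases hj : j ∈ i.J
  · obtain ⟨u, hu⟩ := contr_coord_monBasis_of_mem i hj
    rw [hu, Units.smul_def]
    exact zsmul_mem (monBasis_mem (h i hi hj)) _
  · rw [contr_coord_monBasis_of_notMem i hj]
    exact zero_mem _

lemma wedgeMul_single_mem {P Q : Idx n → Prop} (j : Option (Fin (n + 1)))
    (h : ∀ i : Idx n, P i → j ∉ i.J → Q ⟨i.m, i.c, i.a, insert j i.J⟩)
    {w : Alg n} (hw : w ∈ Sp P) : wedgeMul (Pi.single j 1) w ∈ Sp Q := by
  refine map_mem_Sp _ (fun i hi => ?_) hw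
  rw [monBasis_apply, wedgeMul_monomial, mul_smul_comm]
  change Polynomial.monomial i.a (_ • (oddGen j * extBasis n i.J)) ∈ _
  by_cases hj : j ∈ i.J
  · rw [oddGen_mul_extBasis_of_mem hj, smul_zero, map_zero]
    exact zero_mem _
  · obtain ⟨u, hu⟩ := extBasis_insert hj
    rw [hu, monomial_unit_smul, Units.smul_def]
    refine zsmul_mem ?_ _
    have := monBasis_mem (h i hi hj)
    rwa [monBasis_apply] at this

lemma dE_mem {P Q : Idx n → Prop} (h : ∀ i : Idx n, P i → 1 ≤ i.a → Q ⟨i.m, i.c, i.a - 1, i.J⟩)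
    {w : Alg n} (hw : w ∈ Sp P) : dE w ∈ Sp Q := by
  refine map_mem_Sp _ (fun i hi => ?_) hw
  rw [monBasis_apply, dE_monomial, ← Polynomial.smul_monomial]
  by_cases ha : i.a = 0
  · rw [ha, Nat.cast_zero, zero_smul]
    exact zero_mem _
  · refine Submodule.smul_mem _ _ ?_
    have := monBasis_mem (h i hi (by omega))
    rwa [monBasis_apply] at this

lemma intE_mem {P Q : Idx n → Prop} (h : ∀ i : Idx n, P i → Q ⟨i.m, i.c, i.a + 1, i.J⟩)
    {w : Alg n} (hw : w ∈ Sp P) : intE w ∈ Sp Q := by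
  refine map_mem_Sp _ (fun i hi => ?_) hw
  rw [monBasis_apply, intE_monomial, ← Polynomial.smul_monomial]
  refine Submodule.smul_mem _ _ ?_
  have := monBasis_mem (h i hi)
  rwa [monBasis_apply] at this

lemma evE_mem {P Q : Idx n → Prop} (h : ∀ i : Idx n, P i → i.a = 0 → Q i)
    {w : Alg n} (hw : w ∈ Sp P) : evE w ∈ Sp Q := by
  refine map_mem_Sp _ (fun i hi => ?_) hw
  rw [monBasis_apply, evE_monomial]
  split_ifs with ha
  · have := monBasis_mem (h i hi ha)
    rwa [monBasis_apply] at this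
  · exact zero_mem _

lemma wedgeMul_eulerVec_eq (w : Alg n) : wedgeMul (eulerVec n) w =
    ∑ k : Fin (n + 1), ofPoly (X k) • wedgeMul (Pi.single (some k) 1) w -
      (n + 1 : ℂ) • bdry n • wedgeMul (Pi.single none 1) w := by
  have e1 : eulerVec n = ∑ k : Fin (n + 1), ofPoly (X k) • Pi.single (some k) (1 : Coeff n) +
      (-((n + 1 : Coeff n) * bdry n)) • Pi.single none 1 := by
    rw [eulerVec, neg_smul, sub_eq_add_neg]
  have e2 : ((n + 1 : Coeff n) * bdry n) = (n + 1 : ℂ) • bdry n := by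
    rw [Algebra.smul_def, map_add, map_natCast, map_one]
  rw [e1, wedgeMul_add, wedgeMul_sum, wedgeMul_smul, neg_smul, ← sub_eq_add_neg, e2, smul_assoc]
  simp only [wedgeMul_smul]

lemma wedgeMul_eulerVec_mem {P Q : Idx n → Prop}
    (h : ∀ i j : Idx n, P i → (∀ k, i.m k ≤ j.m k) → j.wt = i.wt → j.deg = i.deg + 1 →
      j.sym = i.sym + 1 → Q j) {w : Alg n} (hw : w ∈ Sp P) :
    wedgeMul (eulerVec n) w ∈ Sp Q := by
  rw [wedgeMul_eulerVec_eq]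
  refine sub_mem (Submodule.sum_mem _ fun k _ => ?_) (Submodule.smul_mem _ _ ?_)
  · refine ofPoly_smul_mem (isHomogeneous_X ℂ k)
      (P := fun i' => ∃ i, P i ∧ some k ∉ i.J ∧ i' = ⟨i.m, i.c, i.a, insert (some k) i.J⟩) ?_
      (wedgeMul_single_mem _ (fun i hi hk => ⟨i, hi, hk, rfl⟩) hw)
    rintro _ ⟨m', c', a', J'⟩ ⟨i, hi, hk, rfl⟩ h1 h2 rfl rfl rfl
    refine h i _ hi h1 ?_ ?_ ?_ <;>
      simp only [Idx.wt, Idx.deg, Idx.sym, yExp_insert_some, dNum_insert_some hk] at h2 ⊢ <;>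
      push_cast at h2 ⊢ <;> linarith
  · refine bdry_smul_mem
      (P := fun i' => ∃ i, P i ∧ none ∉ i.J ∧ i' = ⟨i.m, i.c, i.a, insert none i.J⟩) ?_
      (wedgeMul_single_mem _ (fun i hi hk => ⟨i, hi, hk, rfl⟩) hw)
    rintro _ ⟨i, hi, hk, rfl⟩
    refine h i _ hi (fun k => le_rfl) ?_ ?_ ?_ <;>
      simp only [Idx.wt, Idx.deg, Idx.sym, yExp_insert_none, dNum_insert_none hk,
        yExp_of_notMem hk] <;>
      push_cast <;> linarith

lemma contr_koszulForm₀_mem {P Q : Idx n → Prop} {f : MvPolynomial (Fin (n + 1)) ℂ}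
    (hf : f.IsHomogeneous (n + 1))
    (h : ∀ i j : Idx n, P i → (∀ k, i.m k ≤ j.m k) → ∑ k, j.m k = ∑ k, i.m k + n → j.c = i.c →
      j.a = i.a → yExp j.J = yExp i.J → dNum j.J = dNum i.J - 1 → Q j)
    {w : Alg n} (hw : w ∈ Sp P) : contr (koszulForm₀ f) w ∈ Sp Q := by
  rw [koszulForm₀_eq, contr_sum]
  refine Submodule.sum_mem _ fun k _ => ?_
  rw [contr_smul]
  refine ofPoly_smul_mem (hf.pderiv (i := k))
    (P := fun i' => ∃ i, P i ∧ some k ∈ i.J ∧ i' = ⟨i.m, i.c, i.a, i.J.erase (some k)⟩) ?_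
    (contr_coord_mem _ (fun i hi hk => ⟨i, hi, hk, rfl⟩) hw)
  rintro _ ⟨m', c', a', J'⟩ ⟨i, hi, hk, rfl⟩ h1 h2 rfl rfl rfl
  refine h i _ hi h1 ?_ rfl rfl (yExp_erase_some _ _) (dNum_erase_some hk)
  simpa using h2

lemma dAlg_mem {P Q : Idx n → Prop} {f : MvPolynomial (Fin (n + 1)) ℂ}
    (hf : f.IsHomogeneous (n + 1))
    (h : ∀ i j : Idx n, P i → (∀ k, i.m k ≤ j.m k) → j.wt = i.wt → j.deg = i.deg + 1 →
      j.sym = i.sym → Q j)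
    {w : Alg n} (hw : w ∈ Sp P) : dAlg f w ∈ Sp Q := by
  rw [dAlg_eq, koszulForm_eq, contr_add, contr_smul, contr_smul]
  refine add_mem (add_mem ?_ ?_) ?_
  · refine ofPoly_smul_mem hf
      (P := fun i' => ∃ i, P i ∧ none ∈ i.J ∧ i' = ⟨i.m, i.c, i.a, i.J.erase none⟩) ?_
      (contr_coord_mem _ (fun i hi hk => ⟨i, hi, hk, rfl⟩) hw)
    rintro _ ⟨m', c', a', J'⟩ ⟨i, hi, hk, rfl⟩ h1 h2 rfl rfl rfl
    refine h i _ hi h1 ?_ ?_ ?_ <;>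
      simp only [Idx.wt, Idx.deg, Idx.sym, yExp_erase_none, dNum_erase_none,
        yExp_of_mem hk] at h2 ⊢ <;>
      push_cast at h2 ⊢ <;> linarith
  · refine bdry_smul_mem
      (P := fun j => ∃ i, P i ∧ (∀ k, i.m k ≤ j.m k) ∧ ∑ k, j.m k = ∑ k, i.m k + n ∧ j.c = i.c ∧
        j.a = i.a ∧ yExp j.J = yExp i.J ∧ dNum j.J = dNum i.J - 1) ?_
      (contr_koszulForm₀_mem hf
        (fun i j hi h1 h2 h3 h4 h5 h6 => ⟨i, hi, h1, h2, h3, h4, h5, h6⟩) hw)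
    rintro j ⟨i, hi, h1, h2, h3, h4, h5, h6⟩
    refine h i _ hi h1 ?_ ?_ ?_ <;>
      simp only [Idx.wt, Idx.deg, Idx.sym, h2, h3, h4, h5, h6] <;>
      push_cast <;> linarith
  · refine wedgeMul_eulerVec_mem
      (P := fun i' => ∃ i, P i ∧ 1 ≤ i.a ∧ i' = ⟨i.m, i.c, i.a - 1, i.J⟩) ?_
      (dE_mem (fun i hi hk => ⟨i, hi, hk, rfl⟩) hw)
    rintro _ j ⟨i, hi, hk, rfl⟩ h1 h2 h3 h4
    refine h i _ hi h1 h2 h3 ?_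
    rw [h4]
    simp only [Idx.sym]
    push_cast [hk]
    linarith

/-! ### The sections and the distinguished elements in terms of the monomial basis -/

lemma monBasis_eq_mono (m : Fin (n + 1) → ℤ) (c a ε : ℕ) (hε : ε ≤ 1) (I : Finset (Fin (n + 1)))
    {J : Finset (Option (Fin (n + 1)))} (hy : none ∈ J ↔ ε = 1) (hI : ∀ k, some k ∈ J ↔ k ∈ I) :
    ∃ u : ℤˣ, monBasis n ⟨m, c, a, J⟩ = u • mono m c a ε I := by
  obtain ⟨u, hu⟩ := extBasis_eq_wedge (J := J)
    (l := List.replicate ε none ++ (I.sort (· ≤ ·)).map some)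
    (by
      refine List.Nodup.append (List.nodup_replicate.2 hε)
        ((Finset.sort_nodup _ _).map (Option.some_injective _)) fun j h1 h2 => ?_
      rw [List.eq_of_mem_replicate h1] at h2
      simp at h2)
    (by
      rintro (_ | k)
      · simp only [List.mem_append, List.mem_replicate, List.mem_map, reduceCtorEq, and_false,
          exists_false, or_false, and_true, hy]
        omega
      · simp [hI])
  refine ⟨u, ?_⟩
  have hw : wedge (List.replicate ε none ++ (I.sort (· ≤ ·)).map some) =
      yGen n ^ ε * ((I.sort (· ≤ ·)).map dGen).prod := by
    rw [wedge, List.map_append, List.prod_append, List.map_replicate, List.prod_replicate,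
      List.map_map]
    rfl
  rw [monBasis_apply, mono, hu, hw, xMon_mul_bdry_pow, monomial_unit_smul]

lemma sections_eq (σ : Finset (Fin (n + 1))) (q : ℤ) :
    sections n σ q = Sp fun i => i.wt = 0 ∧ i.deg = q ∧ i.sym < n ∧ i.Regular σ := by
  apply le_antisymm
  · refine Submodule.span_le.2 ?_
    rintro _ ⟨m, c, a, ε, I, rfl, hε, hm, hwt, hdeg, hsym⟩
    have hdisj : none ∉ I.map Function.Embedding.some := by simp
    obtain ⟨J, hy, hI, h1, h2⟩ : ∃ J : Finset (Option (Fin (n + 1))), (none ∈ J ↔ ε = 1) ∧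
        (∀ k, some k ∈ J ↔ k ∈ I) ∧ yExp J = ε ∧ dNum J = I.card := by
      interval_cases ε
      · refine ⟨I.map Function.Embedding.some, by simp, by simp, by simp [yExp], ?_⟩
        rw [dNum, Finset.erase_eq_of_notMem hdisj, Finset.card_map]
      · refine ⟨insert none (I.map Function.Embedding.some), by simp, by simp, by simp [yExp], ?_⟩
        rw [dNum, Finset.erase_insert hdisj, Finset.card_map]
    obtain ⟨u, hu⟩ := monBasis_eq_mono m c a ε hε I hy hI
    rw [← inv_smul_eq_iff] at hu
    rw [← hu, Units.smul_def]
    refine zsmul_mem (monBasis_mem ⟨?_, ?_, ?_, hm⟩) _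
    · simpa [Idx.wt, h1, h2] using hwt
    · simpa [Idx.deg, h1, h2] using hdeg
    · simp only [Idx.sym, h2]
      exact_mod_cast hsym
  · refine Sp_le ?_
    rintro ⟨m, c, a, J⟩ ⟨hwt, hdeg, hsym, hreg⟩
    have hc : dNum J = (Finset.eraseNone J).card := by
      rw [dNum, ← Finset.map_some_eraseNone, Finset.card_map]
    obtain ⟨ε, hε, h1, hy⟩ : ∃ ε : ℕ, ε ≤ 1 ∧ yExp J = ε ∧ (none ∈ J ↔ ε = 1) := by
      by_cases h : none ∈ J
      · exact ⟨1, le_rfl, yExp_of_mem h, by simp [h]⟩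
      · exact ⟨0, zero_le_one, yExp_of_notMem h, by simp [h]⟩
    obtain ⟨u, hu⟩ := monBasis_eq_mono m c a ε hε (Finset.eraseNone J) hy (by simp)
    have hmem : mono m c a ε (Finset.eraseNone J) ∈ sections n σ q := by
      refine Submodule.subset_span ⟨m, c, a, ε, Finset.eraseNone J, rfl, hε, hreg, ?_, ?_, ?_⟩
      · simpa only [Idx.wt, h1, hc] using hwt
      · simpa only [Idx.deg, h1, hc] using hdeg
      · simp only [Idx.sym, hc] at hsym
        exact_mod_cast hsym
    rw [hu, Units.smul_def]
    exact zsmul_mem hmem _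

lemma eElt_eq (k : ℕ) : eElt n k = monBasis n ⟨fun _ => -1, 0, k, {none}⟩ := by
  rw [monBasis_apply, extBasis_singleton]
  rfl

/-- The element `h ∂^p`. -/
def polyElt (p : ℕ) : MvPolynomial (Fin (n + 1)) ℂ →ₗ[ℂ] Alg n where
  toFun h := Polynomial.C (algebraMap _ _ (ofPoly h * bdry n ^ p))
  map_add' := by simp [add_mul]
  map_smul' r h := by
    rw [map_smul, smul_mul_assoc, RingHom.id_apply, Polynomial.smul_C,
      Algebra.algebraMap_eq_smul_one, Algebra.algebraMap_eq_smul_one, smul_assoc]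

lemma primitiveCochain_apply (h : MvPolynomial (Fin (n + 1)) ℂ) (p : ℕ)
    (σ : Finset (Fin (n + 1))) :
    primitiveCochain h p σ = if σ.card = 1 then polyElt p h else 0 := rfl

lemma polyElt_eq (p : ℕ) (h : MvPolynomial (Fin (n + 1)) ℂ) :
    polyElt p h = ofPoly h • monBasis n ⟨0, p, 0, ∅⟩ := by
  have e : (bdry n) ^ p = AddMonoidAlgebra.single (0, p) 1 := by
    rw [bdry, AddMonoidAlgebra.single_pow]
    simp
  rw [monBasis_apply, extBasis_empty, Polynomial.smul_monomial, smul_smul, ← e,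
    ← Algebra.algebraMap_eq_smul_one]
  rfl

lemma polyElt_mem {h : MvPolynomial (Fin (n + 1)) ℂ} {D : ℕ} (hh : h.IsHomogeneous D) (p : ℕ) :
    polyElt p h ∈ Sp fun i : Idx n =>
      i.Regular ∅ ∧ ∑ k, i.m k = D ∧ i.c = p ∧ i.a = 0 ∧ i.J = ∅ := by
  rw [polyElt_eq]
  refine Sp_mono ?_ (ofPoly_smul_monBasis_mem hh _)
  rintro i ⟨h1, h2, h3, h4, h5⟩
  exact ⟨fun k _ => h1 k, by simpa using h2, h3, h4, h5⟩

lemma exists_polyElt_eq {D p : ℕ} {w : Alg n}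
    (hw : w ∈ Sp fun i : Idx n =>
      i.Regular ∅ ∧ ∑ k, i.m k = D ∧ i.c = p ∧ i.a = 0 ∧ i.J = ∅) :
    ∃ h : MvPolynomial (Fin (n + 1)) ℂ, h.IsHomogeneous D ∧ polyElt p h = w := by
  have : w ∈ (homogeneousSubmodule (Fin (n + 1)) ℂ D).map (polyElt p) := by
    refine Sp_le ?_ hw
    rintro ⟨m, c, a, J⟩ ⟨h1, h2, rfl, h4, h5⟩
    dsimp only at h2 h4 h5
    subst h4 h5
    have hm : ∀ k, (((m k).toNat : ℕ) : ℤ) = m k := fun k =>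
      Int.toNat_of_nonneg (h1 k (Finset.notMem_empty k))
    refine ⟨MvPolynomial.monomial (Finsupp.equivFunOnFinite.symm fun k => (m k).toNat) 1,
      isHomogeneous_monomial _ ?_, ?_⟩
    · rw [Finsupp.degree_eq_sum]
      zify
      simpa [hm] using h2
    · rw [polyElt_eq, ofPoly_monomial, one_smul, single_smul_monBasis]
      simp [hm]
  obtain ⟨h, hh, e⟩ := this
  exact ⟨h, hh, e⟩

lemma dAlg_polyElt (f h : MvPolynomial (Fin (n + 1)) ℂ) (p : ℕ) : dAlg f (polyElt p h) = 0 := by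
  rw [polyElt_eq, dAlg_smul, dAlg_eq, monBasis_apply, extBasis_empty, dE_monomial, contr_monomial,
    map_smul, CliffordAlgebra.contractLeft_one]
  simp

/-! ### The augmented Čech complex -/

/-- The sign `(-1)^{#{j ∈ σ : j < i}}`. -/
def cechSign (i : Fin (n + 1)) (σ : Finset (Fin (n + 1))) : ℂ :=
  (-1 : ℂ) ^ (σ.filter (· < i)).card

lemma cechSign_mul_self (i : Fin (n + 1)) (σ : Finset (Fin (n + 1))) :
    cechSign i σ * cechSign i σ = 1 := by
  rw [cechSign, ← mul_pow]
  simp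

lemma cechSign_erase (i : Fin (n + 1)) (σ : Finset (Fin (n + 1))) :
    cechSign i (σ.erase i) = cechSign i σ := by
  rw [cechSign, cechSign, Finset.filter_erase, Finset.erase_eq_of_notMem (by simp)]

lemma cechSign_insert (i : Fin (n + 1)) (σ : Finset (Fin (n + 1))) :
    cechSign i (insert i σ) = cechSign i σ := by
  rw [cechSign, cechSign, Finset.filter_insert]
  simp

lemma cechSign_insert_lt {i j : Fin (n + 1)} (h : j < i) {σ : Finset (Fin (n + 1))}
    (hj : j ∉ σ) : cechSign i (insert j σ) = -cechSign i σ := by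
  rw [cechSign, cechSign, Finset.filter_insert, if_pos h, Finset.card_insert_of_notMem
    (fun hh => hj (Finset.mem_filter.1 hh).1), pow_succ]
  ring

lemma cechSign_insert_gt {i j : Fin (n + 1)} (h : i < j) (σ : Finset (Fin (n + 1))) :
    cechSign i (insert j σ) = cechSign i σ := by
  rw [cechSign, cechSign, Finset.filter_insert, if_neg (not_lt.2 h.le)]

lemma cechSign_swap {i j : Fin (n + 1)} {σ : Finset (Fin (n + 1))} (hi : i ∉ σ) (hj : j ∈ σ) :
    cechSign j σ * cechSign i (σ.erase j) = -(cechSign i σ * cechSign j (insert i σ)) := by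
  obtain ⟨τ, hτ, rfl⟩ : ∃ τ, j ∉ τ ∧ insert j τ = σ :=
    ⟨σ.erase j, Finset.notMem_erase _ _, Finset.insert_erase hj⟩
  rw [Finset.mem_insert, not_or] at hi
  rw [Finset.erase_insert hτ, cechSign_insert]
  rcases lt_or_gt_of_ne hi.1 with h | h
  · rw [cechSign_insert_gt h, cechSign_insert_lt h, cechSign_insert]
    · ring
    · rw [Finset.mem_insert, not_or]
      exact hi
  · rw [cechSign_insert_lt h hτ, cechSign_insert_gt h, cechSign_insert]
    ring

lemma cechDiff_apply (c : PreCochain n) (σ : Finset (Fin (n + 1))) :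
    cechDiff n c σ = ∑ i ∈ σ, cechSign i σ • c (σ.erase i) := by
  simp [cechDiff, cechSign, LinearMap.sum_apply]

lemma cechDiff_empty (c : PreCochain n) : cechDiff n c ∅ = 0 := by
  simp [cechDiff_apply]

lemma cechDiff_singleton (c : PreCochain n) (i : Fin (n + 1)) : cechDiff n c {i} = c ∅ := by
  rw [cechDiff_apply, Finset.sum_singleton, Finset.erase_singleton, cechSign,
    Finset.filter_singleton]
  simp

/-- The Čech differential commutes with linear maps applied to all components. -/
lemma cechDiff_map (T : Alg n →ₗ[ℂ] Alg n) (c : PreCochain n) (σ : Finset (Fin (n + 1))) :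
    cechDiff n (fun τ => T (c τ)) σ = T (cechDiff n c σ) := by
  simp [cechDiff_apply]

/-- The contracting homotopy `c ↦ (σ ↦ ± c (σ ∪ {i}))` of the augmented Čech complex of a
simplex. -/
def cechHomotopy (i : Fin (n + 1)) (c : PreCochain n) : PreCochain n :=
  fun σ => if i ∈ σ then 0 else cechSign i σ • c (insert i σ)

lemma cechHomotopy_spec (i : Fin (n + 1)) (c : PreCochain n) (σ : Finset (Fin (n + 1))) :
    cechDiff n (cechHomotopy i c) σ + cechHomotopy i (cechDiff n c) σ = c σ := by
  by_cases hi : i ∈ σ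
  · rw [cechDiff_apply, Finset.sum_eq_single_of_mem i hi]
    · simp [cechHomotopy, hi, cechSign_erase, Finset.insert_erase hi, smul_smul,
        cechSign_mul_self]
    · intro j _ hj
      rw [cechHomotopy, if_pos (Finset.mem_erase.2 ⟨hj.symm, hi⟩), smul_zero]
  · rw [cechDiff_apply, cechHomotopy, if_neg hi, cechDiff_apply, Finset.sum_insert hi,
      Finset.erase_insert hi, cechSign_insert, smul_add, smul_smul, cechSign_mul_self, one_smul,
      add_left_comm, add_eq_left, Finset.smul_sum, ← Finset.sum_add_distrib]
    refine Finset.sum_eq_zero fun j hj => ?_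
    have hji : i ≠ j := fun h => hi (h ▸ hj)
    rw [cechHomotopy, if_neg (fun h => hi (Finset.mem_of_mem_erase h)), smul_smul, smul_smul,
      cechSign_swap hi hj, Finset.erase_insert_of_ne hji, neg_smul, neg_add_cancel]

lemma cechDiff_cechDiff (c : PreCochain n) : cechDiff n (cechDiff n c) = 0 := by
  funext σ
  induction σ using Finset.induction_on generalizing c with
  | empty => exact cechDiff_empty _
  | insert i σ hi ih =>
    -- The homotopies commute with the square of the differential, which reduces `σ ∪ {i}` to `σ`.
    have h1 : cechDiff n (cechHomotopy i c) = c - cechHomotopy i (cechDiff n c) :=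
      funext fun τ => eq_sub_of_add_eq (cechHomotopy_spec i c τ)
    have h2 := cechHomotopy_spec i (cechDiff n c) σ
    have h3 := ih (cechHomotopy i c)
    rw [h1, map_sub, Pi.sub_apply, Pi.zero_apply, sub_eq_zero] at h3
    rw [← h3, add_eq_left, cechHomotopy, if_neg hi] at h2
    have h4 := congrArg (cechSign i σ • ·) h2
    change _ = (0 : Alg n)
    simpa only [smul_smul, cechSign_mul_self, one_smul, smul_zero] using h4

/-- Away from the monomials all of whose exponents are negative, the augmented Čech complex is
exact. -/
lemma cech_exact {P : Idx n → Prop} {s : ℕ} {c : PreCochain n}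
    (hc : ∀ σ, c σ ∈ Sp fun i => P i ∧ i.Regular σ) (hs : ∀ σ, σ.card ≠ s → c σ = 0)
    (hδ : cechDiff n c = 0) (hu : c Finset.univ ∈ Sp fun i : Idx n => ∃ k, 0 ≤ i.m k) :
    ∃ b : PreCochain n, (∀ σ, b σ ∈ Sp fun i => P i ∧ i.Regular σ) ∧
      (∀ σ, σ.card + 1 ≠ s → b σ = 0) ∧ cechDiff n b = c := by
  classical
  let g : Idx n → Option (Fin (n + 1)) := fun i =>
    if h : ∃ k, 0 ≤ i.m k then some h.choose else none
  have hg : ∀ i k, g i = some k → 0 ≤ i.m k := by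
    intro i k h
    simp only [g] at h
    split_ifs at h with h'
    rw [← Option.some.inj h]
    exact h'.choose_spec
  refine ⟨fun σ => ∑ k, pr (fun i => g i = some k) (cechHomotopy k c σ), fun σ => ?_,
    fun σ hσ => ?_, funext fun σ => ?_⟩
  · refine Submodule.sum_mem _ fun k _ => ?_
    rw [cechHomotopy]
    split_ifs with hk
    · rw [map_zero]
      exact zero_mem _
    · rw [map_smul]
      refine Submodule.smul_mem _ _ (Sp_mono ?_ (pr_mem (hc (insert k σ))))
      rintro i ⟨⟨h1, h2⟩, h3⟩
      refine ⟨h1, fun j hj => ?_⟩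
      by_cases hjk : j = k
      · subst hjk
        exact hg i j h3
      · exact h2 j (by simp [hjk, hj])
  · refine Finset.sum_eq_zero fun k _ => ?_
    rw [cechHomotopy]
    split_ifs with hk
    · exact map_zero _
    · rw [hs _ (by rwa [Finset.card_insert_of_notMem hk]), smul_zero, map_zero]
  · have e : (fun σ => ∑ k, pr (fun i => g i = some k) (cechHomotopy k c σ)) =
        ∑ k, fun σ => pr (fun i => g i = some k) (cechHomotopy k c σ) := by
      funext τ
      simp
    rw [e, map_sum, Finset.sum_apply]
    have e2 : ∀ k, cechDiff n (fun σ => pr (fun i => g i = some k) (cechHomotopy k c σ)) σ =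
        pr (fun i => g i = some k) (c σ) := fun k => by
      rw [cechDiff_map]
      congr 1
      have := cechHomotopy_spec k c σ
      rw [hδ] at this
      simpa [cechHomotopy] using this
    simp only [e2]
    have hne : c σ ∈ Sp fun i : Idx n => ∃ k, 0 ≤ i.m k := by
      by_cases h : σ = Finset.univ
      · rw [h]
        exact hu
      · obtain ⟨k, hk⟩ : ∃ k, k ∉ σ := by
          by_contra! h'
          exact h (Finset.eq_univ_iff_forall.2 h')
        exact Sp_mono (fun i hi => ⟨k, hi.2 k hk⟩) (hc σ)
    have h0 : pr (fun i => g i = none) (c σ) = 0 := pr_eq_zero (fun i hi => by simp [g, hi]) hne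
    have := sum_pr_eq Finset.univ g (fun i _ => Finset.mem_univ _) hne
    rwa [Fintype.sum_option, h0, zero_add] at this

/-! ### The total complex of a differential on the coefficients -/

/-- The total differential `δ + (-1)^p d` on the augmented Čech cochains. -/
def totD (d : Alg n →ₗ[ℂ] Alg n) : PreCochain n →ₗ[ℂ] PreCochain n :=
  cechDiff n + LinearMap.pi fun σ =>
    ((-1 : ℂ) ^ (σ.card + 1)) • (d ∘ₗ LinearMap.proj σ)

lemma totD_apply (d : Alg n →ₗ[ℂ] Alg n) (c : PreCochain n) (σ : Finset (Fin (n + 1))) :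
    totD d c σ = cechDiff n c σ + ((-1 : ℂ) ^ (σ.card + 1)) • d (c σ) := rfl

lemma totalDiff_eq (f : MvPolynomial (Fin (n + 1)) ℂ) : totalDiff f = totD (dAlg f) := rfl

lemma totD_empty (d : Alg n →ₗ[ℂ] Alg n) (c : PreCochain n) : totD d c ∅ = -d (c ∅) := by
  rw [totD_apply, cechDiff_empty]
  simp

lemma totD_totD {d : Alg n →ₗ[ℂ] Alg n} (hd : ∀ w, d (d w) = 0) (c : PreCochain n) :
    totD d (totD d c) = 0 := by
  funext σ
  have e : totD d c = cechDiff n c + fun τ => ((-1 : ℂ) ^ (τ.card + 1)) • d (c τ) := rfl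
  rw [totD_apply, e, map_add, Pi.add_apply, Pi.add_apply, map_add, cechDiff_cechDiff, map_smul,
    hd, smul_zero, add_zero, Pi.zero_apply, zero_add, cechDiff_apply, cechDiff_apply, map_sum,
    Finset.smul_sum, ← Finset.sum_add_distrib]
  refine Finset.sum_eq_zero fun i hi => ?_
  have h : (σ.erase i).card + 1 = σ.card := Finset.card_erase_add_one hi
  rw [h, map_smul, smul_comm, pow_succ, mul_neg_one, neg_smul, add_neg_cancel]

variable {P : ℤ → Idx n → Prop}

/-- Augmented Čech cochains of total degree `m` for a family `P` of sets of monomials; a component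
over a set with `p + 1` elements is a combination of monomials that satisfy `P (m - p)`. -/
def Coch (P : ℤ → Idx n → Prop) (m : ℤ) : Submodule ℂ (PreCochain n) where
  carrier := { c | ∀ σ, c σ ∈ Sp fun i => P (m + 1 - σ.card) i ∧ i.Regular σ }
  add_mem' := by
    intro a b ha hb σ
    rw [Pi.add_apply]
    exact Submodule.add_mem _ (ha σ) (hb σ)
  zero_mem' := fun _ => Submodule.zero_mem _
  smul_mem' := by
    intro r a ha σ
    rw [Pi.smul_apply]
    exact Submodule.smul_mem _ r (ha σ)

lemma cechDiff_mem {m : ℤ} {c : PreCochain n} (hc : c ∈ Coch P m) :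
    cechDiff n c ∈ Coch P (m + 1) := by
  intro σ
  rw [cechDiff_apply]
  refine Submodule.sum_mem _ fun i hi => Submodule.smul_mem _ _ (Sp_mono ?_ (hc (σ.erase i)))
  rintro j ⟨h1, h2⟩
  have h : ((σ.erase i).card : ℤ) + 1 = σ.card := by exact_mod_cast Finset.card_erase_add_one hi
  refine ⟨?_, fun k hk => h2 k fun hk' => hk (Finset.mem_of_mem_erase hk')⟩
  rwa [show m + 1 + 1 - (σ.card : ℤ) = m + 1 - ((σ.erase i).card : ℤ) by omega]

lemma totD_mem {d : Alg n →ₗ[ℂ] Alg n}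
    (hd : ∀ σ q, ∀ w ∈ Sp (fun i => P q i ∧ i.Regular σ),
      d w ∈ Sp fun i => P (q + 1) i ∧ i.Regular σ)
    {m : ℤ} {c : PreCochain n} (hc : c ∈ Coch P m) : totD d c ∈ Coch P (m + 1) := by
  intro σ
  refine add_mem (cechDiff_mem hc σ) (Submodule.smul_mem _ _ ?_)
  have := hd _ _ _ (hc σ)
  rwa [show m + 1 - (σ.card : ℤ) + 1 = m + 1 + 1 - σ.card by ring] at this

/-- The augmented cochain concentrated on the sets in `s`. -/
def restrictCard (s : ℕ) (c : PreCochain n) : PreCochain n :=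
  fun σ => if σ.card = s then c σ else 0

lemma cechDiff_restrictCard (c : PreCochain n) (s : ℕ) :
    cechDiff n (restrictCard s c) = restrictCard (s + 1) (cechDiff n c) := by
  funext σ
  rw [restrictCard, cechDiff_apply, cechDiff_apply]
  split_ifs with h
  · refine Finset.sum_congr rfl fun i hi => ?_
    rw [restrictCard, if_pos (by have := Finset.card_erase_add_one hi; omega)]
  · refine Finset.sum_eq_zero fun i hi => ?_
    rw [restrictCard, if_neg (by have := Finset.card_erase_add_one hi; omega), smul_zero]

/-- A cochain whose total differential is concentrated in Čech degrees at most `0`, and which has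
no monomials with only negative exponents over the smallest open set, is cohomologous, in the
augmented complex, to a cochain concentrated on the empty set. -/
lemma exists_reduce {d : Alg n →ₗ[ℂ] Alg n}
    (hd : ∀ σ q, ∀ w ∈ Sp (fun i => P q i ∧ i.Regular σ),
      d w ∈ Sp fun i => P (q + 1) i ∧ i.Regular σ)
    (hdd : ∀ w, d (d w) = 0) {m : ℤ} (s : ℕ) (hs : s ≤ n + 1) {c : PreCochain n}
    (hc : c ∈ Coch P m) (hsupp : ∀ σ, s < σ.card → c σ = 0)
    (hDc : ∀ σ, 2 ≤ σ.card → totD d c σ = 0)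
    (hu : c Finset.univ ∈ Sp fun i : Idx n => ∃ k, 0 ≤ i.m k) :
    ∃ b ∈ Coch P (m - 1), b Finset.univ = 0 ∧ ∀ σ, σ.Nonempty → c σ = totD d b σ := by
  have hcard : (Finset.univ : Finset (Fin (n + 1))).card = n + 1 := by simp
  induction s generalizing c with
  | zero =>
    refine ⟨0, zero_mem _, rfl, fun σ hσ => ?_⟩
    rw [hsupp σ (Finset.card_pos.2 hσ), map_zero]
    rfl
  | succ s ih =>
    have hδ : cechDiff n (restrictCard (s + 1) c) = 0 := by
      rw [cechDiff_restrictCard]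
      funext σ
      rw [restrictCard]
      split_ifs with h
      · have := hDc σ (by omega)
        rw [totD_apply, hsupp σ (by omega), map_zero, smul_zero, add_zero] at this
        exact this
      · rfl
    obtain ⟨b, hb, hbs, hbc⟩ := cech_exact (P := P (m - s)) (s := s + 1)
      (c := restrictCard (s + 1) c) (fun σ => by
        rw [restrictCard]
        split_ifs with h
        · have := hc σ
          rw [h] at this
          push_cast at this
          rwa [show m + 1 - ((s : ℤ) + 1) = m - s by ring] at this
        · exact zero_mem _)
      (fun σ hσ => if_neg hσ) hδ (by
        rw [restrictCard]
        split_ifs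
        · exact hu
        · exact zero_mem _)
    have hb' : b ∈ Coch P (m - 1) := by
      intro σ
      by_cases h : σ.card = s
      · have := hb σ
        rwa [show m - 1 + 1 - (σ.card : ℤ) = m - s by rw [h]; ring]
      · rw [hbs σ (by omega)]
        exact zero_mem _
    have hbu : b Finset.univ = 0 := hbs _ (by omega)
    have hsupp' : ∀ σ, s < σ.card → (c - totD d b) σ = 0 := by
      intro σ hσ
      rw [Pi.sub_apply, totD_apply, hbc, hbs σ (by omega), map_zero, smul_zero, add_zero,
        restrictCard]
      split_ifs with h
      · exact sub_self _
      · rw [hsupp σ (by omega), sub_zero]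
    obtain ⟨b', hb'', hbu', h⟩ := ih (by omega) (c := c - totD d b)
      (sub_mem hc (by simpa using totD_mem hd hb')) hsupp'
      (fun σ hσ => by rw [map_sub, totD_totD hdd, sub_zero]; exact hDc σ hσ)
      (by rw [hsupp' _ (by omega)]; exact zero_mem _)
    refine ⟨b + b', add_mem hb' hb'', by simp [hbu, hbu'], fun σ hσ => ?_⟩
    rw [map_add, Pi.add_apply, ← h σ hσ, Pi.sub_apply]
    abel

/-- The augmented cochain with one component, over the empty set. -/
def emptyCochain (u : Alg n) : PreCochain n := fun σ => if σ = ∅ then u else 0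

/-- The Čech `0`-cochain with the same component over every `U_i`. -/
def constCochain (u : Alg n) : PreCochain n := fun σ => if σ.card = 1 then u else 0

lemma cechDiff_emptyCochain (u : Alg n) : cechDiff n (emptyCochain u) = constCochain u := by
  have e : emptyCochain u = restrictCard 0 fun _ => u := by
    funext σ
    simp [emptyCochain, restrictCard]
  rw [e, cechDiff_restrictCard]
  funext σ
  rw [restrictCard, constCochain]
  split_ifs with h
  · obtain ⟨i, rfl⟩ := Finset.card_eq_one.1 h
    rw [cechDiff_singleton]
  · rfl

lemma cechDiff_constCochain (u : Alg n) : cechDiff n (constCochain u) = 0 := by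
  rw [← cechDiff_emptyCochain, cechDiff_cechDiff]

lemma totD_constCochain (d : Alg n →ₗ[ℂ] Alg n) (u : Alg n) :
    totD d (constCochain u) = constCochain (d u) := by
  funext σ
  rw [totD_apply, cechDiff_constCochain, Pi.zero_apply, zero_add, constCochain, constCochain]
  split_ifs with h
  · simp [h]
  · rw [map_zero, smul_zero]

lemma constCochain_add (u v : Alg n) :
    constCochain (u + v) = constCochain u + constCochain v := by
  funext σ
  simp only [constCochain, Pi.add_apply]
  split_ifs <;> simp

lemma constCochain_smul (r : ℂ) (u : Alg n) : constCochain (r • u) = r • constCochain u := by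
  funext σ
  simp only [constCochain, Pi.smul_apply]
  split_ifs <;> simp

lemma constCochain_injective : Function.Injective (constCochain (n := n)) := fun u v h => by
  simpa [constCochain] using congrFun h {0}

lemma constCochain_mem {m : ℤ} {u : Alg n} (hu : u ∈ Sp fun i => P m i ∧ i.Regular ∅) :
    constCochain u ∈ Coch P m := by
  intro σ
  rw [constCochain]
  split_ifs with h
  · refine Sp_mono ?_ hu
    rintro i ⟨h1, h2⟩
    refine ⟨?_, fun k _ => h2 k (Finset.notMem_empty k)⟩
    rw [h]
    simpa using h1
  · exact zero_mem _

/-- A Čech cochain whose total differential lives in Čech degree `0`, and which has no monomials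
with only negative exponents over the smallest open set, is cohomologous to a constant one. -/
lemma exists_eq_totD_add_const {d : Alg n →ₗ[ℂ] Alg n}
    (hd : ∀ σ q, ∀ w ∈ Sp (fun i => P q i ∧ i.Regular σ),
      d w ∈ Sp fun i => P (q + 1) i ∧ i.Regular σ)
    (hdd : ∀ w, d (d w) = 0) {m : ℤ} {c : PreCochain n}
    (hc : c ∈ Coch P m) (hc0 : c ∅ = 0) (hDc : ∀ σ, 2 ≤ σ.card → totD d c σ = 0)
    (hu : c Finset.univ ∈ Sp fun i : Idx n => ∃ k, 0 ≤ i.m k) :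
    ∃ b ∈ Coch P (m - 1), b ∅ = 0 ∧ b Finset.univ = 0 ∧
      ∃ u ∈ Sp (fun i => P m i ∧ i.Regular ∅), c = totD d b + constCochain u := by
  have hcard : (Finset.univ : Finset (Fin (n + 1))).card = n + 1 := by simp
  obtain ⟨b, hb, hbu, h⟩ := exists_reduce hd hdd (n + 1) le_rfl hc
    (fun σ hσ => by
      have := Finset.card_le_univ σ
      rw [Fintype.card_fin] at this
      omega) hDc hu
  refine ⟨b - emptyCochain (b ∅), fun σ => ?_, by simp [emptyCochain], ?_, b ∅, ?_, ?_⟩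
  · rw [Pi.sub_apply, emptyCochain]
    split_ifs with hσ
    · rw [hσ, sub_self]
      exact zero_mem _
    · rw [sub_zero]
      exact hb σ
  · rw [Pi.sub_apply, hbu, emptyCochain, if_neg (Finset.univ_nonempty.ne_empty), sub_zero]
  · simpa using hb ∅
  · funext σ
    rw [map_sub, Pi.add_apply, Pi.sub_apply, totD_apply d (emptyCochain _), cechDiff_emptyCochain]
    by_cases hσ : σ = ∅
    · subst hσ
      simp [hc0, totD_empty, emptyCochain, constCochain]
    · rw [h σ (Finset.nonempty_iff_ne_empty.2 hσ), emptyCochain, if_neg hσ, map_zero, smul_zero]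
      abel

/-- If `d` is exact over every open set of the cover, then every `d`-cycle extends to a cycle of
the augmented total complex. -/
lemma exists_extend {d : Alg n →ₗ[ℂ] Alg n}
    (hd : ∀ σ q, ∀ w ∈ Sp (fun i => P q i ∧ i.Regular σ),
      d w ∈ Sp fun i => P (q + 1) i ∧ i.Regular σ)
    (hdd : ∀ w, d (d w) = 0)
    (hloc : ∀ σ : Finset (Fin (n + 1)), σ.Nonempty → ∀ q,
      ∀ g ∈ Sp (fun i => P q i ∧ i.Regular σ), d g = 0 →
        ∃ g' ∈ Sp (fun i => P (q - 1) i ∧ i.Regular σ), d g' = g)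
    {m : ℤ} {w : Alg n} (hw : w ∈ Sp fun i => P (m + 1) i ∧ i.Regular ∅) (hdw : d w = 0) (s : ℕ) :
    ∃ c ∈ Coch P m, c ∅ = w ∧ ∀ σ, σ.card ≤ s → totD d c σ = 0 := by
  induction s with
  | zero =>
    refine ⟨emptyCochain w, fun σ => ?_, if_pos rfl, fun σ hσ => ?_⟩
    · rw [emptyCochain]
      split_ifs with hσ
      · rw [hσ]
        simpa using hw
      · exact zero_mem _
    · rw [Finset.card_eq_zero.1 (Nat.le_zero.1 hσ), totD_empty, emptyCochain, if_pos rfl, hdw,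
        neg_zero]
  | succ s ih =>
    obtain ⟨c, hc, hcw, hDc⟩ := ih
    have hcl : ∀ σ : Finset (Fin (n + 1)), σ.card = s + 1 → d (totD d c σ) = 0 := by
      intro σ hσ
      have h := congrFun (totD_totD hdd c) σ
      rw [totD_apply, cechDiff_apply, Finset.sum_eq_zero, zero_add, Pi.zero_apply] at h
      · have h' := congrArg (((-1 : ℂ) ^ (σ.card + 1)) • ·) h
        simpa [smul_smul, ← mul_pow] using h'
      · intro i hi
        rw [hDc _ (by have := Finset.card_erase_add_one hi; omega), smul_zero]
    have hex : ∀ σ : Finset (Fin (n + 1)), ∃ g : Alg n, σ.card = s + 1 →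
        g ∈ Sp (fun i => P (m + 1 - σ.card) i ∧ i.Regular σ) ∧ d g = totD d c σ := by
      intro σ
      by_cases hσ : σ.card = s + 1
      · obtain ⟨g, hg, hdg⟩ := hloc σ (Finset.card_pos.1 (by omega)) _ _ (totD_mem hd hc σ)
          (hcl σ hσ)
        refine ⟨g, fun _ => ⟨?_, hdg⟩⟩
        rwa [show m + 1 + 1 - (σ.card : ℤ) - 1 = m + 1 - σ.card by ring] at hg
      · exact ⟨0, fun h => (hσ h).elim⟩
    choose g hg using hex
    let b : PreCochain n := restrictCard (s + 1) fun σ => ((-1 : ℂ) ^ (σ.card + 1)) • g σ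
    have hb : b ∈ Coch P m := by
      intro σ
      simp only [b, restrictCard]
      split_ifs with hσ
      · exact Submodule.smul_mem _ _ (hg σ hσ).1
      · exact zero_mem _
    have hδb : ∀ σ, σ.card ≤ s + 1 → cechDiff n b σ = 0 := by
      intro σ hσ
      simp only [b]
      rw [cechDiff_restrictCard, restrictCard, if_neg (by omega)]
    refine ⟨c - b, sub_mem hc hb, ?_, fun σ hσ => ?_⟩
    · rw [Pi.sub_apply, hcw]
      simp [b, restrictCard]
    · rw [map_sub, Pi.sub_apply, totD_apply d b, hδb σ hσ, zero_add]
      simp only [b, restrictCard]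
      split_ifs with h
      · rw [map_smul, smul_smul, (hg σ h).2, ← mul_pow]
        simp
      · rw [hDc σ (by omega)]
        simp

/-- Local exactness of `d`, together with the absence of monomials with only negative exponents in
the relevant degree, gives global exactness. -/
lemma exists_eq_of_local {d : Alg n →ₗ[ℂ] Alg n}
    (hd : ∀ σ q, ∀ w ∈ Sp (fun i => P q i ∧ i.Regular σ),
      d w ∈ Sp fun i => P (q + 1) i ∧ i.Regular σ)
    (hdd : ∀ w, d (d w) = 0)
    (hloc : ∀ σ : Finset (Fin (n + 1)), σ.Nonempty → ∀ q,
      ∀ g ∈ Sp (fun i => P q i ∧ i.Regular σ), d g = 0 →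
        ∃ g' ∈ Sp (fun i => P (q - 1) i ∧ i.Regular σ), d g' = g)
    {q : ℤ} (htop : ∀ i, P (q - (n + 1)) i → ∃ k, 0 ≤ i.m k)
    {w : Alg n} (hw : w ∈ Sp fun i => P q i ∧ i.Regular ∅) (hdw : d w = 0) :
    ∃ w' ∈ Sp (fun i => P (q - 1) i ∧ i.Regular ∅), d w' = w := by
  have hcard : ∀ σ : Finset (Fin (n + 1)), σ.card ≤ n + 1 := fun σ => by
    simpa using Finset.card_le_univ σ
  obtain ⟨c, hc, hcw, hDc⟩ := exists_extend hd hdd hloc (m := q - 1) (w := w) (by simpa using hw)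
    hdw (n + 1)
  have hDc' : totD d c = 0 := funext fun σ => hDc σ (hcard σ)
  obtain ⟨b, hb, -, h⟩ := exists_reduce hd hdd (n + 1) le_rfl hc
    (fun σ hσ => absurd (hcard σ) (by omega)) (fun σ _ => by rw [hDc']; rfl)
    (Sp_mono (fun i hi => htop i (by simpa using hi.1)) (hc Finset.univ))
  have hz : c - totD d b = emptyCochain ((c - totD d b) ∅) := by
    funext σ
    rw [emptyCochain]
    split_ifs with hσ
    · rw [hσ]
    · rw [Pi.sub_apply, h σ (Finset.nonempty_iff_ne_empty.2 hσ), sub_self]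
  have h1 : totD d (c - totD d b) {0} = (c - totD d b) ∅ := by
    rw [totD_apply, cechDiff_singleton]
    nth_rw 2 [hz]
    simp [emptyCochain]
  rw [map_sub, totD_totD hdd, hDc', sub_zero, Pi.zero_apply, Pi.sub_apply, hcw, totD_empty,
    sub_neg_eq_add] at h1
  refine ⟨-b ∅, neg_mem ?_, ?_⟩
  · simpa using hb ∅
  · rw [map_neg]
    exact (eq_neg_of_add_eq_zero_left h1.symm).symm

/-! ### The Jacobian ideal -/

lemma homogeneousComponent_mul_right (p : MvPolynomial (Fin (n + 1)) ℂ)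
    {q : MvPolynomial (Fin (n + 1)) ℂ} (a : ℕ) {b : ℕ} (hq : q.IsHomogeneous b) :
    homogeneousComponent (a + b) (p * q) = homogeneousComponent a p * q := by
  let _ : GradedAlgebra (homogeneousSubmodule (Fin (n + 1)) ℂ) := MvPolynomial.gradedAlgebra
  have := DirectSum.coe_decompose_mul_add_of_right_mem (homogeneousSubmodule (Fin (n + 1)) ℂ)
    (a := p) (i := a) ((mem_homogeneousSubmodule _ _).2 hq)
  rw [← decomposition.decompose'_apply, ← decomposition.decompose'_apply]
  exact this

lemma homogeneousComponent_mul_right_of_lt (p : MvPolynomial (Fin (n + 1)) ℂ)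
    {q : MvPolynomial (Fin (n + 1)) ℂ} {a b : ℕ} (hq : q.IsHomogeneous b) (h : a < b) :
    homogeneousComponent a (p * q) = 0 := by
  let _ : GradedAlgebra (homogeneousSubmodule (Fin (n + 1)) ℂ) := MvPolynomial.gradedAlgebra
  have := DirectSum.coe_decompose_mul_of_right_mem_of_not_le
    (homogeneousSubmodule (Fin (n + 1)) ℂ) (a := p) (n := a)
    ((mem_homogeneousSubmodule _ _).2 hq) (by omega)
  rw [← decomposition.decompose'_apply]
  exact this

lemma homogeneousComponent_eq_sum {f h : MvPolynomial (Fin (n + 1)) ℂ}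
    (hf : f.IsHomogeneous (n + 1)) {D : ℕ} (hJ : h ∈ jacobianIdeal f) :
    ∃ g : Fin (n + 1) → MvPolynomial (Fin (n + 1)) ℂ, (∀ j, (g j).IsHomogeneous D) ∧
      ∑ j, g j * pderiv j f = homogeneousComponent (D + n) h := by
  obtain ⟨c, rfl⟩ := Ideal.mem_span_range_iff_exists_fun.1 hJ
  refine ⟨fun j => homogeneousComponent D (c j),
    fun j => homogeneousComponent_isHomogeneous _ _, ?_⟩
  rw [map_sum]
  refine Finset.sum_congr rfl fun j _ => ?_
  have hj : (pderiv j f).IsHomogeneous n := hf.pderiv (i := j)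
  exact (homogeneousComponent_mul_right _ _ hj).symm

lemma homogeneousComponent_eq_zero_of_mem {f h : MvPolynomial (Fin (n + 1)) ℂ}
    (hf : f.IsHomogeneous (n + 1)) {D : ℕ} (hD : D < n) (hJ : h ∈ jacobianIdeal f) :
    homogeneousComponent D h = 0 := by
  obtain ⟨c, rfl⟩ := Ideal.mem_span_range_iff_exists_fun.1 hJ
  rw [map_sum]
  exact Finset.sum_eq_zero fun j _ =>
    homogeneousComponent_mul_right_of_lt _ (hf.pderiv (i := j)) hD

lemma homogeneousComponent_mem_jacobianIdeal {f h : MvPolynomial (Fin (n + 1)) ℂ}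
    (hf : f.IsHomogeneous (n + 1)) (hJ : h ∈ jacobianIdeal f) (D : ℕ) :
    homogeneousComponent D h ∈ jacobianIdeal f := by
  by_cases hD : D < n
  · rw [homogeneousComponent_eq_zero_of_mem hf hD hJ]
    exact zero_mem _
  · obtain ⟨D, rfl⟩ := Nat.exists_eq_add_of_le' (not_lt.1 hD)
    obtain ⟨g, -, hg⟩ := homogeneousComponent_eq_sum hf (D := D) hJ
    rw [← hg]
    exact sum_mem fun j _ => Ideal.mul_mem_left _ _ (Ideal.subset_span ⟨j, rfl⟩)

lemma mem_jacobianIdeal_self {f : MvPolynomial (Fin (n + 1)) ℂ} (hf : f.IsHomogeneous (n + 1)) :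
    f ∈ jacobianIdeal f := by
  have h : ∑ i, X i * pderiv i f ∈ jacobianIdeal f :=
    sum_mem fun i _ => Ideal.mul_mem_left _ _ (Ideal.subset_span ⟨i, rfl⟩)
  rw [hf.sum_X_mul_pderiv, nsmul_eq_mul] at h
  have h2 := Ideal.mul_mem_left _ (C ((n + 1 : ℕ) : ℂ)⁻¹) h
  rw [← mul_assoc, ← map_natCast (C (R := ℂ) (σ := Fin (n + 1))), ← C_mul,
    inv_mul_cancel₀ (by exact_mod_cast Nat.succ_ne_zero n), C_1, one_mul] at h2
  exact h2

/-- By the Nullstellensatz and Euler's identity, the Jacobian ideal of a nonsingular form contains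
a power of every variable. -/
lemma exists_X_pow_eq {f : MvPolynomial (Fin (n + 1)) ℂ} (hf : f.IsHomogeneous (n + 1))
    (hns : IsNonsingular f) (i : Fin (n + 1)) :
    ∃ (N : ℕ) (g : Fin (n + 1) → MvPolynomial (Fin (n + 1)) ℂ), (∀ j, (g j).IsHomogeneous N) ∧
      ∑ j, g j * pderiv j f = X i ^ (N + n) := by
  have hrad : X i ∈ (jacobianIdeal f).radical := by
    rw [← MvPolynomial.vanishingIdeal_zeroLocus_eq_radical (K := ℂ), mem_vanishingIdeal_iff]
    intro x hx
    have hx' : ∀ p ∈ jacobianIdeal f, eval x p = 0 := fun p hp => by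
      simpa [coe_aeval_eq_eval] using hx p hp
    by_contra hne
    have hx0 : x ≠ 0 := fun h => hne (by simp [h])
    obtain ⟨j, hj⟩ := hns x hx0 (hx' f (mem_jacobianIdeal_self hf))
    exact hj (hx' _ (Ideal.subset_span ⟨j, rfl⟩))
  obtain ⟨N, hN⟩ := hrad
  obtain ⟨g, hg, hgs⟩ := homogeneousComponent_eq_sum hf (D := N)
    (Ideal.mul_mem_right (X i ^ n) _ hN)
  refine ⟨N, g, hg, ?_⟩
  rw [hgs, ← pow_add]
  exact homogeneousComponent_eq_self (isHomogeneous_X_pow i (N + n))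

/-! ### Exactness of the Koszul complex of the partial derivatives -/

/-- The monomials of the Koszul complex: those free of `y`, with given exponents of `∂` and `e`, of
homological degree `-q` and of internal degree `D`, where `∂ᵢ` has the degree `n` of `fᵢ`. -/
def KoszulDeg (c a : ℕ) (D q : ℤ) (i : Idx n) : Prop :=
  i.c = c ∧ i.a = a ∧ yExp i.J = 0 ∧ dNum i.J = -q ∧ ∑ k, i.m k = D + n * q

lemma xMon_mul_ofPoly_X_pow (i : Fin (n + 1)) (K : ℕ) :
    xMon (-Pi.single i (K : ℤ)) * ofPoly (X i ^ K) = (1 : Coeff n) := by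
  rw [map_pow, ofPoly, aeval_X, xMon, xMon, AddMonoidAlgebra.single_pow,
    AddMonoidAlgebra.single_mul_single, one_pow, one_mul, AddMonoidAlgebra.one_def]
  congr 1
  ext j
  · by_cases h : j = i <;> simp [h]
  · simp

lemma contr_koszulForm₀_wedgeMul {f : MvPolynomial (Fin (n + 1)) ℂ}
    (g : Fin (n + 1) → MvPolynomial (Fin (n + 1)) ℂ) {w : Alg n}
    (hw : contr (koszulForm₀ f) w = 0) :
    contr (koszulForm₀ f) (∑ j, ofPoly (g j) • wedgeMul (Pi.single (some j) 1) w) =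
      ofPoly (∑ j, g j * pderiv j f) • w := by
  simp only [map_sum, map_smul, contr_wedgeMul, hw, map_zero, sub_zero, map_mul,
    Finset.sum_smul, mul_smul]
  refine Finset.sum_congr rfl fun j _ => ?_
  congr 2
  rw [koszulForm₀_apply, Finset.sum_eq_single j]
  · simp
  · intro k _ hk
    simp [hk]
  · simp

/-- The partial derivatives of a nonsingular form have no Koszul homology in positive homological
degrees, and their quotient ring vanishes above the socle degree `(n+1)(n-1)`. -/
lemma koszul_exact {f : MvPolynomial (Fin (n + 1)) ℂ} (hf : f.IsHomogeneous (n + 1))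
    (hns : IsNonsingular f) {c a : ℕ} {D q : ℤ} (hq : q < 0 ∨ q = 0 ∧ ((n : ℤ) + 1) * (n - 1) < D)
    {w : Alg n} (hw : w ∈ Sp fun i => KoszulDeg c a D q i ∧ i.Regular ∅)
    (hdw : contr (koszulForm₀ f) w = 0) :
    ∃ w' ∈ Sp (fun i => KoszulDeg c a D (q - 1) i ∧ i.Regular ∅),
      contr (koszulForm₀ f) w' = w := by
  refine exists_eq_of_local (P := KoszulDeg c a D) (d := (contr (koszulForm₀ f)).restrictScalars ℂ)
    ?_ (fun w => contr_contr _ w) ?_ ?_ hw hdw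
  · intro σ q w hw
    refine contr_koszulForm₀_mem hf ?_ hw
    rintro i j ⟨⟨h1, h2, h3, h4, h5⟩, hr⟩ g1 g2 g3 g4 g5 g6
    refine ⟨⟨g3.trans h1, g4.trans h2, g5.trans h3, ?_, ?_⟩, fun k hk => (hr k hk).trans (g1 k)⟩
    · omega
    · rw [g2, h5]
      ring
  · rintro σ ⟨i, hi⟩ q g hg hdg
    obtain ⟨N, p, hp, hps⟩ := exists_X_pow_eq hf hns i
    refine ⟨xMon (-Pi.single i ((N + n : ℕ) : ℤ)) •
      ∑ j, ofPoly (p j) • wedgeMul (Pi.single (some j) 1) g, ?_, ?_⟩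
    · refine xMon_smul_mem (P := fun j : Idx n => j.c = c ∧ j.a = a ∧ yExp j.J = 0 ∧
        dNum j.J = -(q - 1) ∧ ∑ k, j.m k = D + n * q + N ∧ j.Regular σ) _ ?_
        (Submodule.sum_mem _ fun j _ => ?_)
      · rintro j ⟨h1, h2, h3, h4, h5, hr⟩
        refine ⟨⟨h1, h2, h3, h4, ?_⟩, fun k hk => ?_⟩
        · simp only [Pi.add_apply, Pi.neg_apply, Finset.sum_add_distrib, Finset.sum_neg_distrib,
            h5, Finset.sum_pi_single', Finset.mem_univ, if_true]
          push_cast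
          ring
        · have hki : k ≠ i := fun h => hk (h ▸ hi)
          simpa [Pi.single_apply, hki] using hr k hk
      · refine ofPoly_smul_mem (hp j)
          (P := fun i' => ∃ i : Idx n, (KoszulDeg c a D q i ∧ i.Regular σ) ∧ some j ∉ i.J ∧
            i' = ⟨i.m, i.c, i.a, insert (some j) i.J⟩) ?_
          (wedgeMul_single_mem _ (fun i hi hj => ⟨i, hi, hj, rfl⟩) hg)
        rintro _ ⟨m', c', a', J'⟩ ⟨i, ⟨⟨h1, h2, h3, h4, h5⟩, hr⟩, hj, rfl⟩ g1 g2 rfl rfl rfl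
        refine ⟨h1, h2, ?_, ?_, ?_, fun k hk => (hr k hk).trans (g1 k)⟩
        · rw [yExp_insert_some, h3]
        · rw [dNum_insert_some hj, h4]
          ring
        · rw [← h5]
          exact g2
    · rw [LinearMap.restrictScalars_apply, map_smul, contr_koszulForm₀_wedgeMul p hdg, hps,
        smul_smul, xMon_mul_ofPoly_X_pow, one_smul]
  · rintro i ⟨-, -, -, h4, h5⟩
    have h6 := dNum_le i.J
    rcases hq with hq | ⟨rfl, hD⟩
    · omega
    · by_contra! hneg
      have h7 : ∑ k, i.m k ≤ ∑ _k : Fin (n + 1), (-1 : ℤ) :=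
        Finset.sum_le_sum fun k _ => by have := hneg k; omega
      rw [Finset.sum_const, Finset.card_univ, Fintype.card_fin] at h7
      simp only [nsmul_eq_mul, h5] at h7
      push_cast at h7
      nlinarith

/-! ### Elements free of `e` and `y` -/

lemma dAlg_of_free {f : MvPolynomial (Fin (n + 1)) ℂ} {w : Alg n}
    (hE : dE w = 0) (hy : contr (coordForm none) w = 0) :
    dAlg f w = bdry n • contr (koszulForm₀ f) w := by
  rw [dAlg_eq, hE, map_zero, add_zero, koszulForm_eq, contr_add, contr_smul, contr_smul, hy,
    smul_zero, zero_add]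

lemma dE_eq_zero_of_mem {w : Alg n} (hw : w ∈ Sp fun i : Idx n => i.a = 0) : dE w = 0 :=
  eq_zero_of_mem_Sp (P := fun _ : Idx n => False) (fun _ h => h)
    (dE_mem (fun i hi h => by omega) hw)

lemma contr_none_eq_zero_of_mem {w : Alg n} (hw : w ∈ Sp fun i : Idx n => none ∉ i.J) :
    contr (coordForm none) w = 0 :=
  eq_zero_of_mem_Sp (P := fun _ : Idx n => False) (fun _ h => h)
    (contr_coord_mem _ (fun _ hi h => hi h) hw)

lemma mem_Sp_of_free {P : Idx n → Prop} {w : Alg n} (hw : w ∈ Sp P) (hE : dE w = 0)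
    (hy : contr (coordForm none) w = 0) :
    w ∈ Sp fun i => P i ∧ i.a = 0 ∧ none ∉ i.J := by
  have h1 : evE w = w := by
    have := intE_dE w
    rw [hE, map_zero] at this
    exact (sub_eq_zero.1 this.symm).symm
  have h2 : contr (coordForm none) (wedgeMul (Pi.single none 1) w) = w := by
    rw [contr_wedgeMul, hy, map_zero, sub_zero]
    simp
  have h3 : w ∈ Sp fun i => P i ∧ i.a = 0 := by
    rw [← h1]
    exact evE_mem (fun _ hi ha => ⟨hi, ha⟩) hw
  rw [← h2]
  refine contr_coord_mem none (P := fun i' => ∃ i : Idx n, (P i ∧ i.a = 0) ∧ none ∉ i.J ∧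
    i' = ⟨i.m, i.c, i.a, insert none i.J⟩) ?_
    (wedgeMul_single_mem _ (fun i hi hj => ⟨i, hi, hj, rfl⟩) h3)
  rintro _ ⟨i, ⟨hi, ha⟩, hj, rfl⟩ -
  simp only [Finset.erase_insert hj]
  exact ⟨hi, ha, hj⟩

/-! ### Cohomology of the global sections -/

/-- The condition on monomials that defines the global sections of degree `q` of the `k`-th
symmetric power. -/
def Row (k q : ℤ) (i : Idx n) : Prop := (i.wt = 0 ∧ i.deg = q ∧ i.sym = k) ∧ i.Regular ∅

lemma Idx.Regular.sum_nonneg {i : Idx n} (h : i.Regular ∅) : 0 ≤ ∑ k, i.m k :=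
  Finset.sum_nonneg fun k _ => h k (Finset.notMem_empty k)

lemma dAlg_mem_Row {f : MvPolynomial (Fin (n + 1)) ℂ} (hf : f.IsHomogeneous (n + 1)) {k q : ℤ}
    {w : Alg n} (hw : w ∈ Sp (Row k q)) : dAlg f w ∈ Sp (Row k (q + 1)) := by
  refine dAlg_mem hf ?_ hw
  rintro i j ⟨⟨h1, h2, h3⟩, hr⟩ g1 g2 g3 g4
  exact ⟨⟨g2.trans h1, by rw [g3, h2], g4.trans h3⟩, fun l hl => (hr l hl).trans (g1 l)⟩

/-- In weight zero, global sections of low symmetric degree that contain `y` are divisible by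
`∂`. -/
lemma exists_bdry_smul_eq_contr {k q : ℤ} (hk : k ≤ n) {w : Alg n} (hw : w ∈ Sp (Row k q)) :
    ∃ γ ∈ Sp (Row (k - 1) (q - 1)), bdry n • γ = contr (coordForm none) w := by
  refine exists_bdry_smul_eq (P := fun i' => ∃ i : Idx n, Row k q i ∧ none ∈ i.J ∧
    i' = ⟨i.m, i.c, i.a, i.J.erase none⟩) ?_
    (contr_coord_mem _ (fun i hi hj => ⟨i, hi, hj, rfl⟩) hw)
  rintro _ ⟨i, ⟨⟨h1, h2, h3⟩, hr⟩, hj, rfl⟩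
  have h0 := hr.sum_nonneg
  simp only [Idx.wt, Idx.deg, Idx.sym, yExp_of_mem hj] at h1 h2 h3
  have hc : 1 ≤ i.c := by
    by_contra! hc
    have hc' : i.c = 0 := by omega
    simp only [hc', Nat.cast_zero, mul_zero] at h1 h3
    omega
  refine ⟨hc, ⟨?_, ?_, ?_⟩, hr⟩ <;>
    simp only [Idx.wt, Idx.deg, Idx.sym, yExp_erase_none, dNum_erase_none] <;>
    push_cast [hc] <;> linarith

lemma dAlg_of_bdry_smul_eq_contr {f : MvPolynomial (Fin (n + 1)) ℂ} {w γ : Alg n}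
    (hγ : bdry n • γ = contr (coordForm none) w) (hdw : dAlg f w = 0) :
    dAlg f γ = -((n + 1 : ℂ) • dE w) := by
  refine bdry_smul_injective ?_
  have h := contr_none_dAlg f w
  rw [hdw, map_zero, zero_add, ← hγ, dAlg_smul] at h
  dsimp only
  rw [h, smul_neg, smul_comm]

/-- A closed global section is cohomologous to a multiple of one free of `e` and `y`. -/
lemma exists_free_representative {f : MvPolynomial (Fin (n + 1)) ℂ} (hf : f.IsHomogeneous (n + 1))
    {k q : ℤ} (hk : k < n) {w : Alg n} (hw : w ∈ Sp (Row k q)) (hdw : dAlg f w = 0) :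
    ∃ γ ∈ Sp (Row k (q - 1)), ∃ v ∈ Sp (Row k q), v = (n + 1 : ℂ) • w + dAlg f γ ∧
      dE v = 0 ∧ contr (coordForm none) v = 0 ∧ dAlg f v = 0 := by
  have hint : intE w ∈ Sp (Row (k + 1) q) := by
    refine intE_mem ?_ hw
    rintro i ⟨⟨h1, h2, h3⟩, hr⟩
    refine ⟨⟨h1, h2, ?_⟩, hr⟩
    simp only [Idx.sym] at h3 ⊢
    push_cast
    linarith
  have hev : evE w ∈ Sp (Row k q) := evE_mem (fun i hi _ => hi) hw
  obtain ⟨γ, hγ, hγe⟩ := exists_bdry_smul_eq_contr (by omega) hint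
  obtain ⟨γ₀, -, hγ₀e⟩ := exists_bdry_smul_eq_contr hk.le hev
  rw [add_sub_cancel_right] at hγ
  have hnone : coordForm none (eulerVec n) = -((n + 1 : ℂ) • bdry n) := by
    rw [LinearMap.proj_apply, eulerVec_none, Algebra.smul_def, map_add, map_natCast, map_one]
  have hdγ : dAlg f γ = -((n + 1 : ℂ) • w) + ((n + 1 : ℂ) • evE w + wedgeMul (eulerVec n) γ₀) := by
    refine bdry_smul_injective ?_
    have h := contr_none_dAlg f (intE w)
    rw [dAlg_intE hdw, contr_wedgeMul, ← hγ₀e, ← hγe, dAlg_smul, dE_intE, hnone, neg_smul,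
      smul_assoc] at h
    dsimp only
    rw [eq_sub_of_add_eq' h, smul_add, smul_add, smul_neg, smul_comm (bdry n) (n + 1 : ℂ) w,
      smul_comm (bdry n) (n + 1 : ℂ) (evE w)]
    rw [wedgeMul, LinearMap.mulLeft_apply, LinearMap.mulLeft_apply, mul_smul_comm]
    abel
  have hv : (n + 1 : ℂ) • w + dAlg f γ = (n + 1 : ℂ) • evE w + wedgeMul (eulerVec n) γ₀ := by
    rw [hdγ, add_neg_cancel_left]
  have hEγ₀ : dE γ₀ = 0 := by
    refine bdry_smul_injective ?_
    dsimp only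
    rw [← dE_smul, hγ₀e, dE_contr, dE_evE, map_zero, smul_zero]
  have hyγ₀ : contr (coordForm none) γ₀ = 0 := by
    refine bdry_smul_injective ?_
    dsimp only
    rw [← map_smul, hγ₀e, contr_contr, smul_zero]
  refine ⟨γ, hγ, _, ?_, rfl, ?_, ?_, ?_⟩
  · have := dAlg_mem_Row hf hγ
    rw [sub_add_cancel] at this
    exact add_mem (Submodule.smul_mem _ _ hw) this
  · rw [hv, map_add, map_smul, dE_evE, dE_wedgeMul, hEγ₀, map_zero, smul_zero, add_zero]
  · rw [hv, map_add, contr_wedgeMul, hyγ₀, map_zero, sub_zero, LinearMap.map_smul_of_tower,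
      ← hγ₀e, hnone, neg_smul, smul_assoc, add_neg_cancel]
  · rw [map_add, map_smul, hdw, dAlg_dAlg hf, smul_zero, add_zero]

/-- A closed global section free of `e` and `y` is exact, unless it is of the form `h ∂^k`. -/
lemma exists_of_free {f : MvPolynomial (Fin (n + 1)) ℂ} (hf : f.IsHomogeneous (n + 1))
    (hns : IsNonsingular f) {k : ℕ} {q : ℤ} (hk : k < n) {v : Alg n} (hv : v ∈ Sp (Row k q))
    (hE : dE v = 0) (hy : contr (coordForm none) v = 0) (hdv : dAlg f v = 0) :
    ∃ h : MvPolynomial (Fin (n + 1)) ℂ, h.IsHomogeneous (k * (n + 1)) ∧ (q ≠ 2 * k → h = 0) ∧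
      ∃ u ∈ Sp (Row k (q - 1)), v = polyElt k h + dAlg f u := by
  have hκ : contr (koszulForm₀ f) v = 0 := by
    refine bdry_smul_injective ?_
    dsimp only
    rw [← dAlg_of_free hE hy, hdv, smul_zero]
  have hv' := mem_Sp_of_free hv hE hy
  rcases lt_trichotomy (2 * (k : ℤ) - q) 0 with hr | hr | hr
  · have : v = 0 := by
      refine eq_zero_of_mem_Sp ?_ hv'
      rintro i ⟨⟨⟨h1, h2, h3⟩, -⟩, h4, h5⟩
      have := dNum_nonneg i.J
      simp only [Idx.deg, Idx.sym, yExp_of_notMem h5, h4] at h2 h3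
      push_cast at h3
      omega
    exact ⟨0, isHomogeneous_zero _ _ _, fun _ => rfl, 0, zero_mem _, by simp [this]⟩
  · obtain ⟨h, hh, e⟩ := exists_polyElt_eq (D := k * (n + 1)) (p := k) (w := v) (by
      refine Sp_mono ?_ hv'
      rintro i ⟨⟨⟨h1, h2, h3⟩, hreg⟩, h4, h5⟩
      simp only [Idx.wt, Idx.deg, Idx.sym, yExp_of_notMem h5, h4] at h1 h2 h3
      push_cast at h3
      have h6 : (i.c : ℤ) = k := by omega
      have h7 : dNum i.J = 0 := by omega
      refine ⟨hreg, ?_, by exact_mod_cast h6, h4, (dNum_eq_zero h5).1 h7⟩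
      rw [h6, h7] at h1
      push_cast
      linarith)
    exact ⟨h, hh, fun hq => (hq (by omega)).elim, 0, zero_mem _, by simp [e]⟩
  · obtain ⟨w', hw', e⟩ := koszul_exact hf hns (c := (q - k).toNat) (a := 0)
      (D := k * (n + 1)) (q := -(2 * k - q)) (w := v) (Or.inl (by omega)) (by
        refine Sp_mono ?_ hv'
        rintro i ⟨⟨⟨h1, h2, h3⟩, hreg⟩, h4, h5⟩
        simp only [Idx.wt, Idx.deg, Idx.sym, yExp_of_notMem h5, h4] at h1 h2 h3
        push_cast at h3
        have h6 : (i.c : ℤ) = q - k := by omega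
        have h7 : dNum i.J = 2 * k - q := by omega
        refine ⟨⟨by omega, h4, yExp_of_notMem h5, by omega, ?_⟩, hreg⟩
        rw [h6, h7] at h1
        linarith) hκ
    have hfree : ∀ i : Idx n, yExp i.J = 0 → none ∉ i.J := fun i h h' => by
      rw [yExp_of_mem h'] at h
      exact one_ne_zero h
    obtain ⟨u, hu, hue⟩ := exists_bdry_smul_eq
      (Q := fun i : Idx n => Row k (q - 1) i ∧ i.a = 0 ∧ none ∉ i.J) (by
        rintro i ⟨⟨h1, h2, h3, h4, h5⟩, hreg⟩
        have hreg' := hreg.sum_nonneg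
        have hn : (0 : ℤ) ≤ n := Int.natCast_nonneg n
        have h5' : ∑ l, i.m l = (k : ℤ) * (n + 1) - n * (dNum i.J) := by
          rw [h5, h4]
          ring
        have hc : 1 ≤ i.c := by
          by_contra! hc
          -- Without `∂` the coefficients would have negative degree.
          have h6 : q - k ≤ 0 := by omega
          nlinarith
        have h6 : (i.c : ℤ) = q - k := by omega
        have h7 : dNum i.J = 2 * k - q + 1 := by omega
        refine ⟨hc, ⟨⟨?_, ?_, ?_⟩, hreg⟩, h2, hfree i h3⟩ <;>
          simp only [Idx.wt, Idx.deg, Idx.sym, h3, h5', h2] <;>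
          push_cast [hc] <;> rw [h6, h7] <;> ring) hw'
    refine ⟨0, isHomogeneous_zero _ _ _, fun _ => rfl, u, Sp_mono (fun i hi => hi.1) hu, ?_⟩
    rw [dAlg_of_free (dE_eq_zero_of_mem (Sp_mono (fun i hi => hi.2.1) hu))
      (contr_none_eq_zero_of_mem (Sp_mono (fun i hi => hi.2.2) hu)), ← map_smul, hue, e,
      map_zero, zero_add]

/-- The cohomology of the global sections of the `k`-th symmetric power, `k < n`, is represented by
the elements `h ∂^k`. -/
lemma row_cohomology {f : MvPolynomial (Fin (n + 1)) ℂ} (hf : f.IsHomogeneous (n + 1))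
    (hns : IsNonsingular f) {k : ℕ} {q : ℤ} (hk : k < n) {w : Alg n} (hw : w ∈ Sp (Row k q))
    (hdw : dAlg f w = 0) :
    ∃ h : MvPolynomial (Fin (n + 1)) ℂ, h.IsHomogeneous (k * (n + 1)) ∧ (q ≠ 2 * k → h = 0) ∧
      ∃ u ∈ Sp (Row k (q - 1)), w = polyElt k h + dAlg f u := by
  obtain ⟨γ, hγ, v, hv, hve, hE, hy, hdv⟩ :=
    exists_free_representative hf (by exact_mod_cast hk) hw hdw
  obtain ⟨h, hh, hq, u, hu, e⟩ := exists_of_free hf hns hk hv hE hy hdv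
  have hn : (n + 1 : ℂ) ≠ 0 := by exact_mod_cast Nat.succ_ne_zero n
  refine ⟨(n + 1 : ℂ)⁻¹ • h, (homogeneousSubmodule _ ℂ _).smul_mem _ hh,
    fun hq' => by rw [hq hq', smul_zero], (n + 1 : ℂ)⁻¹ • (u - γ),
    Submodule.smul_mem _ _ (sub_mem hu hγ), ?_⟩
  rw [map_smul, map_smul, ← smul_add, map_sub, ← add_sub_assoc, ← e, hve, add_sub_cancel_right,
    smul_smul, inv_mul_cancel₀ hn, one_smul]

lemma polyElt_mem_Row {k : ℕ} {h : MvPolynomial (Fin (n + 1)) ℂ}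
    (hh : h.IsHomogeneous (k * (n + 1))) : polyElt k h ∈ Sp (Row k (2 * k)) := by
  refine Sp_mono ?_ (polyElt_mem hh k)
  rintro i ⟨hr, h2, h3, h4, h5⟩
  refine ⟨⟨?_, ?_, ?_⟩, hr⟩ <;>
    simp only [Idx.wt, Idx.deg, Idx.sym, h2, h3, h4, h5, dNum, yExp] <;>
    simp
  ring

/-- If `h` lies in the Jacobian ideal, then `h ∂^k` is exact. -/
lemma exists_dAlg_eq_polyElt {f : MvPolynomial (Fin (n + 1)) ℂ} (hf : f.IsHomogeneous (n + 1))
    {k : ℕ} (hk : k < n) {h : MvPolynomial (Fin (n + 1)) ℂ} (hh : h.IsHomogeneous (k * (n + 1)))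
    (hJ : h ∈ jacobianIdeal f) : ∃ u ∈ Sp (Row k (2 * k - 1)), dAlg f u = polyElt k h := by
  rcases k with _ | k
  · have : h = 0 := by
      rw [← homogeneousComponent_eq_self hh]
      exact homogeneousComponent_eq_zero_of_mem hf (by omega) hJ
    exact ⟨0, zero_mem _, by simp [this]⟩
  · obtain ⟨g, hg, hgs⟩ := homogeneousComponent_eq_sum hf (D := k * (n + 1) + 1) hJ
    rw [show k * (n + 1) + 1 + n = (k + 1) * (n + 1) by ring,
      homogeneousComponent_eq_self hh] at hgs
    have hb : (bdry n) • monBasis n ⟨0, k, 0, ∅⟩ = monBasis n ⟨0, k + 1, 0, ∅⟩ := by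
      rw [bdry_smul_monBasis]
      simp only [add_comm 1 k]
    have hκ : contr (koszulForm₀ f) (monBasis n ⟨0, k, 0, ∅⟩) = 0 := by
      rw [koszulForm₀_eq, contr_sum]
      refine Finset.sum_eq_zero fun j _ => ?_
      rw [contr_smul, contr_coord_monBasis_of_notMem _ (Finset.notMem_empty _), smul_zero]
    have hmem : ∑ j, ofPoly (g j) • wedgeMul (Pi.single (some j) 1) (monBasis n ⟨0, k, 0, ∅⟩) ∈
        Sp fun i => Row (k + 1 : ℕ) (2 * (k + 1 : ℕ) - 1) i ∧ i.a = 0 ∧ none ∉ i.J := by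
      refine Submodule.sum_mem _ fun j _ => ?_
      refine ofPoly_smul_mem (hg j) (P := fun i => i = ⟨0, k, 0, {some j}⟩) ?_
        (wedgeMul_single_mem _ (P := fun i => i = ⟨0, k, 0, ∅⟩) ?_ (monBasis_mem rfl))
      · rintro _ i rfl g1 g2 g3 g4 g5
        have hd : dNum ({some j} : Finset (Option (Fin (n + 1)))) = 1 := by
          rw [dNum, Finset.erase_eq_of_notMem (by simp), Finset.card_singleton, Nat.cast_one]
        have hy : yExp ({some j} : Finset (Option (Fin (n + 1)))) = 0 := by simp [yExp]
        dsimp only at g3 g4 g5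
        refine ⟨⟨⟨?_, ?_, ?_⟩, fun l _ => g1 l⟩, g4, by simp [g5]⟩ <;>
          simp only [Idx.wt, Idx.deg, Idx.sym, g2, g3, g4, g5, hd, hy]
        · simp
          ring
        · push_cast
          ring
        · push_cast
          ring
      · rintro _ rfl -
        rfl
    refine ⟨_, Sp_mono (fun i hi => hi.1) hmem, ?_⟩
    rw [dAlg_of_free (dE_eq_zero_of_mem (Sp_mono (fun i hi => hi.2.1) hmem))
      (contr_none_eq_zero_of_mem (Sp_mono (fun i hi => hi.2.2) hmem)),
      contr_koszulForm₀_wedgeMul g hκ, hgs, smul_comm, hb, polyElt_eq]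

/-! ### The elements `h ∂^k` that are exact -/

open Classical in
/-- The coefficient of `∂^k` in the part of an element that is free of `e`, of the odd generators
and of negative powers of the variables. -/
def polyPart (k : ℕ) : Alg n →ₗ[ℂ] MvPolynomial (Fin (n + 1)) ℂ :=
  (monBasis n).constr ℂ fun i => if i.Regular ∅ ∧ i.c = k ∧ i.a = 0 ∧ i.J = ∅ then
    MvPolynomial.monomial (Finsupp.equivFunOnFinite.symm fun l => (i.m l).toNat) 1 else 0

open Classical in
lemma polyPart_monBasis (k : ℕ) (i : Idx n) : polyPart k (monBasis n i) =
    if i.Regular ∅ ∧ i.c = k ∧ i.a = 0 ∧ i.J = ∅ then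
      MvPolynomial.monomial (Finsupp.equivFunOnFinite.symm fun l => (i.m l).toNat) 1 else 0 :=
  Basis.constr_basis _ _ _ _

lemma polyPart_eq_zero {k : ℕ} {w : Alg n} (hw : w ∈ Sp fun i : Idx n => i.J ≠ ∅) :
    polyPart k w = 0 := by
  have : w ∈ LinearMap.ker (polyPart k) := by
    refine Sp_le (fun i hi => ?_) hw
    rw [LinearMap.mem_ker, polyPart_monBasis, if_neg fun h => hi h.2.2.2]
  exact this

lemma polyPart_ofPoly_smul (k : ℕ) (p : MvPolynomial (Fin (n + 1)) ℂ) {w : Alg n}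
    (hw : w ∈ Sp fun i : Idx n => i.Regular ∅) :
    polyPart k (ofPoly p • w) = p * polyPart k w := by
  have : w ∈ LinearMap.eqLocus (polyPart k ∘ₗ coeffMul (ofPoly p))
      (LinearMap.mulLeft ℂ p ∘ₗ polyPart k) := by
    refine Sp_le (fun i hi => ?_) hw
    rw [LinearMap.mem_eqLocus, LinearMap.comp_apply, LinearMap.comp_apply, coeffMul_apply,
      LinearMap.mulLeft_apply]
    induction p using MvPolynomial.induction_on' with
    | add p q hp hq => rw [map_add, add_smul, map_add, hp, hq, add_mul]
    | monomial s r =>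
      have hi' : ∀ l, 0 ≤ i.m l := fun l => hi l (Finset.notMem_empty l)
      have hreg : Idx.Regular ∅ (⟨(fun l => (s l : ℤ)) + i.m, 0 + i.c, i.a, i.J⟩ : Idx n) :=
        fun l _ => add_nonneg (Int.natCast_nonneg _) (hi' l)
      rw [ofPoly_monomial, smul_assoc, single_smul_monBasis, map_smul, polyPart_monBasis,
        polyPart_monBasis]
      by_cases h : i.c = k ∧ i.a = 0 ∧ i.J = ∅
      · rw [if_pos ⟨hreg, by simpa using h⟩, if_pos ⟨hi, h⟩, monomial_mul, smul_monomial,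
          smul_eq_mul]
        have hs : (Finsupp.equivFunOnFinite.symm fun l => ((s l : ℤ) + i.m l).toNat) =
            s + Finsupp.equivFunOnFinite.symm fun l => (i.m l).toNat := by
          ext l
          simp [Int.toNat_add (Int.natCast_nonneg (s l)) (hi' l)]
        rw [← hs]
        rfl
      · rw [if_neg fun h' => h (by simpa using h'.2), if_neg fun h' => h h'.2, smul_zero, mul_zero]
  exact this

lemma polyPart_polyElt (k p : ℕ) (h : MvPolynomial (Fin (n + 1)) ℂ) :
    polyPart k (polyElt p h) = if p = k then h else 0 := by
  have hr : Idx.Regular ∅ (⟨0, p, 0, ∅⟩ : Idx n) := fun _ _ => le_rfl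
  rw [polyElt_eq, polyPart_ofPoly_smul _ _ (monBasis_mem hr), polyPart_monBasis]
  simp only [hr, and_self, and_true, true_and]
  split_ifs with hpk
  · convert mul_one h
    exact congrArg (fun s => MvPolynomial.monomial s (1 : ℂ)) (Finsupp.ext fun _ => rfl)
  · exact mul_zero _

/-- If `h ∂^k` is exact, then `h` lies in the Jacobian ideal. -/
lemma polyPart_dAlg_mem {f : MvPolynomial (Fin (n + 1)) ℂ} (hf : f.IsHomogeneous (n + 1)) (k : ℕ)
    {u : Alg n} (hu : u ∈ Sp fun i : Idx n => i.Regular ∅) :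
    polyPart k (dAlg f u) ∈ jacobianIdeal f := by
  have hcontr : ∀ j, contr (coordForm j) u ∈ Sp fun i : Idx n => i.Regular ∅ := fun j =>
    contr_coord_mem j (fun i hi _ => hi) hu
  have hE : dE u ∈ Sp fun i : Idx n => i.Regular ∅ := dE_mem (fun i hi _ => hi) hu
  have hwedge : ∀ j, wedgeMul (Pi.single j 1) (dE u) ∈
      Sp fun i : Idx n => i.Regular ∅ ∧ i.J ≠ ∅ := fun j =>
    wedgeMul_single_mem j (fun i hi _ => ⟨hi, (Finset.insert_nonempty _ _).ne_empty⟩) hE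
  rw [dAlg_eq, koszulForm_eq, contr_add, contr_smul, contr_smul,
    koszulForm₀_eq, contr_sum, wedgeMul_eulerVec_eq, map_add, map_add, map_sub, map_sum,
    Finset.smul_sum, map_sum]
  refine add_mem (add_mem ?_ (sum_mem fun j _ => ?_)) (sub_mem (sum_mem fun j _ => ?_) ?_)
  · rw [polyPart_ofPoly_smul _ _ (hcontr none)]
    exact Ideal.mul_mem_right _ _ (mem_jacobianIdeal_self hf)
  · rw [contr_smul, smul_comm, polyPart_ofPoly_smul _ _ (bdry_smul_mem (fun i hi => hi)
      (hcontr (some j)))]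
    exact Ideal.mul_mem_right _ _ (Ideal.subset_span ⟨j, rfl⟩)
  · rw [polyPart_ofPoly_smul _ _ (Sp_mono (fun i hi => hi.1) (hwedge (some j))),
      polyPart_eq_zero (Sp_mono (fun i hi => hi.2) (hwedge (some j))), mul_zero]
    exact zero_mem _
  · rw [map_smul, polyPart_eq_zero (bdry_smul_mem (P := fun i : Idx n => i.Regular ∅ ∧ i.J ≠ ∅)
      (fun i hi => hi.2) (hwedge none)), smul_zero]
    exact zero_mem _

/-- The quotient by the Jacobian ideal vanishes in the degrees `kν` with `k ≥ n`. -/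
lemma mem_jacobianIdeal_of_le {f : MvPolynomial (Fin (n + 1)) ℂ} (hf : f.IsHomogeneous (n + 1))
    (hns : IsNonsingular f) {k : ℕ} (hk : n ≤ k) {h : MvPolynomial (Fin (n + 1)) ℂ}
    (hh : h.IsHomogeneous (k * (n + 1))) : h ∈ jacobianIdeal f := by
  have hfree := polyElt_mem (n := n) hh 0
  have hκ : contr (koszulForm₀ f) (polyElt 0 h) = 0 := by
    rw [koszulForm₀_eq, contr_sum]
    refine Finset.sum_eq_zero fun j _ => ?_
    rw [contr_smul, polyElt_eq, map_smul,
      contr_coord_monBasis_of_notMem _ (Finset.notMem_empty _), smul_zero, smul_zero]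
  obtain ⟨w, hw, e⟩ := koszul_exact hf hns (c := 0) (a := 0) (D := k * (n + 1)) (q := 0)
    (w := polyElt 0 h) (Or.inr ⟨rfl, by
      have : (n : ℤ) ≤ k := by exact_mod_cast hk
      nlinarith⟩) (by
      refine Sp_mono ?_ hfree
      rintro i ⟨h1, h2, h3, h4, h5⟩
      refine ⟨⟨h3, h4, by simp [h5, yExp], by simp [h5, dNum], ?_⟩, h1⟩
      rw [h2]
      push_cast
      ring) hκ
  have hw' : w ∈ Sp fun i : Idx n => i.Regular ∅ := Sp_mono (fun i hi => hi.2) hw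
  rw [← if_pos (c := 0 = 0) (t := h) (e := 0) rfl, ← polyPart_polyElt 0 0 h, ← e,
    koszulForm₀_eq, contr_sum, map_sum]
  refine sum_mem fun j _ => ?_
  rw [contr_smul, polyPart_ofPoly_smul _ _ (contr_coord_mem _ (fun i hi _ => hi) hw')]
  exact Ideal.mul_mem_right _ _ (Ideal.subset_span ⟨j, rfl⟩)

/-! ### The cocycles of total degree `n - 1` -/

/-- The monomials of weight zero and degree `q` whose symmetric degree satisfies `S`. -/
def Grade (S : ℤ → Prop) (q : ℤ) (i : Idx n) : Prop := i.wt = 0 ∧ i.deg = q ∧ S i.sym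

lemma dAlg_mem_Grade {f : MvPolynomial (Fin (n + 1)) ℂ} (hf : f.IsHomogeneous (n + 1))
    (S : ℤ → Prop) (σ : Finset (Fin (n + 1))) (q : ℤ) :
    ∀ w ∈ Sp (fun i => Grade S q i ∧ i.Regular σ),
      dAlg f w ∈ Sp fun i => Grade S (q + 1) i ∧ i.Regular σ := by
  intro w hw
  refine dAlg_mem hf ?_ hw
  rintro i j ⟨⟨h1, h2, h3⟩, hr⟩ g1 g2 g3 g4
  exact ⟨⟨g2.trans h1, by rw [g3, h2], by rwa [g4]⟩, fun l hl => (hr l hl).trans (g1 l)⟩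

lemma sections_eq_Grade (σ : Finset (Fin (n + 1))) (q : ℤ) :
    sections n σ q = Sp fun i => Grade (· < (n : ℤ)) q i ∧ i.Regular σ := by
  rw [sections_eq]
  refine congrArg Sp (funext fun i => propext ?_)
  simp only [Grade, and_assoc]

lemma mem_cochains {m : ℤ} {c : PreCochain n} :
    c ∈ cochains n m ↔ c ∅ = 0 ∧ c ∈ Coch (Grade (· < (n : ℤ))) m := by
  refine and_congr_right fun h0 => ⟨fun h σ => ?_, fun h σ hσ => ?_⟩
  · by_cases hσ : σ = ∅
    · rw [hσ, h0]
      exact zero_mem _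
    · have := h σ (Finset.nonempty_iff_ne_empty.2 hσ)
      rwa [sections_eq_Grade, show m - ((σ.card : ℤ) - 1) = m + 1 - σ.card by ring] at this
  · rw [sections_eq_Grade, show m - ((σ.card : ℤ) - 1) = m + 1 - σ.card by ring]
    exact h σ

/-- In weight zero the only monomials with only negative exponents of the variables are the
`y e^a / (x^0 ⋯ x^n)`. -/
lemma eq_of_forall_neg {i : Idx n} (hwt : i.wt = 0) (hneg : ∀ k, i.m k < 0) :
    i = ⟨fun _ => -1, 0, i.a, {none}⟩ := by
  have h1 : ∑ k, i.m k ≤ ∑ _k : Fin (n + 1), (-1 : ℤ) :=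
    Finset.sum_le_sum fun k _ => by have := hneg k; omega
  have h1' : ∑ _k : Fin (n + 1), (-1 : ℤ) = -(n + 1) := by
    simp
  have h2 := dNum_nonneg i.J
  have h3 := yExp_le_one i.J
  have hc0 : (0 : ℤ) ≤ i.c := Int.natCast_nonneg _
  have hn : (0 : ℤ) ≤ n := Int.natCast_nonneg n
  simp only [Idx.wt] at hwt
  have hc : (i.c : ℤ) = 0 := by nlinarith
  have hy : yExp i.J = 1 := by
    have := yExp_nonneg i.J
    by_contra hne
    have h0 : yExp i.J = 0 := by omega
    rw [h0, hc] at hwt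
    linarith
  rw [hc, hy] at hwt
  have hd : dNum i.J = 0 := by linarith
  have hm : ∀ k, i.m k = -1 := by
    have hs : ∑ k, i.m k = ∑ _k : Fin (n + 1), (-1 : ℤ) := by linarith
    intro k
    exact (Finset.sum_eq_sum_iff_of_le fun k _ => by have := hneg k; omega).1 hs k
      (Finset.mem_univ k)
  have hJ : i.J = {none} := by
    have hmem : none ∈ i.J := by
      by_contra h
      rw [yExp_of_notMem h] at hy
      exact zero_ne_one hy
    rw [dNum, Nat.cast_eq_zero, Finset.card_eq_zero] at hd
    rw [← Finset.insert_erase hmem, hd]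
    rfl
  obtain ⟨m, c, a, J⟩ := i
  simp only [Nat.cast_eq_zero] at hc
  subst hc
  subst hJ
  rw [show m = fun _ => -1 from funext hm]

lemma yExp_single_none : yExp ({none} : Finset (Option (Fin (n + 1)))) = 1 := by simp [yExp]

lemma dNum_single_none : dNum ({none} : Finset (Option (Fin (n + 1)))) = 0 := by simp [dNum]

lemma deg_of_forall_neg {i : Idx n} (hwt : i.wt = 0) (hneg : ∀ k, i.m k < 0) : i.deg = -1 := by
  rw [eq_of_forall_neg hwt hneg]
  simp [Idx.deg, yExp_single_none, dNum_single_none]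

lemma eElt_mem (k : ℕ) : eElt n k ∈ Sp fun i =>
    Grade (· = (k : ℤ)) (-1) i ∧ ∀ l, i.m l < 0 := by
  rw [eElt_eq]
  refine monBasis_mem ⟨⟨?_, ?_, ?_⟩, fun l => by simp⟩ <;>
    simp [Idx.wt, Idx.deg, Idx.sym, yExp_single_none, dNum_single_none]

lemma dE_eElt (k : ℕ) : dE (eElt n (k + 1)) = ((k : ℂ) + 1) • eElt n k := by
  rw [eElt, eElt, dE_monomial, ← Polynomial.smul_monomial]
  simp

lemma totD_map {d T : Alg n →ₗ[ℂ] Alg n} (hT : ∀ w, T (d w) = d (T w)) (c : PreCochain n)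
    (σ : Finset (Fin (n + 1))) : totD d (fun τ => T (c τ)) σ = T (totD d c σ) := by
  rw [totD_apply, totD_apply, cechDiff_map, map_add, map_smul, hT]

lemma card_univ_fin : (Finset.univ : Finset (Fin (n + 1))).card = n + 1 := by simp

/-- The element `y e^k / (x^0 ⋯ x^n)` extends to a cocycle of the total complex. The obstruction
to extending `y e^(k+1) / (x^0 ⋯ x^n)` is a closed global section `u`; the derivation `∂/∂e`
maps the extension problem for `k + 1` to the one for `k`, and `∂u/∂e` is exact. -/
lemma exists_cocycle {f : MvPolynomial (Fin (n + 1)) ℂ} (hf : f.IsHomogeneous (n + 1)) {k : ℕ}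
    (hk : k < n) : ∃ z ∈ cochains n ((n : ℤ) - 1), totalDiff f z = 0 ∧
      z Finset.univ = eElt n k := by
  have hd := dAlg_mem_Grade hf (· = ((k : ℤ) + 1))
  have hdd := dAlg_dAlg hf
  have hne : (Finset.univ : Finset (Fin (n + 1))) ≠ ∅ := Finset.univ_nonempty.ne_empty
  let c : PreCochain n := fun σ => if σ = Finset.univ then eElt n (k + 1) else 0
  have hc : c ∈ Coch (Grade (· = ((k : ℤ) + 1))) ((n : ℤ) - 1) := by
    intro σ
    simp only [c]
    split_ifs with hσ
    · subst hσ
      refine Sp_mono ?_ (eElt_mem (k + 1))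
      rintro i ⟨⟨h1, h2, h3⟩, -⟩
      refine ⟨⟨h1, ?_, by exact_mod_cast h3⟩, fun l hl => (hl (Finset.mem_univ l)).elim⟩
      rw [h2, card_univ_fin]
      push_cast
      ring
    · exact zero_mem _
  have hDc := totD_mem hd hc
  rw [sub_add_cancel] at hDc
  obtain ⟨b, hb, hb0, hbu, u, hu, he⟩ := exists_eq_totD_add_const hd hdd hDc
    (by rw [totD_empty]; simp [c, hne.symm])
    (fun σ _ => by rw [totD_totD hdd]; rfl)
    (by
      refine Sp_mono ?_ (hDc Finset.univ)
      rintro i ⟨⟨h1, h2, -⟩, -⟩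
      by_contra! hneg
      have := deg_of_forall_neg h1 hneg
      rw [card_univ_fin] at h2
      push_cast at h2
      linarith)
  have hD : totD (dAlg f) (c - b) = constCochain u := by
    rw [map_sub, he, add_sub_cancel_left]
  have hdu : dAlg f u = 0 := by
    have h := congrArg (totD (dAlg f)) hD
    rw [totD_totD hdd, totD_constCochain] at h
    refine constCochain_injective (h.symm.trans ?_)
    funext σ
    simp [constCochain]
  obtain ⟨γ, hγ, hγe⟩ := exists_bdry_smul_eq_contr (k := (k : ℤ) + 1) (q := n) (w := u)
    (by omega) hu
  rw [add_sub_cancel_right] at hγ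
  have hdγ := dAlg_of_bdry_smul_eq_contr hγe hdu
  have hn0 : (n + 1 : ℂ) ≠ 0 := by exact_mod_cast Nat.succ_ne_zero n
  have hk0 : (k + 1 : ℂ) ≠ 0 := by exact_mod_cast Nat.succ_ne_zero k
  refine ⟨(k + 1 : ℂ)⁻¹ • ((fun σ => dE ((c - b) σ)) + (n + 1 : ℂ)⁻¹ • constCochain γ),
    Submodule.smul_mem _ _ (add_mem ?_ (Submodule.smul_mem _ _ ?_)), ?_, ?_⟩
  · refine mem_cochains.2 ⟨by simp [c, hne.symm, hb0], fun σ => ?_⟩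
    refine dE_mem ?_ (sub_mem hc hb σ)
    rintro i ⟨⟨h1, h2, h3⟩, hr⟩ ha
    refine ⟨⟨h1, h2, ?_⟩, hr⟩
    simp only [Idx.sym] at h3 ⊢
    push_cast [ha]
    omega
  · refine mem_cochains.2 ⟨by simp [constCochain], constCochain_mem (Sp_mono ?_ hγ)⟩
    rintro i ⟨⟨h1, h2, h3⟩, hr⟩
    exact ⟨⟨h1, h2, by dsimp only; omega⟩, hr⟩
  · have h1 : totD (dAlg f) (fun σ => dE ((c - b) σ)) = constCochain (dE u) := by
      funext σ
      rw [totD_map (dE_dAlg f), hD, constCochain, constCochain]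
      split_ifs
      · rfl
      · exact map_zero _
    rw [totalDiff_eq, map_smul, map_add, h1, map_smul, totD_constCochain, hdγ, ← constCochain_smul,
      smul_neg, smul_smul, inv_mul_cancel₀ hn0, one_smul, ← constCochain_add, add_neg_cancel]
    funext σ
    simp [constCochain]
  · have h1 : constCochain γ Finset.univ = 0 := by
      rw [constCochain, if_neg]
      rw [card_univ_fin]
      omega
    rw [Pi.smul_apply, Pi.add_apply, Pi.smul_apply, h1, smul_zero, add_zero, Pi.sub_apply, hbu,
      sub_zero]
    simp only [c, if_true]
    rw [dE_eElt, smul_smul, inv_mul_cancel₀ hk0, one_smul]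

/-! ### Representatives of cohomology classes -/

lemma exists_sum_eElt {w : Alg n}
    (hw : w ∈ Sp fun i => (i.wt = 0 ∧ i.sym < n) ∧ ∀ l, i.m l < 0) :
    ∃ μ : Fin n → ℂ, w = ∑ k, μ k • eElt n k := by
  have : w ∈ LinearMap.range (Fintype.linearCombination ℂ fun k : Fin n => eElt n k) := by
    refine Sp_le ?_ hw
    rintro i ⟨⟨h1, h2⟩, h3⟩
    have hi := eq_of_forall_neg h1 h3
    have ha : i.a < n := by
      rw [hi] at h2
      simpa [Idx.sym, dNum_single_none] using h2
    refine ⟨Pi.single ⟨i.a, ha⟩ 1, ?_⟩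
    rw [Fintype.linearCombination_apply_single, one_smul, eElt_eq, ← hi]
  obtain ⟨μ, hμ⟩ := this
  exact ⟨μ, hμ.symm⟩

lemma sub_pr_mem (Q : Idx n → Prop) (w : Alg n) : w - pr Q w ∈ Sp fun i => ¬ Q i := by
  refine map_mem_Sp (P := fun _ => True) (LinearMap.id - pr Q) (fun i _ => ?_) (mem_Sp_true w)
  rw [LinearMap.sub_apply, pr_monBasis, LinearMap.id_apply]
  split_ifs with h
  · rw [sub_self]
    exact zero_mem _
  · rw [sub_zero]
    exact monBasis_mem h

variable {f : MvPolynomial (Fin (n + 1)) ℂ}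

lemma totalDiff_sum_smul {z : Fin n → PreCochain n} (hDz : ∀ k, totalDiff f (z k) = 0)
    (μ : Fin n → ℂ) : totalDiff f (∑ k, μ k • z k) = 0 := by
  rw [map_sum]
  exact Finset.sum_eq_zero fun k _ => by rw [map_smul, hDz, smul_zero]

/-- A cochain whose total differential lives in Čech degree `0` is, up to coboundaries and given
cocycles that extend the elements `y e^k / (x^0 ⋯ x^n)`, a constant one. -/
lemma exists_decomposition (hf : f.IsHomogeneous (n + 1)) {z : Fin n → PreCochain n}
    (hz : ∀ k, z k ∈ cochains n ((n : ℤ) - 1)) (hDz : ∀ k, totalDiff f (z k) = 0)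
    (hzu : ∀ k, z k Finset.univ = eElt n k) {m : ℤ} {c : PreCochain n} (hc : c ∈ cochains n m)
    (hDc : ∀ σ, 2 ≤ σ.card → totalDiff f c σ = 0) :
    ∃ μ : Fin n → ℂ, (m ≠ (n : ℤ) - 1 → μ = 0) ∧ ∃ b ∈ cochains n (m - 1),
      ∃ u ∈ Sp (fun i => Grade (· < (n : ℤ)) m i ∧ i.Regular ∅),
        c = totalDiff f b + ∑ k, μ k • z k + constCochain u := by
  obtain ⟨hc0, hcC⟩ := mem_cochains.1 hc
  have hpr : pr (fun i => ∀ l, i.m l < 0) (c Finset.univ) ∈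
      Sp fun i => (Grade (· < (n : ℤ)) (m - n) i ∧ i.Regular Finset.univ) ∧ ∀ l, i.m l < 0 := by
    have := hcC Finset.univ
    rw [card_univ_fin, show m + 1 - ((n + 1 : ℕ) : ℤ) = m - n by push_cast; ring] at this
    exact pr_mem this
  obtain ⟨μ, hμ0, hμ⟩ : ∃ μ : Fin n → ℂ, (m ≠ (n : ℤ) - 1 → μ = 0) ∧
      pr (fun i => ∀ l, i.m l < 0) (c Finset.univ) = ∑ k, μ k • eElt n k := by
    by_cases hm : m = (n : ℤ) - 1
    · obtain ⟨μ, hμ⟩ := exists_sum_eElt (Sp_mono (fun i hi => ⟨⟨hi.1.1.1, hi.1.1.2.2⟩, hi.2⟩) hpr)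
      exact ⟨μ, fun h => (h hm).elim, hμ⟩
    · refine ⟨0, fun _ => rfl, ?_⟩
      simp only [Pi.zero_apply, zero_smul, Finset.sum_const_zero]
      refine eq_zero_of_mem_Sp ?_ hpr
      rintro i ⟨⟨⟨h1, h2, -⟩, -⟩, h3⟩
      have := deg_of_forall_neg h1 h3
      omega
  have hzm : ∑ k, μ k • z k ∈ cochains n m := by
    by_cases hm : m = (n : ℤ) - 1
    · rw [hm]
      exact Submodule.sum_mem _ fun k _ => Submodule.smul_mem _ _ (hz k)
    · rw [hμ0 hm]
      simp
  obtain ⟨h0, hC⟩ := mem_cochains.1 (sub_mem hc hzm)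
  have hDz' := totalDiff_sum_smul hDz μ
  obtain ⟨b, hb, hb0, -, u, hu, e⟩ := exists_eq_totD_add_const (dAlg_mem_Grade hf _)
    (dAlg_dAlg hf) hC h0
    (fun σ hσ => by rw [← totalDiff_eq, map_sub, hDz', sub_zero]; exact hDc σ hσ)
    (by
      have : (c - ∑ k, μ k • z k) Finset.univ =
          c Finset.univ - pr (fun i => ∀ l, i.m l < 0) (c Finset.univ) := by
        rw [hμ, Pi.sub_apply, Finset.sum_apply]
        simp only [Pi.smul_apply, hzu]
      rw [this]
      refine Sp_mono ?_ (sub_pr_mem _ _)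
      intro i hi
      push Not at hi
      exact hi)
  refine ⟨μ, hμ0, b, mem_cochains.2 ⟨hb0, hb⟩, u, hu, ?_⟩
  rw [totalDiff_eq, add_right_comm, ← e, sub_add_cancel]

/-- A closed global section is the sum of closed ones in the single symmetric powers, because the
differential preserves these. -/
lemma exists_sum_Row_eq (hf : f.IsHomogeneous (n + 1)) {m : ℤ} {u : Alg n}
    (hu : u ∈ Sp (fun i => Grade (· < (n : ℤ)) m i ∧ i.Regular ∅)) (hdu : dAlg f u = 0) :
    ∃ v : Fin n → Alg n, (∀ k : Fin n, v k ∈ Sp (Row ((k : ℕ) : ℤ) m)) ∧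
      (∀ k, dAlg f (v k) = 0) ∧ ∑ k, v k = u := by
  let v : Fin n → Alg n := fun k => pr (fun i => i.sym = ((k : ℕ) : ℤ)) u
  have hv : ∀ k : Fin n, v k ∈ Sp (Row ((k : ℕ) : ℤ) m) := fun k =>
    Sp_mono (fun i hi => ⟨⟨hi.1.1.1, hi.1.1.2.1, hi.2⟩, hi.1.2⟩) (pr_mem hu)
  have hsum : ∑ k, v k = u := by
    have h1 := sum_pr_eq ((Finset.univ : Finset (Fin n)).image fun k : Fin n => ((k : ℕ) : ℤ))
      Idx.sym
      (fun i hi => by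
        have h2 : 0 ≤ i.sym := by
          have := dNum_nonneg i.J
          simp only [Idx.sym]
          omega
        have h3 : i.sym < n := hi.1.2.2
        exact Finset.mem_image.2 ⟨⟨i.sym.toNat, by omega⟩, Finset.mem_univ _,
          Int.toNat_of_nonneg h2⟩) hu
    rwa [Finset.sum_image (fun a _ b _ hab => Fin.ext (by exact_mod_cast hab))] at h1
  refine ⟨v, hv, fun k => ?_, hsum⟩
  have h1 := congrArg (pr (fun i => i.sym = ((k : ℕ) : ℤ))) hdu
  rw [← hsum, map_sum, map_sum, Finset.sum_eq_single k, map_zero] at h1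
  · rwa [pr_eq_self (fun i hi => hi.1.2.2) (dAlg_mem_Row hf (hv k))] at h1
  · intro j _ hj
    refine pr_eq_zero (fun i hi h => ?_) (dAlg_mem_Row hf (hv j))
    have h2 : i.sym = (j : ℕ) := hi.1.2.2
    exact hj (Fin.ext (by omega))
  · simp

/-- Every cocycle is cohomologous to a combination of the distinguished ones. -/
lemma exists_representative (hf : f.IsHomogeneous (n + 1)) (hns : IsNonsingular f)
    {z : Fin n → PreCochain n}
    (hz : ∀ k, z k ∈ cochains n ((n : ℤ) - 1)) (hDz : ∀ k, totalDiff f (z k) = 0)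
    (hzu : ∀ k, z k Finset.univ = eElt n k) {m : ℤ} {c : PreCochain n} (hc : c ∈ cochains n m)
    (hDc : totalDiff f c = 0) :
    ∃ μ : Fin n → ℂ, (m ≠ (n : ℤ) - 1 → μ = 0) ∧
      ∃ h : Fin n → MvPolynomial (Fin (n + 1)) ℂ,
        (∀ k : Fin n, (h k).IsHomogeneous (k * (n + 1))) ∧
        (∀ k : Fin n, m ≠ 2 * (k : ℤ) → h k = 0) ∧ ∃ b ∈ cochains n (m - 1),
          c = totalDiff f b + ∑ k, μ k • z k + ∑ k, primitiveCochain (h k) k := by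
  obtain ⟨μ, hμ, b, hb, u, hu, e⟩ := exists_decomposition hf hz hDz hzu hc
    (fun σ _ => by rw [hDc]; rfl)
  have hdu : dAlg f u = 0 := by
    have h := congrArg (totalDiff f) e
    rw [hDc, map_add, map_add, totalDiff_sum_smul hDz, totalDiff_eq, totD_totD (dAlg_dAlg hf),
      totD_constCochain, zero_add, zero_add] at h
    simpa [constCochain] using (congrFun h {0}).symm
  obtain ⟨v, hv, hdv, hsum⟩ := exists_sum_Row_eq hf hu hdu
  choose h hh hh0 w hw hwe using fun k : Fin n => row_cohomology hf hns k.2 (hv k) (hdv k)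
  refine ⟨μ, hμ, h, hh, hh0, b + constCochain (∑ k, w k), add_mem hb ?_, ?_⟩
  · refine mem_cochains.2 ⟨by simp [constCochain], constCochain_mem
      (Submodule.sum_mem _ fun k _ => Sp_mono ?_ (hw k))⟩
    rintro i ⟨⟨h1, h2, h3⟩, hr⟩
    refine ⟨⟨h1, h2, ?_⟩, hr⟩
    rw [h3]
    show ((k : ℕ) : ℤ) < n
    exact_mod_cast k.2
  · have h1 : constCochain u = totalDiff f (constCochain (∑ k, w k)) +
        ∑ k, primitiveCochain (h k) k := by
      rw [totalDiff_eq, totD_constCochain, map_sum]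
      funext σ
      simp only [Pi.add_apply, Finset.sum_apply, primitiveCochain_apply, constCochain]
      split_ifs
      · rw [← Finset.sum_add_distrib, ← hsum]
        exact Finset.sum_congr rfl fun k _ => by rw [hwe k, add_comm]
      · simp
    rw [e, h1, map_add]
    abel

/-- A combination of the distinguished cocycles is a coboundary only if it vanishes in the Jacobian
ring. -/
lemma eq_zero_of_eq_totalDiff (hf : f.IsHomogeneous (n + 1)) {z : Fin n → PreCochain n}
    (hz : ∀ k, z k ∈ cochains n ((n : ℤ) - 1)) (hDz : ∀ k, totalDiff f (z k) = 0)
    (hzu : ∀ k, z k Finset.univ = eElt n k) {m : ℤ} {μ : Fin n → ℂ}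
    (hμ : m ≠ (n : ℤ) - 1 → μ = 0) (h : Fin n → MvPolynomial (Fin (n + 1)) ℂ) {b : PreCochain n}
    (hb : b ∈ cochains n (m - 1))
    (e : ∑ k, μ k • z k + ∑ k, primitiveCochain (h k) k = totalDiff f b) :
    μ = 0 ∧ ∀ k, h k ∈ jacobianIdeal f := by
  obtain ⟨hb0, hbC⟩ := mem_cochains.1 hb
  have hμ0 : μ = 0 := by
    by_cases hm : m = (n : ℤ) - 1
    swap
    · exact hμ hm
    funext k₀
    have hn : 0 < n := k₀.pos
    have h1 := congrFun e Finset.univ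
    have h2 : ∀ k : Fin n, primitiveCochain (h k) k Finset.univ = 0 := fun k => by
      rw [primitiveCochain_apply, if_neg]
      rw [card_univ_fin]
      omega
    simp only [Pi.add_apply, Finset.sum_apply, Pi.smul_apply, hzu, h2, Finset.sum_const_zero,
      add_zero] at h1
    have h3 : pr (fun i => ∀ l, i.m l < 0) (totalDiff f b Finset.univ) = 0 := by
      rw [totalDiff_eq, totD_apply, map_add, map_smul, cechDiff_apply, map_sum,
        Finset.sum_eq_zero fun l _ => ?_, zero_add]
      · rw [pr_eq_zero (P := fun j => ∃ i : Idx n, (i.wt = 0 ∧ i.deg = -2) ∧ ∀ l, i.m l ≤ j.m l) ?_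
          (dAlg_mem hf (fun i j hi g1 _ _ _ => ⟨i, ⟨hi.1.1, ?_⟩, g1⟩) (hbC Finset.univ)), smul_zero]
        · rintro j ⟨i, ⟨hi1, hi2⟩, hi3⟩ hneg
          have := deg_of_forall_neg hi1 fun l => (hi3 l).trans_lt (hneg l)
          omega
        · have := hi.1.2.1
          rw [card_univ_fin, hm] at this
          rw [this]
          push_cast
          ring
      · rw [map_smul, pr_eq_zero (fun i hi hneg => ?_) (hbC (Finset.univ.erase l)), smul_zero]
        exact absurd (hi.2 l (Finset.notMem_erase _ _)) (not_le.2 (hneg l))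
    have hself := pr_eq_self (P := fun i : Idx n => ∀ l, i.m l < 0)
      (Q := fun i : Idx n => ∀ l, i.m l < 0) (fun i hi => hi)
      (w := ∑ k : Fin n, μ k • eElt n k) (Submodule.sum_mem _ fun k _ => Submodule.smul_mem _ _
        (Sp_mono (fun i hi => hi.2) (eElt_mem (k : ℕ))))
    rw [← h1, hself] at h3
    simp only [eElt_eq] at h3
    have hli : LinearIndependent ℂ
        fun k : Fin n => monBasis n ⟨fun _ => -1, 0, (k : ℕ), {none}⟩ :=
      (monBasis n).linearIndependent.comp _ fun a b hab => Fin.ext (congrArg Idx.a hab)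
    exact Fintype.linearIndependent_iff.1 hli μ h3 k₀
  refine ⟨hμ0, fun k => ?_⟩
  simp only [hμ0, Pi.zero_apply, zero_smul, Finset.sum_const_zero, zero_add] at e
  have e' : totalDiff f b = constCochain (∑ k : Fin n, polyElt k (h k)) := by
    rw [← e]
    funext σ
    simp only [Finset.sum_apply, primitiveCochain_apply, constCochain]
    split_ifs
    · rfl
    · simp
  obtain ⟨ν, -, b', -, v, hv, hbe⟩ := exists_decomposition hf hz hDz hzu hb
    (fun σ hσ => by rw [e', constCochain, if_neg]; omega)
  have h4 := congrArg (totalDiff f) hbe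
  rw [e', map_add, map_add, totalDiff_sum_smul hDz, totalDiff_eq, totD_totD (dAlg_dAlg hf),
    totD_constCochain, zero_add, zero_add] at h4
  have h5 := polyPart_dAlg_mem hf k (Sp_mono (fun i hi => hi.2) hv)
  rw [← constCochain_injective h4, map_sum] at h5
  simp only [polyPart_polyElt] at h5
  rwa [Finset.sum_eq_single k (fun j _ hj => if_neg fun h => hj (Fin.ext h))
    (fun h => (h (Finset.mem_univ k)).elim), if_pos rfl] at h5

/-! ### The isomorphism -/

lemma eq_of_map_sub_eq_zero {V W : Type*} [AddCommGroup V] [AddCommMonoid W] [Module ℂ V]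
    [Module ℂ W] {φ : V →ₗ[ℂ] W} {a b : V} (h : φ (a - b) = 0) : φ a = φ b := by
  rw [← sub_add_cancel a b, map_add, h, zero_add]

/-- The class of a cocycle, as a linear map. -/
def classMap (f : MvPolynomial (Fin (n + 1)) ℂ) (m : ℤ) :
    cocycles f m →ₗ[ℂ] TotalCohomology f :=
  DirectSum.lof ℂ ℤ (fun m => Cohomology f m) m ∘ₗ Submodule.mkQ _

lemma classMap_apply {m : ℤ} (w : cocycles f m) : classMap f m w = cocycleClass w := rfl

lemma mkQ_eq_zero {m : ℤ} {w : cocycles f m} :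
    Submodule.mkQ ((coboundaries f m).submoduleOf (cocycles f m)) w = 0 ↔
      (w : PreCochain n) ∈ coboundaries f m :=
  Submodule.Quotient.mk_eq_zero _

lemma classMap_eq_zero {m : ℤ} {w : cocycles f m} (hw : (w : PreCochain n) ∈ coboundaries f m) :
    classMap f m w = 0 := by
  rw [classMap, LinearMap.comp_apply, mkQ_eq_zero.2 hw, map_zero]

/-- A cocycle that vanishes unless `m = m'` may be regarded as one of degree `m`. -/
lemma exists_classMap_eq {m m' : ℤ} (w : cocycles f m')
    (h : m ≠ m' → (w : PreCochain n) = 0) :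
    ∃ w' : cocycles f m, (w' : PreCochain n) = w ∧ classMap f m w' = classMap f m' w := by
  by_cases hm : m = m'
  · subst hm
    exact ⟨w, rfl, rfl⟩
  · have hw : w = 0 := Subtype.ext (h hm)
    exact ⟨0, (h hm).symm, by rw [hw, map_zero, map_zero]⟩

/-- The component of degree `m` of the class of a cocycle of degree `m'` is represented by the
cocycle or by zero. -/
lemma exists_component_classMap {m m' : ℤ} (w : cocycles f m') :
    ∃ w' : cocycles f m, (w' : PreCochain n) = (if m' = m then (w : PreCochain n) else 0) ∧
      DirectSum.component ℂ ℤ (fun m => Cohomology f m) m (classMap f m' w) =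
        Submodule.mkQ _ w' := by
  by_cases h : m' = m
  · subst h
    exact ⟨w, by simp, DirectSum.component.lof_self ℂ m' _⟩
  · refine ⟨0, by simp [h], ?_⟩
    rw [map_zero]
    exact (DirectSum.component.of ℂ m m' _).trans (dif_neg h)

lemma primitiveCochain_eq_constCochain (h : MvPolynomial (Fin (n + 1)) ℂ) (p : ℕ) :
    primitiveCochain h p = constCochain (polyElt p h) := by
  funext σ
  rw [primitiveCochain_apply, constCochain]

lemma primitiveCochain_zero (p : ℕ) :
    primitiveCochain (0 : MvPolynomial (Fin (n + 1)) ℂ) p = 0 := by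
  rw [primitiveCochain_eq_constCochain, map_zero]
  funext σ
  simp [constCochain]

lemma constCochain_mem_cochains {k : ℕ} (hk : k < n) {q : ℤ} {u : Alg n}
    (hu : u ∈ Sp (Row k q)) : constCochain u ∈ cochains n q := by
  refine mem_cochains.2 ⟨by simp [constCochain], constCochain_mem (Sp_mono ?_ hu)⟩
  rintro i ⟨⟨h1, h2, h3⟩, hr⟩
  refine ⟨⟨h1, h2, ?_⟩, hr⟩
  rw [h3]
  show (k : ℤ) < n
  exact_mod_cast hk

lemma primitiveCochain_mem_cocycles (f : MvPolynomial (Fin (n + 1)) ℂ) {p : ℕ} (hp : p < n)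
    {h : MvPolynomial (Fin (n + 1)) ℂ} (hh : h.IsHomogeneous (p * (n + 1))) :
    primitiveCochain h p ∈ cocycles f (2 * (p : ℤ)) := by
  rw [primitiveCochain_eq_constCochain]
  refine ⟨constCochain_mem_cochains hp (polyElt_mem_Row hh), ?_⟩
  show totD (dAlg f) _ = 0
  rw [totD_constCochain, dAlg_polyElt]
  funext σ
  simp [constCochain]

/-- The cocycle with components `h ∂^p`, where `h` has degree `p (n + 1)`. -/
def primitiveCocycle (f : MvPolynomial (Fin (n + 1)) ℂ) (p : Fin n) :
    homogeneousSubmodule (Fin (n + 1)) ℂ (p * (n + 1)) →ₗ[ℂ] cocycles f (2 * ((p : ℕ) : ℤ)) where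
  toFun h := ⟨primitiveCochain h p, primitiveCochain_mem_cocycles f p.2 h.2⟩
  map_add' a b := Subtype.ext <| by
    simp [primitiveCochain_eq_constCochain, constCochain_add]
  map_smul' r a := Subtype.ext <| by
    simp [primitiveCochain_eq_constCochain, constCochain_smul]

lemma coe_primitiveCocycle (p : Fin n)
    (h : homogeneousSubmodule (Fin (n + 1)) ℂ (p * (n + 1))) :
    (primitiveCocycle f p h : PreCochain n) = primitiveCochain h p := rfl

/-- The homogeneous component, as an element of the space of homogeneous polynomials. -/
def homogeneousPart (n D : ℕ) :
    MvPolynomial (Fin (n + 1)) ℂ →ₗ[ℂ] homogeneousSubmodule (Fin (n + 1)) ℂ D :=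
  (homogeneousComponent D).codRestrict _ fun h => homogeneousComponent_mem D h

lemma coe_homogeneousPart (D : ℕ) (h : MvPolynomial (Fin (n + 1)) ℂ) :
    (homogeneousPart n D h : MvPolynomial (Fin (n + 1)) ℂ) = homogeneousComponent D h := rfl

/-- The sum over `p < n` of the classes of the cocycles with components `h_p ∂^p`, where `h_p` is
the homogeneous component of degree `p (n + 1)` of `h`. -/
def polyClass (f : MvPolynomial (Fin (n + 1)) ℂ) :
    MvPolynomial (Fin (n + 1)) ℂ →ₗ[ℂ] TotalCohomology f :=
  ∑ p : Fin n, classMap f (2 * ((p : ℕ) : ℤ)) ∘ₗ primitiveCocycle f p ∘ₗ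
    homogeneousPart n (p * (n + 1))

lemma polyClass_apply (h : MvPolynomial (Fin (n + 1)) ℂ) :
    polyClass f h = ∑ p : Fin n, classMap f (2 * ((p : ℕ) : ℤ))
      (primitiveCocycle f p (homogeneousPart n (p * (n + 1)) h)) := by
  simp [polyClass, LinearMap.sum_apply]

lemma polyClass_of_isHomogeneous {p : ℕ} (hp : p < n) {h : MvPolynomial (Fin (n + 1)) ℂ}
    (hh : h.IsHomogeneous (p * (n + 1))) : polyClass f h =
      cocycleClass (⟨primitiveCochain h p, primitiveCochain_mem_cocycles f hp hh⟩ :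
        cocycles f (2 * (p : ℤ))) := by
  rw [polyClass_apply, Finset.sum_eq_single (⟨p, hp⟩ : Fin n)]
  · rw [classMap_apply]
    refine congrArg cocycleClass (Subtype.ext ?_)
    rw [coe_primitiveCocycle, coe_homogeneousPart, homogeneousComponent_eq_self hh]
  · intro j _ hj
    have : homogeneousPart n (j * (n + 1)) h = 0 := by
      refine Subtype.ext ?_
      rw [coe_homogeneousPart, homogeneousComponent_of_mem hh, if_neg, ZeroMemClass.coe_zero]
      intro h'
      exact hj (Fin.ext (Nat.eq_of_mul_eq_mul_right n.succ_pos h'))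
    rw [this, map_zero, map_zero]
  · simp

lemma polyClass_eq_zero (hf : f.IsHomogeneous (n + 1)) {h : MvPolynomial (Fin (n + 1)) ℂ}
    (hJ : h ∈ jacobianIdeal f) : polyClass f h = 0 := by
  rw [polyClass_apply]
  refine Finset.sum_eq_zero fun p _ => classMap_eq_zero ?_
  have hh := homogeneousComponent_isHomogeneous (p * (n + 1)) h
  obtain ⟨u, hu, e⟩ := exists_dAlg_eq_polyElt hf p.2 hh
    (homogeneousComponent_mem_jacobianIdeal hf hJ _)
  refine ⟨constCochain u, constCochain_mem_cochains p.2 hu, ?_⟩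
  rw [totalDiff_eq, totD_constCochain, e, coe_primitiveCocycle, coe_homogeneousPart,
    primitiveCochain_eq_constCochain]

/-- The map `S / J_f → H(𝒞, D)` induced by `polyClass`. It is defined by means of a linear section
of the quotient map. -/
def jacobianClass (f : MvPolynomial (Fin (n + 1)) ℂ) :
    MvPolynomial (Fin (n + 1)) ℂ ⧸ jacobianIdeal f →ₗ[ℂ] TotalCohomology f :=
  polyClass f ∘ₗ (LinearMap.exists_rightInverse_of_surjective (toJacobian f)
    (LinearMap.range_eq_top.2 Ideal.Quotient.mk_surjective)).choose

lemma toJacobian_eq_zero {h : MvPolynomial (Fin (n + 1)) ℂ} :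
    toJacobian f h = 0 ↔ h ∈ jacobianIdeal f := Ideal.Quotient.eq_zero_iff_mem

lemma jacobianClass_toJacobian (hf : f.IsHomogeneous (n + 1))
    (h : MvPolynomial (Fin (n + 1)) ℂ) : jacobianClass f (toJacobian f h) = polyClass f h := by
  have hs := (LinearMap.exists_rightInverse_of_surjective (toJacobian f)
    (LinearMap.range_eq_top.2 Ideal.Quotient.mk_surjective)).choose_spec
  rw [jacobianClass, LinearMap.comp_apply]
  refine eq_of_map_sub_eq_zero (polyClass_eq_zero hf (toJacobian_eq_zero.1 ?_))
  rw [map_sub, ← LinearMap.comp_apply, hs, LinearMap.id_apply, sub_self]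

/-- The map `R̃ → H(𝒞, D)` that sends `e_k` to the class of `z k`. -/
def comparison (f : MvPolynomial (Fin (n + 1)) ℂ) (z : Fin n → cocycles f ((n : ℤ) - 1)) :
    RTilde f →ₗ[ℂ] TotalCohomology f :=
  LinearMap.coprod (jacobianClass f ∘ₗ (R f).subtype)
    (classMap f ((n : ℤ) - 1) ∘ₗ Fintype.linearCombination ℂ z)

variable {z : Fin n → cocycles f ((n : ℤ) - 1)}

lemma comparison_mk (hf : f.IsHomogeneous (n + 1)) {h : MvPolynomial (Fin (n + 1)) ℂ} {r : R f}
    (hr : toJacobian f h = r) (μ : Fin n → ℂ) :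
    comparison f z (r, μ) = polyClass f h + classMap f ((n : ℤ) - 1) (∑ k, μ k • z k) := by
  rw [comparison, LinearMap.coprod_apply, LinearMap.comp_apply, Submodule.subtype_apply, ← hr,
    jacobianClass_toJacobian hf, LinearMap.comp_apply, Fintype.linearCombination_apply]

lemma comparison_ofPoly (hf : f.IsHomogeneous (n + 1)) {k : ℕ}
    {h : MvPolynomial (Fin (n + 1)) ℂ} (hh : h.IsHomogeneous (k * (n + 1))) :
    comparison f z (RTilde.ofPoly f hh) = polyClass f h := by
  rw [RTilde.ofPoly, comparison_mk hf rfl, Finset.sum_eq_zero, map_zero, add_zero]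
  exact fun k _ => zero_smul ℂ _

lemma comparison_e (hf : f.IsHomogeneous (n + 1)) (k : Fin n) :
    comparison f z (RTilde.e f k) = cocycleClass (z k) := by
  rw [RTilde.e, comparison_mk hf (map_zero _), map_zero, zero_add,
    Finset.sum_eq_single k, Pi.single_eq_same, one_smul, classMap_apply]
  · intro j _ hj
    rw [Pi.single_eq_of_ne hj]
    exact zero_smul ℂ _
  · simp

lemma homogeneousComponent_eq_zero_of_not_dvd {h : MvPolynomial (Fin (n + 1)) ℂ}
    (hh : h ∈ ⨆ k : ℕ, homogeneousSubmodule (Fin (n + 1)) ℂ (k * (n + 1))) {D : ℕ}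
    (hD : ¬ n + 1 ∣ D) : homogeneousComponent D h = 0 := by
  have : (⨆ k : ℕ, homogeneousSubmodule (Fin (n + 1)) ℂ (k * (n + 1))) ≤
      LinearMap.ker (homogeneousComponent D) := by
    refine iSup_le fun k g hg => ?_
    rw [LinearMap.mem_ker, homogeneousComponent_of_mem hg, if_neg]
    rintro rfl
    exact hD (Dvd.intro_left k rfl)
  exact this hh

/-- In each degree a vanishing class is a coboundary, so that the coefficients of the `e_k` and the
classes in `S / J_f` of all homogeneous components vanish. -/
lemma comparison_injective (hf : f.IsHomogeneous (n + 1)) (hns : IsNonsingular f)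
    (hzu : ∀ k, (z k : PreCochain n) Finset.univ = eElt n k) :
    Function.Injective (comparison f z) := by
  rw [injective_iff_map_eq_zero]
  rintro ⟨⟨r, hr⟩, μ⟩ h0
  obtain ⟨h, hh, rfl⟩ := hr
  rw [comparison_mk hf rfl, polyClass_apply] at h0
  -- Every component of the class gives a coboundary.
  have key : ∀ m : ℤ, (m = (n : ℤ) - 1 → μ = 0) ∧
      ∀ k : Fin n, m = 2 * ((k : ℕ) : ℤ) → homogeneousComponent (k * (n + 1)) h ∈
        jacobianIdeal f := by
    intro m
    choose w hw hwe using fun p : Fin n => exists_component_classMap (m := m)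
      (primitiveCocycle f p (homogeneousPart n (p * (n + 1)) h))
    obtain ⟨v, hv, hve⟩ := exists_component_classMap (m := m) (∑ k, μ k • z k)
    have h1 := congrArg (DirectSum.component ℂ ℤ (fun m => Cohomology f m) m) h0
    rw [map_add, map_sum, hve, Finset.sum_congr rfl fun p _ => hwe p, map_zero,
      ← map_sum (Submodule.mkQ ((coboundaries f m).submoduleOf (cocycles f m))) w,
      ← map_add (Submodule.mkQ ((coboundaries f m).submoduleOf (cocycles f m))) _ v] at h1
    obtain ⟨b, hb, e⟩ := mkQ_eq_zero.1 h1
    have h2 := eq_zero_of_eq_totalDiff hf (fun k => (z k).2.1) (fun k => (z k).2.2) hzu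
      (μ := if m = (n : ℤ) - 1 then μ else 0) (fun hm => if_neg hm)
      (fun k => if m = 2 * ((k : ℕ) : ℤ) then homogeneousComponent (k * (n + 1)) h else 0) hb ?_
    · refine ⟨fun hm => by simpa [hm] using h2.1, fun k hk => by simpa [hk] using h2.2 k⟩
    · rw [e, add_comm, Submodule.coe_add, Submodule.coe_sum, hv]
      congr 1
      · refine Finset.sum_congr rfl fun p _ => ?_
        rw [hw, coe_primitiveCocycle, coe_homogeneousPart]
        by_cases hp : m = 2 * ((p : ℕ) : ℤ)
        · rw [if_pos hp, if_pos hp.symm]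
        · rw [if_neg hp, if_neg (Ne.symm hp), primitiveCochain_zero]
      · by_cases hm : m = (n : ℤ) - 1
        · rw [if_pos hm, if_pos hm.symm, Submodule.coe_sum]
          rfl
        · rw [if_neg hm, if_neg (Ne.symm hm)]
          simp
  have hJ : h ∈ jacobianIdeal f := by
    rw [← sum_homogeneousComponent h]
    refine sum_mem fun D _ => ?_
    by_cases hD : n + 1 ∣ D
    · obtain ⟨k, rfl⟩ := hD
      rw [mul_comm]
      by_cases hk : k < n
      · exact (key _).2 ⟨k, hk⟩ rfl
      · exact mem_jacobianIdeal_of_le hf hns (not_lt.1 hk)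
          (homogeneousComponent_isHomogeneous _ _)
    · rw [homogeneousComponent_eq_zero_of_not_dvd hh hD]
      exact zero_mem _
  exact Prod.ext (Subtype.ext (toJacobian_eq_zero.2 hJ)) ((key _).1 rfl)

lemma sum_smul_e (μ : Fin n → ℂ) : ∑ k, μ k • RTilde.e f k = (0, μ) := by
  refine Prod.ext ?_ ?_
  · rw [Prod.fst_sum]
    exact Finset.sum_eq_zero fun k _ => smul_zero _
  · rw [Prod.snd_sum]
    funext j
    simp [RTilde.e, Finset.sum_apply, Pi.single_apply]

set_option maxHeartbeats 1000000 in
lemma exists_comparison_eq (hf : f.IsHomogeneous (n + 1)) (hns : IsNonsingular f)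
    (hzu : ∀ k, (z k : PreCochain n) Finset.univ = eElt n k) (m : ℤ) (x : Cohomology f m) :
    ∃ v ∈ RTilde.degreePart f m, comparison f z v =
      DirectSum.lof ℂ ℤ (fun m => Cohomology f m) m x := by
  obtain ⟨c, rfl⟩ := Submodule.Quotient.mk_surjective _ x
  obtain ⟨μ, hμ, h, hh, hh0, b, hb, e⟩ := exists_representative hf hns
    (fun k => (z k).2.1) (fun k => (z k).2.2) hzu c.2.1 c.2.2
  refine ⟨∑ k, RTilde.ofPoly f (hh k) + ∑ k, μ k • RTilde.e f k, add_mem ?_ ?_, ?_⟩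
  · refine Submodule.sum_mem _ fun k _ => ?_
    by_cases hk : m = 2 * ((k : ℕ) : ℤ)
    · exact Submodule.subset_span (Or.inl ⟨k, h k, hh k, hk, rfl⟩)
    · have : RTilde.ofPoly f (hh k) = 0 := by
        refine Prod.ext (Subtype.ext ?_) rfl
        show toJacobian f (h k) = 0
        rw [hh0 k hk, map_zero]
      rw [this]
      exact zero_mem _
  · by_cases hm : m = (n : ℤ) - 1
    · exact Submodule.sum_mem _ fun k _ => Submodule.smul_mem _ _
        (Submodule.subset_span (Or.inr ⟨k, hm, rfl⟩))
    · rw [hμ hm]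
      simp
  · -- In each sum only the terms of degree `m` are different from zero.
    choose w hw hwe using fun k : Fin n => exists_classMap_eq (m := m)
      (⟨primitiveCochain (h k) k, primitiveCochain_mem_cocycles f k.2 (hh k)⟩ :
        cocycles f (2 * ((k : ℕ) : ℤ)))
      (fun hm => by simp only [hh0 k hm, primitiveCochain_zero])
    obtain ⟨v, hv, hve⟩ := exists_classMap_eq (m := m) (∑ k, μ k • z k)
      (fun hm => by simp [hμ hm])
    have h1 : ∀ k, comparison f z (RTilde.ofPoly f (hh k)) = classMap f m (w k) := fun k => by
      rw [comparison_ofPoly hf, polyClass_of_isHomogeneous k.2 (hh k), hwe, classMap_apply]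
    have h2 : comparison f z (∑ k, μ k • RTilde.e f k) = classMap f m v := by
      rw [sum_smul_e, comparison_mk hf (map_zero _), map_zero, zero_add, hve]
    have h3 : comparison f z (∑ k, RTilde.ofPoly f (hh k) + ∑ k, μ k • RTilde.e f k) =
        classMap f m (∑ k, w k + v) := by
      rw [LinearMap.map_add, LinearMap.map_add, h2, map_sum, map_sum,
        Finset.sum_congr rfl fun k _ => h1 k]
    rw [h3]
    refine (eq_of_map_sub_eq_zero (φ := classMap f m) (classMap_eq_zero ⟨b, hb, ?_⟩)).symm
    rw [Submodule.coe_sub, Submodule.coe_add, Submodule.coe_sum, hv, e,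
      Finset.sum_congr rfl fun k _ => hw k, Submodule.coe_sum]
    simp only [Submodule.coe_smul]
    abel

lemma comparison_mem_range (hf : f.IsHomogeneous (n + 1)) (hns : IsNonsingular f) (m : ℤ) :
    (RTilde.degreePart f m).map (comparison f z) ≤
      LinearMap.range (DirectSum.lof ℂ ℤ (fun m => Cohomology f m) m) := by
  rw [RTilde.degreePart, Submodule.map_span_le]
  rintro v (⟨k, h, hh, rfl, rfl⟩ | ⟨k, rfl, rfl⟩)
  · rw [comparison_ofPoly hf]
    by_cases hk : k < n
    · rw [polyClass_of_isHomogeneous hk hh]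
      exact ⟨_, rfl⟩
    · rw [polyClass_eq_zero hf (mem_jacobianIdeal_of_le hf hns (not_lt.1 hk) hh)]
      exact zero_mem _
  · rw [comparison_e hf]
    exact ⟨_, rfl⟩

lemma comparison_surjective (hf : f.IsHomogeneous (n + 1)) (hns : IsNonsingular f)
    (hzu : ∀ k, (z k : PreCochain n) Finset.univ = eElt n k) :
    Function.Surjective (comparison f z) := by
  rw [← LinearMap.range_eq_top, eq_top_iff]
  rintro x -
  induction x using DirectSum.induction_on with
  | zero => exact zero_mem _
  | of m x =>
    obtain ⟨v, -, hv⟩ := exists_comparison_eq hf hns hzu m x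
    exact ⟨v, hv⟩
  | add x y hx hy => exact add_mem hx hy

end CYCech

end

open CYCech in
theorem theorem6p2 (n : ℕ) (f : MvPolynomial (Fin (n + 1)) ℂ)
    (hf : f.IsHomogeneous (n + 1)) (hns : IsNonsingular f) :
    ∃ Φ : RTilde f ≃ₗ[ℂ] TotalCohomology f,
      (∀ m : ℤ, (RTilde.degreePart f m).map (Φ : RTilde f →ₗ[ℂ] TotalCohomology f) =
        LinearMap.range (DirectSum.lof ℂ ℤ (fun m => Cohomology f m) m)) ∧
      (∀ p : ℕ, p < n → ∀ (h : MvPolynomial (Fin (n + 1)) ℂ)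
        (hh : h.IsHomogeneous (p * (n + 1))),
        ∃ z : cocycles f (2 * (p : ℤ)), (z : PreCochain n) = primitiveCochain h p ∧
          Φ (RTilde.ofPoly f hh) = cocycleClass z) ∧
      (∀ k : Fin n,
        ∃ z : cocycles f ((n : ℤ) - 1), (z : PreCochain n) Finset.univ = eElt n k ∧
          Φ (RTilde.e f k) = cocycleClass z) := by
  choose z hz hDz hzu using fun k : Fin n => exists_cocycle hf k.2
  let z' : Fin n → cocycles f ((n : ℤ) - 1) := fun k => ⟨z k, hz k, hDz k⟩
  let Φ := LinearEquiv.ofBijective (comparison f z')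
    ⟨comparison_injective hf hns hzu, comparison_surjective hf hns hzu⟩
  have hΦ : (Φ : RTilde f →ₗ[ℂ] TotalCohomology f) = comparison f z' := rfl
  refine ⟨Φ, fun m => ?_, fun p hp h hh => ⟨⟨primitiveCochain h p,
    primitiveCochain_mem_cocycles f hp hh⟩, rfl, ?_⟩, fun k => ⟨z' k, hzu k, comparison_e hf k⟩⟩
  · rw [hΦ]
    refine le_antisymm (comparison_mem_range hf hns m) ?_
    rintro _ ⟨x, rfl⟩
    exact exists_comparison_eq hf hns hzu m x
  · exact (comparison_ofPoly hf hh).trans (polyClass_of_isHomogeneous hp hh)
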